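/- **Setting.** Let $L>0$, let $n\ge 1$, let $N$ be even, and let $v_1,\dots,v_n:\mathbb R\to\mathbb R$ be locally integrable. Put $K=\{2\pi(m+\tfrac12)/L: m\in\mathbb Z\}$ and $K_\otimes=\{(2\pi n m/L,b): m\in\mathbb Z,\ 1\le b\le n\}$. For $\bar a=(a,b)\in K_\otimes$ write $b(\bar a)=b$; box $b$ is the interval $((b-1)L/n,\,bL/n)$. *States.* The state $\int\chi(x_1,\dots,x_N)\,\phi^\dagger(x_1)\cdots\phi^\dagger(x_N)|0\rangle\,dx$ of a Bose field $\phi$ on $[0,L]$ is identified with its normalized symmetric wave function $\frac1{\sqrt{N!}}\sum_{\sigma\in\mathfrak S_N}\chi(x_{\sigma 1},\dots,x_{\sigma N})$; states with different particle numbers are orthogonal. The hardcore boson Hamiltonian $H_0$ is diagonal in the states $|\lambda\rangle$, $\lambda_1<\dots<\lambda_N$ in $K$, with $$\chi=\frac1{N!L^{N/2}}\sum_{\sigma\in\mathfrak S_N}(-1)^\sigma e^{i\sum_jx_j\lambda_{\sigma j}}\prod_{i<j}\mathrm{sgn}(x_i-x_j),$$ and eigenvalues $E(\lambda)=\sum_j\lambda_j^2$.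 For distinct $\bar a_1,\dots,\bar a_N\in K_\otimes$, of which $N_b$ lie in box $b$, the wavelet state $|\bar a_1,\dots,\bar a_N\rangle$ has $$\chi=\frac{(n/L)^{N/2}}{\prod_bN_b!}\sum_{\sigma}(-1)^\sigma e^{i\sum_jx_ja_{\sigma j}}\prod_{i<j,\ b(\bar a_i)=b(\bar a_j)}\mathrm{sgn}(x_i-x_j)\prod_j\mathbf 1_{x_j\in\text{box }b(\bar a_j)},$$ the sum being over the permutations $\sigma\in\mathfrak S_N$ with $b(\bar a_{\sigma j})=b(\bar a_j)$ for all $j$. (This state depends on the order of the labels through a sign.) *Evolution.* Let $\bar\alpha_1,\dots,\bar\alpha_N\in K_\otimes$ be distinct, and let $|\Psi(t)\rangle=\mathcal T\exp\big(-i\int_0^t(H_0+V(s))\,ds\big)|\bar\alpha_1,\dots,\bar\alpha_N\rangle$, where $V(s)=\sum_bv_b(s)\int_{\text{box }b}\phi^\dagger(x)\phi(x)\,dx$; that is, $\Psi$ is the continuous solution, with values in the symmetric square integrable functions on $(0,L)^N$, of $\Psi(t)=e^{-itH_0}\Psi(0)-i\int_0^te^{-i(t-s)H_0}V(s)\Psi(s)\,ds$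 with $\Psi(0)=|\bar\alpha_1,\dots,\bar\alpha_N\rangle$. *The function $\psi_t$.* For $\lambda\in K$ and $\bar a,\bar c\in K_\otimes$ let $$\varphi(\lambda,\bar a)=\frac{i\sqrt n}{L}\,\frac{1-e^{iL\lambda/n}}{\lambda-a}\,e^{-iLb(\bar a)\lambda/n},\qquad G_t(\bar a,\bar c)=\sum_{\lambda\in K}\varphi(\lambda,\bar a)^*\varphi(\lambda,\bar c)e^{-it\lambda^2},$$ $$U_t(\bar a,\bar c)=\sum_{\bar\gamma\in K_\otimes}G_{-t}(\bar a,\bar\gamma)v_{b(\bar\gamma)}(t)G_t(\bar\gamma,\bar c),\qquad \psi_t(\bar a,\bar c)=\sum_{\bar\gamma\in K_\otimes}G_t(\bar a,\bar\gamma)\tilde\psi_t(\bar\gamma,\bar c),$$ where $\tilde\psi$ is the solution, with columns $t\mapsto\tilde\psi_t(\cdot,\bar c)$ continuous in $\ell^2(K_\otimes)$, of $\partial_t\tilde\psi_t(\bar a,\bar c)=-i\sum_{\bar\nu\in K_\otimes}U_t(\bar a,\bar\nu)\tilde\psi_t(\bar\nu,\bar c)$, $\tilde\psi_0(\bar a,\bar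 c)=\delta_{\bar a,\bar c}$ (in integrated form). *The cumulative reduced density matrix.* For a box $b$ and $t\in\mathbb R$ let $$\rho_b^{\rm cumul}=\sum_{X,Y}|X\rangle\langle Y|\sum_{\beta,\gamma}\langle\beta|\Psi(t)\rangle\langle\Psi(t)|\gamma\rangle .$$ Here $X,Y$ run over the finite subsets of $K_\otimes$ localized in box $b$, and $\beta,\gamma$ over the finite subsets of $K_\otimes$ with $X\subset\beta$, $Y\subset\gamma$, $\beta\setminus X=\gamma\setminus Y$. In $|\beta\rangle$ the labels in $X$ are listed first, in the same order as in $|X\rangle$; in $|\gamma\rangle$ those in $Y$, in the same order as in $\langle Y|$; the common rest follows in the same order in both. **Theorem.** The solutions $\Psi$ and $\tilde\psi$ exist and are unique, and the inner sum over $\beta,\gamma$ converges absolutely for all $X,Y$ localized in box $b$. For all $M\ge 0$, all distinct $\bar x_1,\dots,\bar x_M\in K_\otimes$ and all distinct $\bar y_1,\dots,\bar y_M\in K_\otimes$, all localized in box $b$, $$\langle\bar x_1,\dots,\bar x_M|\rho_b^{\rm cumul}|\bar y_1,\dots,\bar y_M\rangle=\sum_{q_1,\dots,q_M=1}^N\det_{i,j=1,\dots,M}\big[\psi_t(\bar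 x_i,\bar\alpha_{q_i})\,\psi_t(\bar y_i,\bar\alpha_{q_j})^*\big].$$ If two families of distinct elements of $K_\otimes$ localized in box $b$ have different numbers of elements $M\ne M'$, then $\langle\bar x_1,\dots,\bar x_M|\rho_b^{\rm cumul}|\bar y_1,\dots,\bar y_{M'}\rangle=0$. -/

import Mathlib

open MeasureTheory
open scoped ENNReal ComplexConjugate Nat

noncomputable section

namespace HardcoreWavelet

/-! ### Momenta, boxes and wavelet labels

The system is `[0, L]`, cut into `n` boxes. Boxes are numbered from `0` here: the element `b` of
`Fin n` is the box number `b + 1`, that is, the interval `(b L / n, (b + 1) L / n)`. -/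

/-- A wavelet label: a box together with the integer `m` of the momentum `2 π n m / L`. The
(lexicographic) linear order is only used to enumerate finite sets of labels. -/
abbrev Wavelet (n : ℕ) : Type := Fin n ×ₗ ℤ

/-- The box index of a wavelet. -/
def Wavelet.box {n : ℕ} (a : Wavelet n) : Fin n := (ofLex a).1

/-- The momentum of a wavelet, an element of `{2 π n m / L : m ∈ ℤ}`. -/
def Wavelet.momentum (L : ℝ) {n : ℕ} (a : Wavelet n) : ℝ :=
  2 * Real.pi * n * (((ofLex a).2 : ℤ) : ℝ) / L

/-- The momenta of the whole ring (even particle number), `2 π (m + 1/2) / L`. -/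
def ringMomentum (L : ℝ) (m : ℤ) : ℝ := 2 * Real.pi * ((m : ℝ) + 1 / 2) / L

/-- The interior of box `b`. -/
def boxSet (L : ℝ) {n : ℕ} (b : Fin n) : Set ℝ :=
  Set.Ioo ((b : ℝ) * L / n) (((b : ℝ) + 1) * L / n)

/-! ### States of `N` bosons -/

/-- Lebesgue measure on `(0, L) ^ N`. -/
abbrev cubeMeasure (L : ℝ) (N : ℕ) : Measure (Fin N → ℝ) :=
  volume.restrict (Set.univ.pi fun _ => Set.Ioo (0 : ℝ) L)

/-- Square integrable wave functions of `N` particles on `(0, L)`. Bosonic states are the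
symmetric ones, see `IsBosonic`. -/
abbrev NSpace (L : ℝ) (N : ℕ) : Type := Lp ℂ 2 (cubeMeasure L N)

/-- The Hilbert sum over all particle numbers. -/
abbrev Fock (L : ℝ) : Type := lp (fun N : ℕ => NSpace L N) 2

/-- Symmetry under permutations of the particles. -/
def IsBosonic {L : ℝ} {N : ℕ} (f : NSpace L N) : Prop :=
  ∀ σ : Equiv.Perm (Fin N), ∀ᵐ x ∂(cubeMeasure L N), f (x ∘ σ) = f x

/-- The normalized symmetric wave function `√(N!) · Sym χ` of the state
`∫ χ(x₁, …, x_N) φ†(x₁) ⋯ φ†(x_N) |0⟩ dx` of a Bose field `φ`. -/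
def bosonize {N : ℕ} (χ : (Fin N → ℝ) → ℂ) (x : Fin N → ℝ) : ℂ :=
  ((Real.sqrt (N ! : ℝ) : ℝ) : ℂ)⁻¹ * ∑ σ : Equiv.Perm (Fin N), χ (x ∘ σ)

/-- The function `χ` of the eigenstate of the hardcore boson Hamiltonian `H₀` with ring momenta
`λ_j = 2 π (k j + 1/2) / L`. -/
def eigenChi (L : ℝ) {N : ℕ} (k : Fin N → ℤ) (x : Fin N → ℝ) : ℂ :=
  ((N ! : ℂ) * ((Real.sqrt L : ℝ) : ℂ) ^ N)⁻¹ *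
    (∑ σ : Equiv.Perm (Fin N), ((Equiv.Perm.sign σ : ℤ) : ℂ) *
      Complex.exp (Complex.I * ∑ j, (x j : ℂ) * (ringMomentum L (k (σ j)) : ℂ))) *
    ∏ i, ∏ j, if i < j then ((Real.sign (x i - x j) : ℝ) : ℂ) else 1

/-- The energy `∑ λ_j²`. -/
def energy (L : ℝ) {N : ℕ} (k : Fin N → ℤ) : ℝ := ∑ j, ringMomentum L (k j) ^ 2

open Classical in
/-- The function `χ` of the wavelet state with labels `a₁, …, a_N`: the product over the boxes of
the eigenfunctions of the boxes. The permutations that preserve the box labels are the elements of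
`∏_b 𝔖_{N_b}`. -/
def waveletChi (L : ℝ) {n N : ℕ} (a : Fin N → Wavelet n) (x : Fin N → ℝ) : ℂ :=
  ((Real.sqrt ((n : ℝ) / L) : ℝ) : ℂ) ^ N *
    (∏ b : Fin n, ((Finset.univ.filter fun j => (a j).box = b).card ! : ℂ))⁻¹ *
    (∑ σ ∈ Finset.univ.filter
        (fun σ : Equiv.Perm (Fin N) => ∀ j, (a (σ j)).box = (a j).box),
      ((Equiv.Perm.sign σ : ℤ) : ℂ) *
        Complex.exp (Complex.I * ∑ j, (x j : ℂ) * ((a (σ j)).momentum L : ℂ))) *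
    (∏ i, ∏ j, if i < j ∧ (a i).box = (a j).box
      then ((Real.sign (x i - x j) : ℝ) : ℂ) else 1) *
    ∏ j, (boxSet L (a j).box).indicator (fun _ => (1 : ℂ)) (x j)

theorem measurable_sign_sub {N : ℕ} (i j : Fin N) :
    Measurable fun x : Fin N → ℝ => ((Real.sign (x i - x j) : ℝ) : ℂ) := by
  have h : Measurable Real.sign := by
    unfold Real.sign
    refine Measurable.ite measurableSet_Iio measurable_const ?_
    exact Measurable.ite measurableSet_Ioi measurable_const measurable_const
  exact Complex.measurable_ofReal.comp
    (h.comp ((measurable_pi_apply i).sub (measurable_pi_apply j)))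

theorem norm_sign_le (r : ℝ) : ‖((Real.sign r : ℝ) : ℂ)‖ ≤ 1 := by
  rcases Real.sign_apply_eq r with h | h | h <;> simp [h]

theorem norm_phase_le {N : ℕ} (σ : Equiv.Perm (Fin N)) (x p : Fin N → ℝ) :
    ‖((Equiv.Perm.sign σ : ℤ) : ℂ) *
      Complex.exp (Complex.I * ∑ j, (x j : ℂ) * (p j : ℂ))‖ ≤ 1 := by
  have h : (Complex.I * ∑ j, (x j : ℂ) * (p j : ℂ))
      = ((∑ j, x j * p j : ℝ) : ℂ) * Complex.I := by
    push_cast; ring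
  rw [norm_mul, h, Complex.norm_exp_ofReal_mul_I, mul_one]
  rcases Int.units_eq_one_or (Equiv.Perm.sign σ) with h | h <;> simp [h]

theorem memLp_bosonize (L : ℝ) {N : ℕ} {χ : (Fin N → ℝ) → ℂ} (hm : Measurable χ)
    (C : ℝ) (hC : ∀ x, ‖χ x‖ ≤ C) : MemLp (bosonize χ) 2 (cubeMeasure L N) := by
  have : IsFiniteMeasure (cubeMeasure L N) := by
    refine ⟨?_⟩
    rw [Measure.restrict_apply_univ, volume_pi_pi]
    exact ENNReal.prod_lt_top fun _ _ => by simp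
  refine MemLp.of_bound (C := ‖((Real.sqrt (N ! : ℝ) : ℝ) : ℂ)⁻¹‖ *
    ∑ _σ : Equiv.Perm (Fin N), C) ?_ (Filter.Eventually.of_forall fun x => ?_)
  · refine Measurable.aestronglyMeasurable (measurable_const.mul ?_)
    refine Finset.measurable_sum _ fun σ _ => hm.comp ?_
    exact measurable_pi_lambda _ fun j => measurable_pi_apply _
  · unfold bosonize
    rw [norm_mul]
    gcongr
    exact (norm_sum_le _ _).trans (Finset.sum_le_sum fun σ _ => hC _)

theorem memLp_eigen (L : ℝ) {N : ℕ} (k : Fin N → ℤ) :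
    MemLp (bosonize (eigenChi L k)) 2 (cubeMeasure L N) := by
  refine memLp_bosonize L ?_ (‖((N ! : ℂ) * ((Real.sqrt L : ℝ) : ℂ) ^ N)⁻¹‖ *
    (∑ _σ : Equiv.Perm (Fin N), (1 : ℝ)) * 1) fun x => ?_
  · unfold eigenChi
    refine (measurable_const.mul (Finset.measurable_sum _ fun σ _ => ?_)).mul
      (Finset.measurable_prod _ fun i _ => Finset.measurable_prod _ fun j _ => ?_)
    · fun_prop
    · split_ifs
      · exact measurable_sign_sub i j
      · exact measurable_const
  · unfold eigenChi
    rw [norm_mul, norm_mul]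
    gcongr
    · exact (norm_sum_le _ _).trans (Finset.sum_le_sum fun σ _ => norm_phase_le σ x _)
    · rw [norm_prod]
      refine Finset.prod_le_one (fun _ _ => norm_nonneg _) fun i _ => ?_
      rw [norm_prod]
      refine Finset.prod_le_one (fun _ _ => norm_nonneg _) fun j _ => ?_
      split_ifs
      · exact norm_sign_le _
      · simp

open Classical in
theorem memLp_wavelet (L : ℝ) {n N : ℕ} (a : Fin N → Wavelet n) :
    MemLp (bosonize (waveletChi L a)) 2 (cubeMeasure L N) := by
  refine memLp_bosonize L ?_ (‖((Real.sqrt ((n : ℝ) / L) : ℝ) : ℂ) ^ N‖ *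
    ‖(∏ b : Fin n, ((Finset.univ.filter fun j => (a j).box = b).card ! : ℂ))⁻¹‖ *
    (∑ _σ ∈ Finset.univ.filter
        (fun σ : Equiv.Perm (Fin N) => ∀ j, (a (σ j)).box = (a j).box), (1 : ℝ)) * 1 * 1)
      fun x => ?_
  · unfold waveletChi
    refine ((measurable_const.mul (Finset.measurable_sum _ fun σ _ => ?_)).mul
      (Finset.measurable_prod _ fun i _ => Finset.measurable_prod _ fun j _ => ?_)).mul
      (Finset.measurable_prod _ fun j _ => ?_)
    · fun_prop
    · split_ifs
      · exact measurable_sign_sub i j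
      · exact measurable_const
    · exact (measurable_const.indicator measurableSet_Ioo).comp (measurable_pi_apply j)
  · unfold waveletChi
    rw [norm_mul, norm_mul, norm_mul, norm_mul]
    gcongr
    · exact (norm_sum_le _ _).trans (Finset.sum_le_sum fun σ _ => norm_phase_le σ x _)
    · rw [norm_prod]
      refine Finset.prod_le_one (fun _ _ => norm_nonneg _) fun i _ => ?_
      rw [norm_prod]
      refine Finset.prod_le_one (fun _ _ => norm_nonneg _) fun j _ => ?_
      split_ifs
      · exact norm_sign_le _
      · simp
    · rw [norm_prod]
      refine Finset.prod_le_one (fun _ _ => norm_nonneg _) fun j _ => ?_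
      by_cases h : x j ∈ boxSet L (a j).box <;> simp [h]

/-- The eigenstate `|λ⟩` of `H₀`. -/
def eigenState (L : ℝ) {N : ℕ} (k : Fin N → ℤ) : NSpace L N := (memLp_eigen L k).toLp _

/-- The wavelet state `|a⟩`. It is antisymmetric in the labels of each box. -/
def waveletState (L : ℝ) {n N : ℕ} (a : Fin N → Wavelet n) : NSpace L N :=
  (memLp_wavelet L a).toLp _

/-- The wavelet state as a vector of the sum over all particle numbers. -/
def ket (L : ℝ) {n N : ℕ} (a : Fin N → Wavelet n) : Fock L := lp.single 2 N (waveletState L a)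

/-! ### Time evolution -/

open Classical in
/-- The potential `V = ∑_b v_b ∫_{box b} φ†(x) φ(x) dx` at time `s`, as a multiplication operator:
`∑_j v_{box of x_j}(s)`. -/
def potential (L : ℝ) {n N : ℕ} (v : Fin n → ℝ → ℝ) (s : ℝ) (x : Fin N → ℝ) : ℝ :=
  ∑ j, ∑ b : Fin n, if x j ∈ boxSet L b then v b s else 0

/-- The matrix element `⟨λ|V(s)|f⟩`. -/
def potentialElement (L : ℝ) {n N : ℕ} (v : Fin n → ℝ → ℝ) (s : ℝ) (k : Fin N → ℤ)
    (f : NSpace L N) : ℂ :=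
  ∫ x, conj (bosonize (eigenChi L k) x) * (potential L v s x : ℂ) * f x ∂(cubeMeasure L N)

/-- `Ψ(t) = U(t)|α⟩` with `U(t) = 𝒯 exp(-i ∫₀ᵗ (H₀ + V(s)) ds)`. The operator `H₀` is diagonal in
the basis `|λ⟩`, with eigenvalues `E(λ)`, and `|α⟩` is in general not in its domain; so, as usual,
the evolution `i ∂ₜΨ = (H₀ + V(t))Ψ` is understood through Duhamel's formula
`Ψ(t) = e^{-itH₀}Ψ(0) - i ∫₀ᵗ e^{-i(t-s)H₀} V(s)Ψ(s) ds`, written in the basis `|λ⟩`. -/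
structure IsEvolution (L : ℝ) {n N : ℕ} (v : Fin n → ℝ → ℝ) (α : Fin N → Wavelet n)
    (Ψ : ℝ → NSpace L N) : Prop where
  continuous : Continuous Ψ
  bosonic : ∀ t, IsBosonic (Ψ t)
  initial : Ψ 0 = waveletState L α
  integrable : ∀ k : Fin N → ℤ, StrictMono k → ∀ t : ℝ,
    IntervalIntegrable (fun s => potentialElement L v s k (Ψ s)) volume 0 t
  duhamel : ∀ k : Fin N → ℤ, StrictMono k → ∀ t : ℝ,
    inner ℂ (eigenState L k) (Ψ t) =
      Complex.exp (-Complex.I * t * energy L k) * inner ℂ (eigenState L k) (Ψ 0) -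
      Complex.I * ∫ s in (0 : ℝ)..t,
        Complex.exp (-Complex.I * (t - s) * energy L k) * potentialElement L v s k (Ψ s)

/-! ### The function `ψ_t` -/

/-- `φ(λ, a) = (i √n / L) (1 - e^{iLλ/n}) / (λ - a) e^{-iL b(a) λ/n}`, where `b(a)` is numbered
from `1`. -/
def overlap (L : ℝ) {n : ℕ} (lam : ℝ) (a : Wavelet n) : ℂ :=
  Complex.I * ((Real.sqrt n : ℝ) : ℂ) / (L : ℂ) *
    ((1 - Complex.exp (Complex.I * L * lam / n)) / ((lam : ℂ) - (a.momentum L : ℂ))) *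
    Complex.exp (-Complex.I * L * (((a.box : ℕ) : ℂ) + 1) / n * lam)

/-- `G_t(a, c) = ∑_λ φ(λ, a)^* φ(λ, c) e^{-itλ²}`. -/
def green (L : ℝ) {n : ℕ} (t : ℝ) (a c : Wavelet n) : ℂ :=
  ∑' m : ℤ, conj (overlap L (ringMomentum L m) a) * overlap L (ringMomentum L m) c *
    Complex.exp (-Complex.I * t * (ringMomentum L m : ℂ) ^ 2)

/-- `U_t(a, c) = ∑_γ G_{-t}(a, γ) v_{b(γ)}(t) G_t(γ, c)`. -/
def interaction (L : ℝ) {n : ℕ} (v : Fin n → ℝ → ℝ) (t : ℝ) (a c : Wavelet n) : ℂ :=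
  ∑' g : Wavelet n, green L (-t) a g * (v g.box t : ℂ) * green L t g c

/-- `ψ̃` solves `∂ₜψ̃_t(a, c) = -i ∑_ν U_t(a, ν) ψ̃_t(ν, c)`, `ψ̃_0(a, c) = δ_{a,c}`. As the
potentials are only locally integrable in time, the equation is written in integrated form. For
fixed `c`, the column `ψ̃_t(·, c)` is a continuous function of `t` with values in `ℓ²`. -/
structure IsPsiTilde (L : ℝ) {n : ℕ} (v : Fin n → ℝ → ℝ)
    (ψt : ℝ → Wavelet n → Wavelet n → ℂ) : Prop where
  column : ∀ c : Wavelet n, ∃ u : ℝ → lp (fun _ : Wavelet n => ℂ) 2,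
    Continuous u ∧ ∀ t a, u t a = ψt t a c
  integrable : ∀ (a c : Wavelet n) (t : ℝ),
    IntervalIntegrable (fun s => ∑' g : Wavelet n, interaction L v s a g * ψt s g c) volume 0 t
  equation : ∀ (a c : Wavelet n) (t : ℝ),
    ψt t a c = (if a = c then 1 else 0) -
      Complex.I * ∫ s in (0 : ℝ)..t, ∑' g : Wavelet n, interaction L v s a g * ψt s g c

/-- `ψ_t(a, c) = ∑_γ G_t(a, γ) ψ̃_t(γ, c)`. -/
def psi (L : ℝ) {n : ℕ} (ψt : ℝ → Wavelet n → Wavelet n → ℂ) (t : ℝ) (a c : Wavelet n) : ℂ :=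
  ∑' g : Wavelet n, green L t a g * ψt t g c

/-! ### The cumulative reduced density matrix -/

/-- The increasing enumeration of a finite set of wavelets. -/
def enum {n : ℕ} (X : Finset (Wavelet n)) : Fin X.card → Wavelet n := X.orderEmbOfFin rfl

/-- The wavelet state with label set `X ∪ R` (for disjoint `X`, `R`), in which the labels of `X`
are listed first. -/
def ketFirst (L : ℝ) {n : ℕ} (X R : Finset (Wavelet n)) : Fock L :=
  ket L (Fin.append (enum X) (enum R))

/-- The pairs `(β, γ)` of finite sets with `X ⊆ β`, `Y ⊆ γ`, `β \ X = γ \ Y`. -/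
def Completion {n : ℕ} (X Y : Finset (Wavelet n)) : Type :=
  {p : Finset (Wavelet n) × Finset (Wavelet n) //
    X ⊆ p.1 ∧ Y ⊆ p.2 ∧ p.1 \ X = p.2 \ Y}

/-- `⟨β|Ψ⟩⟨Ψ|γ⟩`. The sign of a wavelet state depends on the order of its labels: in `|β⟩` those of
`X` come first, in `|γ⟩` those of `Y`, followed by the common rest in the same order. -/
def cumulTerm {L : ℝ} {n : ℕ} (Ψ : Fock L) (X Y : Finset (Wavelet n)) (p : Completion X Y) : ℂ :=
  inner ℂ (ketFirst L X (p.1.1 \ X)) Ψ * inner ℂ Ψ (ketFirst L Y (p.1.2 \ Y))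

/-- The finite sets of wavelets that are localized in box `b`. -/
def InBox {n : ℕ} (b : Fin n) : Type := {X : Finset (Wavelet n) // ∀ a ∈ X, a.box = b}

/-- The matrix element `⟨f|ρ_b^cumul|g⟩`, where
`ρ_b^cumul = ∑_{X, Y in box b} |X⟩⟨Y| ∑_{β, γ} ⟨β|Ψ⟩⟨Ψ|γ⟩`. -/
def rhoCumul {L : ℝ} {n : ℕ} (Ψ : Fock L) (b : Fin n) (f g : Fock L) : ℂ :=
  ∑' P : InBox b × InBox b,
    inner ℂ f (ket L (enum P.1.1)) * inner ℂ (ket L (enum P.2.1)) g *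
      ∑' p : Completion P.1.1 P.2.1, cumulTerm Ψ P.1.1 P.2.1 p

end HardcoreWavelet

end

open MeasureTheory
open scoped ENNReal ComplexConjugate Nat

noncomputable section

namespace HardcoreWavelet

/-! ### Primitives of locally integrable functions -/

section Primitive

variable {E F G : Type*} [NormedAddCommGroup E] [NormedSpace ℝ E]
  [NormedAddCommGroup F] [NormedSpace ℝ F] [NormedAddCommGroup G] [NormedSpace ℝ G]

/-! Multiplication by `pairSign` (the Girardeau map from hardcore bosons to free fermions) turns the
eigenstates of H₀ into Slater determinants of plane waves of the ring. The wavelet states become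
Slater determinants as well, up to a sign: for points in different boxes sgn(x_i - x_j) depends only
on the order of the boxes, so the factors absent from the definition combine into a constant
`boxSign`; symmetrization restores the full determinant and cancels the factorials N_b!
(`waveletState_eq`).

In this picture both H₀ and V are sums of one-particle operators, so a Slater determinant remains
one and each orbital moves by itself. In the interaction picture the one-particle generator is
bounded by the locally integrable function ∑ |v_b|. The orbital equation is thus a linear Volterra
equation, solved by the Dyson series (`volterra_exists`) and unique by a Gronwall iteration
(`volterra_unique`). Column c of ψ̃ is the list of wavelet coordinates of the orbit starting at c,
and ψ_t(a, c) is the coordinate at a of the same orbit after the free propagator is applied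
(`IsPsiTilde.psi_eq`). The product rule for determinants of absolutely continuous functions then
gives Duhamel's formula for the determinant of the moving orbitals (`isEvolution_evolved`).
Uniqueness among symmetric states follows from completeness of the eigenstates, Bessel's inequality
and the same Gronwall iteration (`IsEvolution.unique`).

Consequently ⟨β|Ψ(t)⟩ is, up to sign, the determinant of ψ_t(β_i, α_j). If X and Y lie in one box
and have equally many elements, adding the same rest R to both gives the same box sign, so all signs
cancel from the product of two overlaps. The orbitals stay orthonormal, and Parseval gives ∑_a
ψ_t(a, α_p) ψ_t(a, α_q)^* = δ_{pq}. Hence summing det · conj det over R contracts the common rows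
and leaves det[∑_q ψ_t(x_i, α_q) ψ_t(y_j, α_q)^*] (`hasSum_finset_det_mul_det`); sets R that meet X
or Y contribute zero, having a repeated row. Expanding this determinant in the orbital indices gives
the claimed formula (`sum_det_eq_det`). Unequal label numbers give zero by orthogonality of
different particle numbers. -/

/-- `u` is a primitive of the locally integrable function `f`. -/
structure IsPrimitive (u f : ℝ → E) : Prop where
  locallyIntegrable : LocallyIntegrable f
  eq_add_integral : ∀ t, u t = u 0 + ∫ s in (0 : ℝ)..t, f s

theorem _root_.MeasureTheory.LocallyIntegrable.intervalIntegrable' {E : Type*}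
    [NormedAddCommGroup E] {f : ℝ → E}
    (hf : LocallyIntegrable f) (a b : ℝ) : IntervalIntegrable f volume a b :=
  intervalIntegrable_iff.2
    ((hf.integrableOn_isCompact isCompact_uIcc).mono_set Set.uIoc_subset_uIcc)

theorem IsPrimitive.sub_eq {u f : ℝ → E} (h : IsPrimitive u f) (s t : ℝ) :
    u t - u s = ∫ r in s..t, f r := by
  rw [h.eq_add_integral t, h.eq_add_integral s,
    ← intervalIntegral.integral_add_adjacent_intervals (h.1.intervalIntegrable' 0 s)
      (h.1.intervalIntegrable' s t)]
  abel

theorem IsPrimitive.continuous {u f : ℝ → E} (h : IsPrimitive u f) : Continuous u := by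
  rw [funext h.eq_add_integral]
  exact continuous_const.add
    (intervalIntegral.continuous_primitive (fun a b => h.1.intervalIntegrable' a b) 0)

theorem IsPrimitive.ae_hasDerivAt [CompleteSpace E] {u f : ℝ → E} (h : IsPrimitive u f) :
    ∀ᵐ t, HasDerivAt u (f t) t := by
  filter_upwards [LocallyIntegrable.ae_hasDerivAt_integral h.1] with t ht
  rw [funext h.eq_add_integral]
  exact (ht 0).const_add _

theorem isPrimitive_integral {f : ℝ → E} (hf : LocallyIntegrable f) (c : E) :
    IsPrimitive (fun t => c + ∫ s in (0 : ℝ)..t, f s) f :=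
  ⟨hf, fun t => by simp⟩

theorem IsPrimitive.norm_sub_le {u f : ℝ → E} (h : IsPrimitive u f) (s t : ℝ) :
    ‖u t - u s‖ ≤ |∫ r in s..t, ‖f r‖| := by
  rw [h.sub_eq]
  exact intervalIntegral.norm_integral_le_abs_integral_norm

theorem absolutelyContinuousOnInterval_of_dist_le {X : Type*} [PseudoMetricSpace X]
    {u : ℝ → X} {W : ℝ → ℝ} {a b K : ℝ}
    (hW : AbsolutelyContinuousOnInterval W a b)
    (h : ∀ x ∈ Set.uIcc a b, ∀ y ∈ Set.uIcc a b, dist (u x) (u y) ≤ K * dist (W x) (W y)) :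
    AbsolutelyContinuousOnInterval u a b := by
  unfold AbsolutelyContinuousOnInterval at hW ⊢
  refine squeeze_zero' ?_ ?_ (by simpa using hW.const_mul K)
  · exact Filter.Eventually.of_forall fun _ => Finset.sum_nonneg fun i hi => dist_nonneg
  rw [Filter.eventually_inf_principal]
  filter_upwards with ⟨m, I⟩ hI
  rw [Finset.mul_sum]
  refine Finset.sum_le_sum fun i hi => ?_
  exact h _ (hI.1 i hi).1 _ (hI.1 i hi).2

theorem IsPrimitive.absolutelyContinuousOnInterval {u f : ℝ → E} (h : IsPrimitive u f) (a b : ℝ) :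
    AbsolutelyContinuousOnInterval u a b := by
  have hn : LocallyIntegrable fun s => ‖f s‖ := h.1.mono h.1.aestronglyMeasurable.norm (by simp)
  refine absolutelyContinuousOnInterval_of_dist_le (K := 1)
    ((hn.intervalIntegrable' a b).absolutelyContinuousOnInterval_intervalIntegral
      (c := a) Set.left_mem_uIcc) fun x _ y _ => ?_
  rw [one_mul, dist_eq_norm, Real.dist_eq,
    intervalIntegral.integral_interval_sub_left (hn.intervalIntegrable' _ _)
      (hn.intervalIntegrable' _ _)]
  exact h.norm_sub_le y x

theorem locallyIntegrable_bilin_continuous (B : E →L[ℝ] F →L[ℝ] G) {f : ℝ → E} {g : ℝ → F}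
    (hf : LocallyIntegrable f) (hg : Continuous g) : LocallyIntegrable fun s => B (f s) (g s) := by
  rw [locallyIntegrable_iff] at hf ⊢
  intro k hk
  obtain ⟨C, hC⟩ := hk.exists_bound_of_continuousOn hg.continuousOn
  have hm : AEStronglyMeasurable (fun s => B (f s) (g s)) (volume.restrict k) :=
    B.aestronglyMeasurable_comp₂ (hf k hk).1 hg.aestronglyMeasurable.restrict
  refine Integrable.mono' (((hf k hk).norm.const_mul ‖B‖).mul_const C) hm ?_
  filter_upwards [ae_restrict_mem hk.measurableSet] with s hs
  refine (B.le_opNorm₂ _ _).trans ?_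
  gcongr
  exact hC s hs

/-- The product rule for vector-valued absolutely continuous functions. It yields conservation of
inner products and the derivative of a determinant when the potentials are merely locally integrable
in time. -/
theorem IsPrimitive.bilin [CompleteSpace E] [CompleteSpace F] [CompleteSpace G]
    (B : E →L[ℝ] F →L[ℝ] G) {u f : ℝ → E} {w g : ℝ → F}
    (hu : IsPrimitive u f) (hw : IsPrimitive w g) :
    IsPrimitive (fun t => B (u t) (w t)) fun t => B (u t) (g t) + B (f t) (w t) := by
  have h1 : LocallyIntegrable fun t => B (f t) (w t) :=
    locallyIntegrable_bilin_continuous B hu.1 hw.continuous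
  have h2 : LocallyIntegrable fun t => B (u t) (g t) :=
    locallyIntegrable_bilin_continuous B.flip hw.1 hu.continuous
  have h := isPrimitive_integral (h2.add h1) (0 : G)
  refine ⟨h2.add h1, fun t => ?_⟩
  set P := fun t : ℝ => (0 : G) + ∫ s in (0 : ℝ)..t,
    ((fun t => B (u t) (g t)) + fun t => B (f t) (w t)) s with hP
  have hac : AbsolutelyContinuousOnInterval (fun t => B (u t) (w t)) 0 t := by
    have a1 := hu.absolutelyContinuousOnInterval 0 t
    have a2 := hw.absolutelyContinuousOnInterval 0 t
    obtain ⟨C, hC⟩ := a1.exists_bound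
    obtain ⟨D, hD⟩ := a2.exists_bound
    unfold AbsolutelyContinuousOnInterval at a1 a2 ⊢
    refine squeeze_zero' ?_ ?_
      (by simpa using (a2.const_mul (‖B‖ * C)).add (a1.const_mul (‖B‖ * D)))
    · exact Filter.Eventually.of_forall fun _ => Finset.sum_nonneg fun i hi => dist_nonneg
    rw [Filter.eventually_inf_principal]
    filter_upwards with ⟨m, I⟩ hI
    simp only [Finset.mul_sum, ← Finset.sum_add_distrib]
    refine Finset.sum_le_sum fun i hi => ?_
    set x := (I i).1
    set y := (I i).2
    have e : B (u x) (w x) - B (u y) (w y) = B (u x) (w x - w y) + B (u x - u y) (w y) := by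
      simp
    rw [dist_eq_norm, dist_eq_norm, dist_eq_norm, e]
    refine (norm_add_le _ _).trans (add_le_add ?_ ?_)
    · refine (B.le_opNorm₂ _ _).trans ?_
      gcongr
      exact hC _ (hI.1 i hi).1
    · refine (B.le_opNorm₂ _ _).trans ?_
      rw [mul_right_comm]
      gcongr
      exact hD _ (hI.1 i hi).2
  -- The product and the integral of its candidate derivative are both absolutely continuous, and
  -- their difference has derivative zero almost everywhere; so the difference is constant on the
  -- interval.
  obtain ⟨C, hC⟩ := (hac.sub (h.absolutelyContinuousOnInterval 0 t)).const_of_ae_hasDerivAt_zero (by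
    filter_upwards [hu.ae_hasDerivAt, hw.ae_hasDerivAt, h.ae_hasDerivAt] with s e1 e2 e3 _
    have e4 := (B.hasDerivAt_of_bilinear (u := u) (v := w) (fun _ => e1) fun _ => e2).sub e3
    convert! e4 using 1
    simp)
  have c0 := hC 0 Set.left_mem_uIcc
  have ct := hC t Set.right_mem_uIcc
  simp only [Pi.sub_apply, hP, intervalIntegral.integral_same, Pi.add_apply] at c0 ct
  rw [← c0] at ct
  simp only [zero_add, sub_zero] at ct
  rw [← ct]
  abel

theorem IsPrimitive.inner {H : Type*} [NormedAddCommGroup H] [InnerProductSpace ℂ H]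
    [CompleteSpace H] {u f w g : ℝ → H} (hu : IsPrimitive u f) (hw : IsPrimitive w g) :
    IsPrimitive (fun t => inner ℂ (u t) (w t))
      fun t => inner ℂ (u t) (g t) + inner ℂ (f t) (w t) := by
  exact IsPrimitive.bilin (isBoundedBilinearMap_inner (E := H) (𝕜 := ℂ)).toContinuousLinearMap hu hw

theorem IsPrimitive.mul {𝕜 : Type*} [RCLike 𝕜] {u f w g : ℝ → 𝕜} (hu : IsPrimitive u f)
    (hw : IsPrimitive w g) :
    IsPrimitive (fun t => u t * w t) fun t => u t * g t + f t * w t :=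
  IsPrimitive.bilin (ContinuousLinearMap.mul ℝ 𝕜) hu hw

theorem IsPrimitive.clm [CompleteSpace E] [CompleteSpace F] (A : E →L[ℝ] F)
    {u f : ℝ → E} (hu : IsPrimitive u f) :
    IsPrimitive (fun t => A (u t)) fun t => A (f t) := by
  refine ⟨?_, fun t => ?_⟩
  · have := hu.1
    rw [locallyIntegrable_iff] at this ⊢
    exact fun k hk => A.integrable_comp (this k hk)
  · rw [hu.eq_add_integral t, map_add, A.intervalIntegral_comp_comm (hu.1.intervalIntegrable' _ _)]

theorem isPrimitive_const (c : E) : IsPrimitive (fun _ : ℝ => c) fun _ => 0 :=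
  ⟨locallyIntegrable_const _, fun t => by simp⟩

theorem IsPrimitive.add {u f w g : ℝ → E} (hu : IsPrimitive u f) (hw : IsPrimitive w g) :
    IsPrimitive (fun t => u t + w t) fun t => f t + g t := by
  refine ⟨hu.1.add hw.1, fun t => ?_⟩
  rw [intervalIntegral.integral_add (hu.1.intervalIntegrable' _ _) (hw.1.intervalIntegrable' _ _),
    hu.eq_add_integral t, hw.eq_add_integral t]
  abel

theorem IsPrimitive.sum {ι : Type*} (s : Finset ι) {u f : ι → ℝ → E}
    (h : ∀ i ∈ s, IsPrimitive (u i) (f i)) :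
    IsPrimitive (fun t => ∑ i ∈ s, u i t) fun t => ∑ i ∈ s, f i t := by
  classical
  induction s using Finset.induction_on with
  | empty => simpa using isPrimitive_const (0 : E)
  | insert i s hi ih =>
    simp only [Finset.sum_insert hi]
    exact (h i (by simp)).add (ih fun j hj => h j (by simp [hj]))

theorem IsPrimitive.const_mul {u f : ℝ → ℂ} (c : ℂ) (hu : IsPrimitive u f) :
    IsPrimitive (fun t => c * u t) fun t => c * f t := by
  simpa using (isPrimitive_const c).mul hu

open Classical in
theorem IsPrimitive.prod {ι : Type*} (s : Finset ι) {u f : ι → ℝ → ℂ}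
    (h : ∀ i ∈ s, IsPrimitive (u i) (f i)) :
    IsPrimitive (fun t => ∏ i ∈ s, u i t)
      fun t => ∑ i ∈ s, ∏ j ∈ s, if j = i then f j t else u j t := by
  induction s using Finset.induction_on with
  | empty => simpa using isPrimitive_const (1 : ℂ)
  | insert i s hi ih =>
    have h1 := (h i (by simp)).mul (ih fun j hj => h j (by simp [hj]))
    convert! h1 using 1
    · funext t; rw [Finset.prod_insert hi]
    · funext t
      rw [Finset.sum_insert hi, add_comm]
      congr 1
      · rw [Finset.mul_sum]
        refine Finset.sum_congr rfl fun k hk => ?_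
        have hik : i ≠ k := fun e => hi (e ▸ hk)
        rw [Finset.prod_insert hi, if_neg hik]
      · rw [Finset.prod_insert hi, if_pos rfl]
        congr 1
        refine Finset.prod_congr rfl fun k hk => ?_
        have hik : k ≠ i := fun e => hi (e ▸ hk)
        rw [if_neg hik]

end Primitive

/-! ### Linear Volterra equations with integrable kernels -/

section Volterra

/-- Since `w` need not be continuous, the chain rule for powers of its integral is replaced by
repeated use of the product rule. -/
theorem isPrimitive_pow {w : ℝ → ℝ} (hw : LocallyIntegrable w) (k : ℕ) :
    IsPrimitive (fun t => (∫ s in (0 : ℝ)..t, w s) ^ (k + 1))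
      fun t => (k + 1) * (w t * (∫ s in (0 : ℝ)..t, w s) ^ k) := by
  have h0 : IsPrimitive (fun t => ∫ s in (0 : ℝ)..t, w s) w := by
    simpa using isPrimitive_integral hw 0
  induction k with
  | zero => simpa using h0
  | succ k ih =>
    convert! ih.mul h0 using 1
    funext t
    push_cast
    ring

/-- One Picard step raises the order of the factorial bound by one. The two signs of `t` are
separate because the integral of `w` has the sign of the endpoint, which decides how the absolute
values unfold. -/
theorem norm_integral_le_pow {E : Type*} [NormedAddCommGroup E] [NormedSpace ℝ E]
    {w : ℝ → ℝ} (hw : LocallyIntegrable w) (hw0 : ∀ s, 0 ≤ w s) {f : ℝ → E} {C t : ℝ} {k : ℕ}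
    (hf : ∀ s ∈ Set.uIoc 0 t, ‖f s‖ ≤ w s * (C * (|∫ r in (0 : ℝ)..s, w r| ^ k / k !))) :
    ‖∫ s in (0 : ℝ)..t, f s‖ ≤ C * (|∫ s in (0 : ℝ)..t, w s| ^ (k + 1) / (k + 1)!) := by
  set W : ℝ → ℝ := fun s => ∫ r in (0 : ℝ)..s, w r with hWdef
  have hP := isPrimitive_pow hw k
  have hWc : Continuous W := intervalIntegral.continuous_primitive
    (fun a b => hw.intervalIntegrable' a b) 0
  have key : ∫ s in (0 : ℝ)..t, w s * W s ^ k = W t ^ (k + 1) / (k + 1) := by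
    have := hP.eq_add_integral t
    simp only [intervalIntegral.integral_same, intervalIntegral.integral_const_mul] at this
    rw [zero_pow (by simp), zero_add] at this
    rw [hWdef]; simp only
    rw [this]
    field_simp
  have hfac : ((k + 1)! : ℝ) = (k + 1) * k ! := by rw [Nat.factorial_succ]; push_cast; ring
  have hki : (k ! : ℝ) ≠ 0 := by positivity
  have hint : LocallyIntegrable fun s => w s * (C * (|W s| ^ k / k !)) := by
    refine locallyIntegrable_bilin_continuous (ContinuousLinearMap.mul ℝ ℝ) hw ?_
    fun_prop
  rcases le_total 0 t with ht | ht
  · rw [Set.uIoc_of_le ht] at hf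
    refine (intervalIntegral.norm_integral_le_of_norm_le ht
      (Filter.Eventually.of_forall hf) (hint.intervalIntegrable' _ _)).trans ?_
    have hW0 : ∀ s, 0 ≤ s → 0 ≤ W s := fun s hs =>
      intervalIntegral.integral_nonneg hs fun r _ => hw0 r
    have e : ∫ s in (0 : ℝ)..t, w s * (C * (|W s| ^ k / k !)) =
        ∫ s in (0 : ℝ)..t, (C / k !) * (w s * W s ^ k) := by
      refine intervalIntegral.integral_congr fun s hs => ?_
      rw [Set.uIcc_of_le ht] at hs
      simp only [abs_of_nonneg (hW0 s hs.1)]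
      ring
    rw [e, intervalIntegral.integral_const_mul, key, abs_of_nonneg (hW0 t ht), hfac]
    apply le_of_eq
    field_simp
  · rw [Set.uIoc_of_ge ht] at hf
    rw [intervalIntegral.integral_symm, norm_neg]
    refine (intervalIntegral.norm_integral_le_of_norm_le ht
      (Filter.Eventually.of_forall hf) (hint.intervalIntegrable' _ _)).trans ?_
    have hW0 : ∀ s, s ≤ 0 → W s ≤ 0 := fun s hs => by
      rw [hWdef]; simp only
      rw [intervalIntegral.integral_symm]
      simpa using intervalIntegral.integral_nonneg hs fun r _ => hw0 r
    have e : ∫ s in t..(0 : ℝ), w s * (C * (|W s| ^ k / k !)) =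
        ∫ s in t..(0 : ℝ), (C / k ! * (-1) ^ k) * (w s * W s ^ k) := by
      refine intervalIntegral.integral_congr fun s hs => ?_
      rw [Set.uIcc_of_le ht] at hs
      simp only [abs_of_nonpos (hW0 s hs.2), neg_pow (W s) k]
      ring
    rw [e, intervalIntegral.integral_const_mul, intervalIntegral.integral_symm, key,
      abs_of_nonpos (hW0 t ht), hfac, neg_pow (W t) (k + 1), pow_succ (-1 : ℝ) k]
    apply le_of_eq
    field_simp

/-- Gronwall's lemma by iteration: feeding a bound for `D` back into the inequality gives C |W|^k /
k! for every k, where W is the integral of `w`, and this tends to zero. -/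
theorem eq_zero_of_le_integral {w : ℝ → ℝ} (hw : LocallyIntegrable w) (hw0 : ∀ s, 0 ≤ w s)
    {D : ℝ → ℝ} (hD : Continuous D) (hD0 : ∀ t, 0 ≤ D t)
    (h : ∀ t, D t ≤ |∫ s in (0 : ℝ)..t, w s * D s|) (t : ℝ) : D t = 0 := by
  obtain ⟨C, hC⟩ := (isCompact_uIcc (a := (0 : ℝ)) (b := t)).exists_bound_of_continuousOn
    hD.continuousOn
  have hb : ∀ k : ℕ, ∀ s ∈ Set.uIcc 0 t, D s ≤ C * (|∫ r in (0 : ℝ)..s, w r| ^ k / k !) := by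
    intro k
    induction k with
    | zero => intro s hs; simpa using (le_abs_self _).trans (hC s hs)
    | succ k ih =>
      intro s hs
      refine (h s).trans (norm_integral_le_pow (E := ℝ) hw hw0 fun r hr => ?_)
      rw [Real.norm_eq_abs, abs_of_nonneg (mul_nonneg (hw0 r) (hD0 r))]
      refine mul_le_mul_of_nonneg_left (ih r ?_) (hw0 r)
      exact Set.uIcc_subset_uIcc Set.left_mem_uIcc hs (Set.uIoc_subset_uIcc hr)
  have hlim : Filter.Tendsto (fun k : ℕ => C * (|∫ r in (0 : ℝ)..t, w r| ^ k / k !))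
      Filter.atTop (nhds 0) := by
    simpa using (FloorSemiring.tendsto_pow_div_factorial_atTop
      (|∫ r in (0 : ℝ)..t, w r|)).const_mul C
  exact le_antisymm (ge_of_tendsto' hlim fun k => hb k t Set.right_mem_uIcc) (hD0 t)

variable {H : Type*} [NormedAddCommGroup H] [NormedSpace ℂ H]
  {B : ℝ → H →L[ℂ] H} {w : ℝ → ℝ}

theorem volterra_unique (hw : LocallyIntegrable w) (hw0 : ∀ s, 0 ≤ w s)
    (hB : ∀ s x, ‖B s x‖ ≤ w s * ‖x‖) {u u' : ℝ → H}
    (hu : IsPrimitive u fun s => B s (u s)) (hu' : IsPrimitive u' fun s => B s (u' s))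
    (h0 : u 0 = u' 0) : u = u' := by
  have hd : ∀ t, ‖u t - u' t‖ = 0 := by
    refine eq_zero_of_le_integral hw hw0 (hu.continuous.sub hu'.continuous).norm
      (fun t => norm_nonneg _) fun t => ?_
    rw [hu.eq_add_integral t, hu'.eq_add_integral t, h0, add_sub_add_left_eq_sub,
      ← intervalIntegral.integral_sub (hu.1.intervalIntegrable' _ _)
        (hu'.1.intervalIntegrable' _ _)]
    refine intervalIntegral.norm_integral_le_abs_of_norm_le
      (Filter.Eventually.of_forall fun s => ?_) ?_
    · rw [← map_sub]; exact hB s _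
    · exact (locallyIntegrable_bilin_continuous (ContinuousLinearMap.mul ℝ ℝ) hw
        (hu.continuous.sub hu'.continuous).norm).intervalIntegrable' _ _
  funext t
  exact sub_eq_zero.1 (norm_eq_zero.1 (hd t))

/-- The terms of the Dyson series. -/
def dysonTerm (B : ℝ → H →L[ℂ] H) (u₀ : H) : ℕ → ℝ → H
  | 0, _ => u₀
  | k + 1, t => ∫ s in (0 : ℝ)..t, B s (dysonTerm B u₀ k s)

/-- The solution is the Dyson series, dominated term by term by the exponential series of |∫ w|. The
hypothesis `hint` supplies the measurability of the integrands, which the norm bound alone does not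
give. -/
theorem volterra_exists [CompleteSpace H] (hw : LocallyIntegrable w) (hw0 : ∀ s, 0 ≤ w s)
    (hB : ∀ s x, ‖B s x‖ ≤ w s * ‖x‖)
    (hint : ∀ u : ℝ → H, Continuous u → LocallyIntegrable fun s => B s (u s)) (u₀ : H) :
    ∃ u : ℝ → H, u 0 = u₀ ∧ IsPrimitive u fun s => B s (u s) := by
  set U := dysonTerm B u₀ with hU
  set W : ℝ → ℝ := fun s => ∫ r in (0 : ℝ)..s, w r with hWdef
  have hWc : Continuous W := intervalIntegral.continuous_primitive
    (fun a b => hw.intervalIntegrable' a b) 0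
  have hUc : ∀ k, Continuous (U k) := by
    intro k
    induction k with
    | zero => exact continuous_const
    | succ k ih =>
      exact intervalIntegral.continuous_primitive
        (fun a b => (hint _ ih).intervalIntegrable' a b) 0
  have hUb : ∀ k t, ‖U k t‖ ≤ ‖u₀‖ * (|W t| ^ k / k !) := by
    intro k
    induction k with
    | zero => intro t; simp [hU, dysonTerm]
    | succ k ih =>
      intro t
      refine norm_integral_le_pow hw hw0 fun s _ => ?_
      exact (hB s _).trans (mul_le_mul_of_nonneg_left (ih s) (hw0 s))
  have hsumm : ∀ x : ℝ, Summable fun k : ℕ => ‖u₀‖ * (x ^ k / k !) := fun x =>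
    (Real.summable_pow_div_factorial x).mul_left _
  have hUs : ∀ t, Summable fun k => U k t := fun t =>
    Summable.of_norm_bounded (hsumm _) fun k => hUb k t
  have hbd : ∀ t : ℝ, ∃ C, ∀ s ∈ Set.uIcc 0 t, |W s| ≤ C := fun t =>
    (isCompact_uIcc (a := (0 : ℝ)) (b := t)).exists_bound_of_continuousOn hWc.continuousOn
  set u : ℝ → H := fun t => ∑' k, U k t with hu
  have huc : Continuous u := by
    rw [continuous_iff_continuousAt]
    intro t
    obtain ⟨C, hC⟩ := (isCompact_Icc (a := t - 1) (b := t + 1)).exists_bound_of_continuousOn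
      hWc.continuousOn
    -- Weierstrass test on a compact neighbourhood of `t`, where one constant bounds the integral of
    -- `w`.
    have : ContinuousOn u (Set.Icc (t - 1) (t + 1)) :=
      continuousOn_tsum (fun k => (hUc k).continuousOn) (hsumm C) fun k s hs =>
        (hUb k s).trans (by
          have := hC s hs
          rw [Real.norm_eq_abs] at this
          gcongr)
    exact this.continuousAt (Icc_mem_nhds (by linarith) (by linarith))
  refine ⟨u, ?_, hint u huc, fun t => ?_⟩
  · simp only [hu]
    rw [tsum_eq_single 0]
    · rfl
    · intro k hk
      obtain ⟨k, rfl⟩ := Nat.exists_eq_succ_of_ne_zero hk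
      simp [hU, dysonTerm]
  · obtain ⟨C, hC⟩ := hbd t
    have hi : HasSum (fun k => ∫ s in (0 : ℝ)..t, B s (U k s)) (∫ s in (0 : ℝ)..t, B s (u s)) := by
      refine intervalIntegral.hasSum_integral_of_dominated_convergence
        (fun k s => w s * (‖u₀‖ * (C ^ k / k !)))
        (fun k => (hint _ (hUc k)).aestronglyMeasurable.restrict)
        (fun k => Filter.Eventually.of_forall fun s hs => ?_)
        (Filter.Eventually.of_forall fun s _ => (hsumm C).mul_left _) ?_
        (Filter.Eventually.of_forall fun s _ => (B s).hasSum (hUs s).hasSum)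
      · refine (hB s _).trans (mul_le_mul_of_nonneg_left ((hUb k s).trans ?_) (hw0 s))
        have := hC s (Set.uIoc_subset_uIcc hs)
        gcongr
      · simp only [tsum_mul_left]
        exact (hw.intervalIntegrable' _ _).mul_const _
    have e0 : u 0 = U 0 t := by
      simp only [hu]
      rw [tsum_eq_single 0]
      · rfl
      · intro k hk
        obtain ⟨k, rfl⟩ := Nat.exists_eq_succ_of_ne_zero hk
        simp [hU, dysonTerm]
    rw [e0, ← hi.tsum_eq]
    exact (hUs t).tsum_eq_zero_add

end Volterra

/-! ### The one-particle space and its two orthonormal bases -/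

/-- Lebesgue measure on `(0, L)`. -/
abbrev lineMeasure (L : ℝ) : Measure ℝ := volume.restrict (Set.Ioo (0 : ℝ) L)

/-- Square integrable functions on `(0, L)`. -/
abbrev OneSpace (L : ℝ) : Type := Lp ℂ 2 (lineMeasure L)

/-- The plane waves of the ring. -/
def ringFun (L : ℝ) (m : ℤ) (x : ℝ) : ℂ :=
  ((Real.sqrt L : ℝ) : ℂ)⁻¹ * Complex.exp (Complex.I * ((x : ℂ) * (ringMomentum L m : ℂ)))

/-- The plane waves of the boxes. -/
def boxFun (L : ℝ) {n : ℕ} (a : Wavelet n) (x : ℝ) : ℂ :=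
  (boxSet L a.box).indicator (fun x : ℝ => ((Real.sqrt ((n : ℝ) / L) : ℝ) : ℂ) *
    Complex.exp (Complex.I * ((x : ℂ) * (a.momentum L : ℂ)))) x

theorem norm_exp_I_mul (x p : ℝ) : ‖Complex.exp (Complex.I * ((x : ℂ) * (p : ℂ)))‖ = 1 := by
  have h : Complex.I * ((x : ℂ) * (p : ℂ)) = ((x * p : ℝ) : ℂ) * Complex.I := by push_cast; ring
  rw [h, Complex.norm_exp_ofReal_mul_I]

theorem conj_exp_I_mul (x p : ℝ) : conj (Complex.exp (Complex.I * ((x : ℂ) * (p : ℂ)))) =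
    Complex.exp (-(Complex.I * ((x : ℂ) * (p : ℂ)))) := by
  rw [← Complex.exp_conj]; simp

theorem measurable_ringFun (L : ℝ) (m : ℤ) : Measurable (ringFun L m) := by
  unfold ringFun; fun_prop

theorem measurable_boxFun (L : ℝ) {n : ℕ} (a : Wavelet n) : Measurable (boxFun L a) := by
  unfold boxFun
  exact Measurable.indicator (by fun_prop) measurableSet_Ioo

theorem memLp_ringFun (L : ℝ) (m : ℤ) : MemLp (ringFun L m) 2 (lineMeasure L) := by
  refine MemLp.of_bound (measurable_ringFun L m).aestronglyMeasurable
    ‖((Real.sqrt L : ℝ) : ℂ)⁻¹‖ (Filter.Eventually.of_forall fun x => ?_)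
  rw [ringFun, norm_mul, norm_exp_I_mul, mul_one]

theorem memLp_boxFun (L : ℝ) {n : ℕ} (a : Wavelet n) : MemLp (boxFun L a) 2 (lineMeasure L) := by
  refine MemLp.of_bound (measurable_boxFun L a).aestronglyMeasurable
    ‖((Real.sqrt ((n : ℝ) / L) : ℝ) : ℂ)‖ (Filter.Eventually.of_forall fun x => ?_)
  refine (norm_indicator_le_norm_self _ _).trans ?_
  rw [norm_mul, norm_exp_I_mul, mul_one]

/-- The plane wave `x ↦ e^{iλx} / √L` as a vector. -/
def ringVec (L : ℝ) (m : ℤ) : OneSpace L := (memLp_ringFun L m).toLp _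

/-- The wavelet `x ↦ √(n/L) e^{iax} 1_{box}(x)` as a vector. -/
def boxVec (L : ℝ) {n : ℕ} (a : Wavelet n) : OneSpace L := (memLp_boxFun L a).toLp _

theorem ringVec_coeFn (L : ℝ) (m : ℤ) : ringVec L m =ᵐ[lineMeasure L] ringFun L m :=
  MemLp.coeFn_toLp _

theorem boxVec_coeFn (L : ℝ) {n : ℕ} (a : Wavelet n) :
    boxVec L a =ᵐ[lineMeasure L] boxFun L a :=
  MemLp.coeFn_toLp _

theorem inner_Lp_eq {α : Type*} [MeasurableSpace α] {μ : Measure α} (f g : Lp ℂ 2 μ) {f' g' : α → ℂ}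
    (hf : f =ᵐ[μ] f') (hg : g =ᵐ[μ] g') : inner ℂ f g = ∫ x, conj (f' x) * g' x ∂μ := by
  rw [L2.inner_def]
  refine integral_congr_ae ?_
  filter_upwards [hf, hg] with x h1 h2
  rw [h1, h2, RCLike.inner_apply, mul_comm]

theorem integral_exp_period {c d : ℝ} (hcd : c < d) {p : ℝ} {k : ℤ}
    (hp : p * (d - c) = 2 * Real.pi * k) :
    ∫ x in c..d, Complex.exp (Complex.I * ((x : ℂ) * (p : ℂ))) = if k = 0 then ((d - c : ℝ) : ℂ)
      else 0 := by
  have hdc : d - c ≠ 0 := (sub_pos.2 hcd).ne'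
  have e : ∀ x : ℝ, Complex.I * ((x : ℂ) * (p : ℂ)) = (Complex.I * p) * x := fun x => by ring
  simp_rw [e]
  split_ifs with hk
  · subst hk
    have : p = 0 := by simpa [hdc] using hp
    subst this
    simp
  · have hp0 : p ≠ 0 := by
      rintro rfl
      simp [Real.pi_ne_zero, hk] at hp
    rw [integral_exp_mul_complex (mul_ne_zero Complex.I_ne_zero (by exact_mod_cast hp0))]
    have e2 : Complex.I * p * d = Complex.I * p * c + k * (2 * Real.pi * Complex.I) := by
      have : (p : ℂ) * (d - c) = 2 * Real.pi * k := by exact_mod_cast hp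
      linear_combination Complex.I * this
    rw [e2, Complex.exp_add, Complex.exp_int_mul_two_pi_mul_I]
    simp

theorem measurableSet_boxSet (L : ℝ) {n : ℕ} (b : Fin n) : MeasurableSet (boxSet L b) :=
  measurableSet_Ioo

theorem setIntegral_boxSet {L : ℝ} (hL : 0 < L) {n : ℕ} (b : Fin n) (f : ℝ → ℂ) :
    ∫ x in boxSet L b, f x = ∫ x in ((b : ℝ) * L / n)..(((b : ℝ) + 1) * L / n), f x := by
  rw [intervalIntegral.integral_of_le (by gcongr; simp), integral_Ioc_eq_integral_Ioo]
  rfl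

theorem boxSet_subset {L : ℝ} (hL : 0 < L) {n : ℕ} (b : Fin n) :
    boxSet L b ⊆ Set.Ioo 0 L := by
  have hn : (0 : ℝ) < n := by exact_mod_cast (Nat.zero_le _).trans_lt b.2
  have hb : ((b : ℕ) : ℝ) + 1 ≤ n := by exact_mod_cast b.2
  rintro x ⟨h1, h2⟩
  refine ⟨lt_of_le_of_lt (by positivity) h1, h2.trans_le ?_⟩
  rw [div_le_iff₀ hn, mul_comm L]
  gcongr

theorem boxSet_lt {L : ℝ} (hL : 0 < L) {n : ℕ} {b c : Fin n} (hbc : b < c) {x y : ℝ}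
    (hx : x ∈ boxSet L b) (hy : y ∈ boxSet L c) : x < y := by
  have hn : (0 : ℝ) < n := by exact_mod_cast (Nat.zero_le _).trans_lt b.2
  have h : ((b : ℕ) : ℝ) + 1 ≤ (c : ℕ) := by exact_mod_cast hbc
  refine hx.2.trans_le (le_trans ?_ hy.1.le)
  gcongr

theorem boxSet_unique {L : ℝ} (hL : 0 < L) {n : ℕ} {b c : Fin n} {x : ℝ}
    (hx : x ∈ boxSet L b) (hy : x ∈ boxSet L c) : b = c := by
  rcases lt_trichotomy b c with h | h | h
  · exact absurd (boxSet_lt hL h hx hy) (lt_irrefl _)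
  · exact h
  · exact absurd (boxSet_lt hL h hy hx) (lt_irrefl _)

theorem setIntegral_indicator_boxSet {L : ℝ} (hL : 0 < L) {n : ℕ} (b : Fin n) (f : ℝ → ℂ) :
    ∫ x, (boxSet L b).indicator f x ∂(lineMeasure L) =
      ∫ x in ((b : ℝ) * L / n)..(((b : ℝ) + 1) * L / n), f x := by
  rw [integral_indicator (measurableSet_boxSet L b),
    Measure.restrict_restrict (measurableSet_boxSet L b),
    Set.inter_eq_left.2 (boxSet_subset hL b), ← setIntegral_boxSet hL]

theorem sqrt_mul_sqrt_complex {r : ℝ} (hr : 0 ≤ r) :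
    ((Real.sqrt r : ℝ) : ℂ) * ((Real.sqrt r : ℝ) : ℂ) = r := by
  rw [← Complex.ofReal_mul, Real.mul_self_sqrt hr]

theorem orthonormal_ringVec {L : ℝ} (hL : 0 < L) : Orthonormal ℂ (ringVec L) := by
  rw [orthonormal_iff_ite]
  intro m m'
  rw [inner_Lp_eq _ _ (ringVec_coeFn L m) (ringVec_coeFn L m')]
  have e : ∀ x : ℝ, conj (ringFun L m x) * ringFun L m' x = ((L : ℂ))⁻¹ *
      Complex.exp (Complex.I * ((x : ℂ) * ((2 * Real.pi * (m' - m : ℤ) / L : ℝ) : ℂ))) := by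
    intro x
    rw [ringFun, ringFun, map_mul, conj_exp_I_mul, map_inv₀, Complex.conj_ofReal,
      mul_mul_mul_comm, ← mul_inv, sqrt_mul_sqrt_complex hL.le, ← Complex.exp_add]
    congr 2
    unfold ringMomentum
    push_cast
    field_simp
    ring
  simp_rw [e]
  rw [integral_const_mul, ← integral_Ioc_eq_integral_Ioo,
    ← intervalIntegral.integral_of_le hL.le, integral_exp_period hL (k := m' - m)
      (by field_simp; ring)]
  by_cases h : m = m'
  · subst h
    have : (L : ℂ) ≠ 0 := by exact_mod_cast hL.ne'
    simp [this]
  · rw [if_neg h, if_neg (by omega), mul_zero]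

theorem box_width {L : ℝ} {n : ℕ} (b : Fin n) :
    ((b : ℝ) + 1) * L / n - (b : ℝ) * L / n = L / n := by ring

theorem box_left_lt_right {L : ℝ} (hL : 0 < L) {n : ℕ} (b : Fin n) :
    (b : ℝ) * L / n < ((b : ℝ) + 1) * L / n := by
  have hn : (0 : ℝ) < n := by exact_mod_cast (Nat.zero_le _).trans_lt b.2
  gcongr
  linarith

theorem orthonormal_boxVec {L : ℝ} (hL : 0 < L) (n : ℕ) :
    Orthonormal ℂ (boxVec L : Wavelet n → OneSpace L) := by
  rw [orthonormal_iff_ite]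
  intro a a'
  rw [inner_Lp_eq _ _ (boxVec_coeFn L a) (boxVec_coeFn L a')]
  have hn : (0 : ℝ) < n := by exact_mod_cast (Nat.zero_le _).trans_lt a.box.2
  by_cases hb : a.box = a'.box
  · have e : ∀ x : ℝ, conj (boxFun L a x) * boxFun L a' x =
        (boxSet L a.box).indicator (fun x : ℝ => ((n / L : ℝ) : ℂ) *
          Complex.exp (Complex.I * ((x : ℂ) *
            ((2 * Real.pi * n * ((ofLex a').2 - (ofLex a).2 : ℤ) / L : ℝ) : ℂ)))) x := by
      intro x
      rw [boxFun, boxFun, ← hb]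
      by_cases hx : x ∈ boxSet L a.box
      · simp only [Set.indicator_of_mem hx]
        rw [map_mul, conj_exp_I_mul, Complex.conj_ofReal, mul_mul_mul_comm,
          sqrt_mul_sqrt_complex (by positivity), ← Complex.exp_add]
        congr 2
        unfold Wavelet.momentum
        push_cast
        ring
      · simp [Set.indicator_of_notMem hx]
    simp_rw [e]
    rw [setIntegral_indicator_boxSet hL, intervalIntegral.integral_const_mul,
      integral_exp_period (box_left_lt_right hL _) (k := (ofLex a').2 - (ofLex a).2)
        (by rw [box_width]; field_simp), box_width]
    by_cases h : a = a'
    · subst h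
      have h1 : (n : ℂ) ≠ 0 := by exact_mod_cast hn.ne'
      have h2 : (L : ℂ) ≠ 0 := by exact_mod_cast hL.ne'
      simp only [sub_self, if_true]
      push_cast
      field_simp
    · rw [if_neg h, if_neg, mul_zero]
      intro h0
      exact h (ofLex.injective (Prod.ext hb (by omega)))
  · have h : a ≠ a' := fun h => hb (by rw [h])
    rw [if_neg h]
    refine integral_eq_zero_of_ae (Filter.Eventually.of_forall fun x => ?_)
    simp only [boxFun, Pi.zero_apply]
    by_cases hx : x ∈ boxSet L a.box
    · have : x ∉ boxSet L a'.box := fun hx' => hb (boxSet_unique hL hx hx')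
      simp [Set.indicator_of_notMem this]
    · simp [Set.indicator_of_notMem hx]

/-! ### Completeness of the plane waves of the ring and of the boxes -/

theorem ae_eq_zero_of_fourier {c d : ℝ} (hcd : c < d) {f : ℝ → ℂ}
    (hf : MemLp f 2 (volume.restrict (Set.Ioo c d)))
    (h : ∀ k : ℤ, ∫ x in c..d,
      Complex.exp (-(Complex.I * ((x : ℂ) * ((2 * Real.pi * k / (d - c) : ℝ) : ℂ)))) * f x = 0) :
    f =ᵐ[volume.restrict (Set.Ioo c d)] 0 := by
  rw [← restrict_Ioo_eq_restrict_Ioc.symm] at hf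
  have hp := hasSum_sq_fourierCoeffOn hcd hf
  have h0 : ∀ k, fourierCoeffOn hcd f k = 0 := by
    intro k
    rw [fourierCoeffOn_eq_integral]
    have : ∫ x in c..d, fourier (-k) (x : AddCircle (d - c)) • f x = 0 := by
      rw [← h k]
      congr 1
      funext x
      rw [fourier_coe_apply, smul_eq_mul]
      congr 2
      push_cast
      ring
    rw [this, smul_zero]
  simp only [h0] at hp
  -- Parseval: the mean of |f|² is the sum of the squared Fourier coefficients, all of which vanish.
  have h1 : ∫ x in c..d, ‖f x‖ ^ 2 = 0 := by
    have := hp.unique (a₂ := (0 : ℝ)) (by simp)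
    simpa [(sub_pos.2 hcd).ne'] using this
  rw [intervalIntegral.integral_of_le hcd.le,
    integral_eq_zero_iff_of_nonneg (fun x => by positivity)
      ((memLp_two_iff_integrable_sq_norm hf.1).1 hf)] at h1
  rw [restrict_Ioo_eq_restrict_Ioc]
  filter_upwards [h1] with x hx
  simpa using hx

/-- The ring momenta are shifted by half a step from the Fourier momenta of (0, L). Multiplying `f`
by e^{-iπx/L} absorbs the shift without affecting where `f` vanishes. -/
theorem ae_eq_zero_of_inner_ringVec {L : ℝ} (hL : 0 < L) (f : OneSpace L)
    (h : ∀ m, inner ℂ (ringVec L m) f = 0) : f = 0 := by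
  rw [Lp.eq_zero_iff_ae_eq_zero]
  have hg : MemLp (fun x : ℝ => Complex.exp (-(Complex.I * ((x : ℂ) * ((Real.pi / L : ℝ) : ℂ))))
      * f x) 2 (volume.restrict (Set.Ioo 0 L)) := by
    refine MemLp.of_le (Lp.memLp f) ?_ (Filter.Eventually.of_forall fun x => ?_)
    · exact (Continuous.aestronglyMeasurable (by fun_prop)).mul (Lp.aestronglyMeasurable f)
    · rw [norm_mul, ← conj_exp_I_mul, RCLike.norm_conj, norm_exp_I_mul, one_mul]
  have := ae_eq_zero_of_fourier hL hg fun k => by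
    have hk := h k
    rw [inner_Lp_eq _ _ (ringVec_coeFn L k) (ae_eq_refl _), ← integral_Ioc_eq_integral_Ioo,
      ← intervalIntegral.integral_of_le hL.le] at hk
    have hs : (((Real.sqrt L : ℝ) : ℂ)⁻¹) ≠ 0 := by
      simpa using (Real.sqrt_pos.2 hL).ne'
    have e : ∀ x : ℝ, conj (ringFun L k x) * f x = (((Real.sqrt L : ℝ) : ℂ)⁻¹) *
        (Complex.exp (-(Complex.I * ((x : ℂ) * ((2 * Real.pi * k / (L - 0) : ℝ) : ℂ)))) *
        (Complex.exp (-(Complex.I * ((x : ℂ) * ((Real.pi / L : ℝ) : ℂ)))) * f x)) := by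
      intro x
      rw [ringFun, map_mul, conj_exp_I_mul, map_inv₀, Complex.conj_ofReal, mul_assoc,
        ← mul_assoc (Complex.exp _) (Complex.exp _), ← Complex.exp_add]
      congr 3
      unfold ringMomentum
      push_cast
      field_simp
      ring
    simp_rw [e] at hk
    rw [intervalIntegral.integral_const_mul] at hk
    exact (mul_eq_zero.1 hk).resolve_left hs
  filter_upwards [this] with x hx
  simpa using hx

/-- Away from the countable set of grid points k L / n, the point x lies in the box numbered by the
floor of x n / L. -/
theorem ae_exists_mem_boxSet {L : ℝ} (hL : 0 < L) {n : ℕ} (hn : 0 < n) :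
    ∀ᵐ x ∂(lineMeasure L), ∃ b : Fin n, x ∈ boxSet L b := by
  have hn' : (0 : ℝ) < n := by exact_mod_cast hn
  have hc : (Set.range fun k : ℤ => (k : ℝ) * L / n).Countable := Set.countable_range _
  filter_upwards [ae_restrict_mem measurableSet_Ioo,
    ae_restrict_of_ae (hc.ae_notMem (volume : Measure ℝ))] with x hx hxn
  have h0 : 0 < x * n / L := by have := hx.1; positivity
  have hfl : ⌊x * n / L⌋₊ < n := by
    rw [Nat.floor_lt h0.le, div_lt_iff₀ hL, mul_comm]
    exact mul_lt_mul_of_pos_left hx.2 hn'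
  refine ⟨⟨_, hfl⟩, ?_, ?_⟩
  · refine lt_of_le_of_ne ?_ fun h => hxn ⟨(⌊x * n / L⌋₊ : ℤ), by simpa using h⟩
    have := Nat.floor_le h0.le
    rw [le_div_iff₀ hL] at this
    rw [div_le_iff₀ hn']
    exact this
  · have := Nat.lt_floor_add_one (x * n / L)
    rw [div_lt_iff₀ hL] at this
    rw [lt_div_iff₀ hn']
    exact this

theorem ae_eq_zero_of_inner_boxVec {L : ℝ} (hL : 0 < L) {n : ℕ} (hn : 0 < n) (f : OneSpace L)
    (h : ∀ a : Wavelet n, inner ℂ (boxVec L a) f = 0) : f = 0 := by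
  rw [Lp.eq_zero_iff_ae_eq_zero]
  have hn' : (0 : ℝ) < n := by exact_mod_cast hn
  have hb : ∀ b : Fin n, ∀ᵐ x ∂(lineMeasure L), x ∈ boxSet L b → f x = 0 := by
    intro b
    have hres : (lineMeasure L).restrict (boxSet L b) = volume.restrict (boxSet L b) := by
      rw [Measure.restrict_restrict (measurableSet_boxSet L b),
        Set.inter_eq_left.2 (boxSet_subset hL b)]
    have hf : MemLp f 2 (volume.restrict (boxSet L b)) := by
      rw [← hres]; exact (Lp.memLp f).restrict _
    have := ae_eq_zero_of_fourier (box_left_lt_right hL b) hf fun k => by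
      have hk := h (toLex (b, k))
      rw [inner_Lp_eq _ _ (boxVec_coeFn L _) (ae_eq_refl _)] at hk
      have e : ∀ x : ℝ, conj (boxFun L (toLex (b, k) : Wavelet n) x) * f x =
          (boxSet L b).indicator (fun x : ℝ => ((Real.sqrt ((n : ℝ) / L) : ℝ) : ℂ) *
            (Complex.exp (-(Complex.I * ((x : ℂ) * ((2 * Real.pi * k /
              (((b : ℝ) + 1) * L / n - (b : ℝ) * L / n) : ℝ) : ℂ)))) * f x)) x := by
        intro x
        have hbx : Wavelet.box (toLex (b, k) : Wavelet n) = b := rfl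
        rw [boxFun, hbx]
        by_cases hx : x ∈ boxSet L b
        · simp only [Set.indicator_of_mem hx]
          rw [map_mul, conj_exp_I_mul, Complex.conj_ofReal, mul_assoc, box_width]
          congr 5
          simp only [Wavelet.momentum, ofLex_toLex]
          field_simp
        · simp [Set.indicator_of_notMem hx]
      simp_rw [e] at hk
      rw [setIntegral_indicator_boxSet hL, intervalIntegral.integral_const_mul] at hk
      refine (mul_eq_zero.1 hk).resolve_left ?_
      have : 0 < (n : ℝ) / L := by positivity
      simpa using (Real.sqrt_pos.2 this).ne'
    change f =ᵐ[volume.restrict (boxSet L b)] 0 at this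
    rw [← hres] at this
    exact (ae_restrict_iff' (measurableSet_boxSet L b)).1 this
  filter_upwards [ae_exists_mem_boxSet hL hn, ae_all_iff.2 hb] with x ⟨b, hx⟩ hx'
  exact hx' b hx

/-- The orthonormal basis of plane waves of the ring. -/
def ringBasis {L : ℝ} (hL : 0 < L) : HilbertBasis ℤ ℂ (OneSpace L) :=
  HilbertBasis.mkOfOrthogonalEqBot (orthonormal_ringVec hL) (by
    rw [Submodule.eq_bot_iff]
    intro f hf
    refine ae_eq_zero_of_inner_ringVec hL f fun m => ?_
    exact (Submodule.mem_orthogonal _ _).1 hf _ (Submodule.subset_span ⟨m, rfl⟩))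

/-- The orthonormal basis of wavelets. -/
def boxBasis {L : ℝ} (hL : 0 < L) {n : ℕ} (hn : 0 < n) :
    HilbertBasis (Wavelet n) ℂ (OneSpace L) :=
  HilbertBasis.mkOfOrthogonalEqBot (orthonormal_boxVec hL n) (by
    rw [Submodule.eq_bot_iff]
    intro f hf
    refine ae_eq_zero_of_inner_boxVec hL hn f fun m => ?_
    exact (Submodule.mem_orthogonal _ _).1 hf _ (Submodule.subset_span ⟨m, rfl⟩))

@[simp] theorem ringBasis_apply {L : ℝ} (hL : 0 < L) (m : ℤ) : ringBasis hL m = ringVec L m := by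
  simp [ringBasis]

@[simp] theorem boxBasis_apply {L : ℝ} (hL : 0 < L) {n : ℕ} (hn : 0 < n) (a : Wavelet n) :
    boxBasis hL hn a = boxVec L a := by
  simp [boxBasis]

/-! ### Overlaps of the two one-particle bases -/

theorem ringMomentum_ne_momentum {L : ℝ} (hL : 0 < L) {n : ℕ} (m : ℤ) (a : Wavelet n) :
    ringMomentum L m ≠ a.momentum L := by
  unfold ringMomentum Wavelet.momentum
  intro h
  have h1 : (m : ℝ) + 1 / 2 = n * ((ofLex a).2 : ℤ) := by
    have := Real.pi_pos
    field_simp at h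
    linarith
  -- Equality of the momenta would make an odd integer even.
  have h2 : (2 * m + 1 : ℤ) = 2 * (n * (ofLex a).2) := by
    have : (2 * m + 1 : ℝ) = 2 * (n * ((ofLex a).2 : ℤ)) := by linarith
    exact_mod_cast this
  omega

/-- The explicit φ is the integral of an exponential over one box; the denominator λ - a is nonzero
because the two momentum lattices are disjoint. -/
theorem inner_ringVec_boxVec {L : ℝ} (hL : 0 < L) {n : ℕ} (m : ℤ) (a : Wavelet n) :
    inner ℂ (ringVec L m) (boxVec L a) = overlap L (ringMomentum L m) a := by
  have hn : (0 : ℝ) < n := by exact_mod_cast (Nat.zero_le _).trans_lt a.box.2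
  rw [inner_Lp_eq _ _ (ringVec_coeFn L m) (boxVec_coeFn L a)]
  set p := a.momentum L with hp
  set l := ringMomentum L m with hl
  have hne : l - p ≠ 0 := sub_ne_zero.2 (ringMomentum_ne_momentum hL m a)
  have hneC : (l : ℂ) - p ≠ 0 := by exact_mod_cast hne
  have hnC : (n : ℂ) ≠ 0 := by exact_mod_cast hn.ne'
  have hLC : (L : ℂ) ≠ 0 := by exact_mod_cast hL.ne'
  have e : ∀ x : ℝ, conj (ringFun L m x) * boxFun L a x =
      (boxSet L a.box).indicator (fun x : ℝ => (((Real.sqrt n : ℝ) : ℂ) / L) *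
        Complex.exp ((Complex.I * (p - l)) * x)) x := by
    intro x
    rw [boxFun]
    by_cases hx : x ∈ boxSet L a.box
    · simp only [Set.indicator_of_mem hx]
      rw [ringFun, map_mul, conj_exp_I_mul, map_inv₀, Complex.conj_ofReal, mul_mul_mul_comm,
        ← Complex.exp_add]
      congr 1
      · rw [Real.sqrt_div hn.le, Complex.ofReal_div]
        have hs : ((Real.sqrt L : ℝ) : ℂ) ≠ 0 := by simpa using (Real.sqrt_pos.2 hL).ne'
        rw [← sqrt_mul_sqrt_complex hL.le]
        field_simp
      · rw [← hp, ← hl]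
        congr 1
        ring
    · simp [Set.indicator_of_notMem hx]
  simp_rw [e]
  rw [setIntegral_indicator_boxSet hL, intervalIntegral.integral_const_mul,
    integral_exp_mul_complex (mul_ne_zero Complex.I_ne_zero (by
      rw [← neg_sub]; exact neg_ne_zero.2 hneC)), overlap]
  -- At the grid point k L / n the wavelet phase is the exponential of an integer multiple of 2πi,
  -- so only the ring phase survives at both endpoints.
  have hint : ∀ k : ℤ, Complex.exp (Complex.I * (p - l) * ((k * L / n : ℝ) : ℂ)) =
      Complex.exp (-(Complex.I * l * (k * L / n))) := by
    intro k
    rw [Complex.exp_eq_exp_iff_exists_int]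
    refine ⟨k * (ofLex a).2, ?_⟩
    rw [hp, Wavelet.momentum]
    push_cast
    field_simp
    ring
  have h1 := hint (a.box : ℕ)
  have h2 := hint ((a.box : ℕ) + 1)
  push_cast at h1 h2
  push_cast
  rw [h1, h2]
  have h3 : Complex.exp (-(Complex.I * l * (((a.box : ℕ) : ℂ) * L / n))) =
      Complex.exp (Complex.I * L * l / n) *
      Complex.exp (-(Complex.I * l * ((((a.box : ℕ) : ℂ) + 1) * L / n))) := by
    rw [← Complex.exp_add]
    congr 1
    field_simp
    ring
  have h4 : Complex.exp (-Complex.I * L * (((a.box : ℕ) : ℂ) + 1) / n * l) =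
      Complex.exp (-(Complex.I * l * ((((a.box : ℕ) : ℂ) + 1) * L / n))) := by
    congr 1
    field_simp
  rw [h3, h4]
  have h5 : (Complex.I * ((p : ℂ) - l))⁻¹ = Complex.I / (l - p) := by
    rw [mul_inv, Complex.inv_I, ← neg_sub (l : ℂ) p, inv_neg]
    field_simp
  rw [div_eq_mul_inv _ (Complex.I * ((p : ℂ) - l)), h5, ← hp]
  field_simp

/-! ### Diagonal operators -/

section Diagonal

variable {ι H : Type*} [NormedAddCommGroup H] [InnerProductSpace ℂ H]

theorem memlp_diagonal {c : ι → ℂ} (hc : ∀ i, ‖c i‖ ≤ 1) (x : lp (fun _ : ι => ℂ) 2) :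
    Memℓp (fun i => c i * x i) 2 := by
  refine (lp.memℓp x).mono' fun i => ?_
  rw [norm_mul]
  exact mul_le_of_le_one_left (norm_nonneg _) (hc i)

/-- The operator that is diagonal in a Hilbert basis. -/
def diagonal (b : HilbertBasis ι ℂ H) (c : ι → ℂ) (hc : ∀ i, ‖c i‖ ≤ 1) : H →L[ℂ] H :=
  LinearMap.mkContinuous
    { toFun := fun x => b.repr.symm ⟨fun i => c i * b.repr x i, memlp_diagonal hc _⟩
      map_add' := fun x y => by
        rw [← map_add]
        congr 1
        ext i
        simp [mul_add]
        rfl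
      map_smul' := fun r x => by
        rw [RingHom.id_apply, ← map_smul]
        congr 1
        ext i
        simp [mul_left_comm] } 1 (fun x => by
      rw [one_mul, LinearMap.coe_mk, AddHom.coe_mk, LinearIsometryEquiv.norm_map,
        ← b.repr.norm_map x]
      refine lp.norm_mono (by norm_num) fun i => ?_
      rw [norm_mul]
      exact mul_le_of_le_one_left (norm_nonneg _) (hc i))

theorem repr_diagonal (b : HilbertBasis ι ℂ H) {c : ι → ℂ} (hc : ∀ i, ‖c i‖ ≤ 1) (x : H) (i : ι) :
    inner ℂ (b i) (diagonal b c hc x) = c i * inner ℂ (b i) x := by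
  rw [← b.repr_apply_apply, ← b.repr_apply_apply]
  simp [diagonal]

theorem _root_.HilbertBasis.ext_inner (b : HilbertBasis ι ℂ H) {x y : H}
    (h : ∀ i, inner ℂ (b i) x = inner ℂ (b i) y) : x = y := by
  refine b.repr.injective ?_
  ext i
  rw [b.repr_apply_apply, b.repr_apply_apply, h]

end Diagonal

/-! ### The free evolution of one particle -/

theorem norm_phase (t r : ℝ) : ‖Complex.exp (-Complex.I * t * r)‖ = 1 := by
  have : -Complex.I * t * r = ((-(t * r) : ℝ) : ℂ) * Complex.I := by push_cast; ring
  rw [this, Complex.norm_exp_ofReal_mul_I]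

/-- The free propagator `e^{-ith}` of one particle. -/
def freeProp {L : ℝ} (hL : 0 < L) (t : ℝ) : OneSpace L →L[ℂ] OneSpace L :=
  diagonal (ringBasis hL) (fun m => Complex.exp (-Complex.I * t * (ringMomentum L m ^ 2 : ℝ)))
    fun _ => (norm_phase t _).le

section FreeProp

variable {L : ℝ} (hL : 0 < L)

theorem inner_ringVec_freeProp (t : ℝ) (x : OneSpace L) (m : ℤ) :
    inner ℂ (ringVec L m) (freeProp hL t x) =
      Complex.exp (-Complex.I * t * (ringMomentum L m ^ 2 : ℝ)) * inner ℂ (ringVec L m) x := by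
  rw [← ringBasis_apply hL]
  exact repr_diagonal _ _ _ _

theorem hasSum_inner_freeProp (t : ℝ) (x y : OneSpace L) :
    HasSum (fun m => inner ℂ x (ringVec L m) * inner ℂ (ringVec L m) y *
      Complex.exp (-Complex.I * t * (ringMomentum L m ^ 2 : ℝ))) (inner ℂ x (freeProp hL t y)) := by
  have := (ringBasis hL).hasSum_inner_mul_inner x (freeProp hL t y)
  simp only [ringBasis_apply, inner_ringVec_freeProp] at this
  convert! this using 2
  ring

theorem freeProp_zero (x : OneSpace L) : freeProp hL 0 x = x := by
  refine (ringBasis hL).ext_inner fun m => ?_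
  rw [ringBasis_apply, inner_ringVec_freeProp]
  simp

theorem freeProp_add (s t : ℝ) (x : OneSpace L) :
    freeProp hL s (freeProp hL t x) = freeProp hL (s + t) x := by
  refine (ringBasis hL).ext_inner fun m => ?_
  rw [ringBasis_apply, inner_ringVec_freeProp, inner_ringVec_freeProp, inner_ringVec_freeProp,
    ← mul_assoc, ← Complex.exp_add]
  congr 2
  push_cast
  ring

theorem inner_freeProp_left (t : ℝ) (x y : OneSpace L) :
    inner ℂ (freeProp hL t x) y = inner ℂ x (freeProp hL (-t) y) := by
  have h1 := (ringBasis hL).hasSum_inner_mul_inner (freeProp hL t x) y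
  have h2 := (ringBasis hL).hasSum_inner_mul_inner x (freeProp hL (-t) y)
  refine h1.unique ?_
  convert h2 using 2 with m
  simp only [ringBasis_apply]
  rw [← inner_conj_symm (freeProp hL t x), inner_ringVec_freeProp, inner_ringVec_freeProp, map_mul,
    inner_conj_symm, ← Complex.exp_conj]
  simp only [map_mul, map_neg, Complex.conj_I, Complex.conj_ofReal]
  push_cast
  ring_nf

theorem norm_freeProp (t : ℝ) (x : OneSpace L) : ‖freeProp hL t x‖ = ‖x‖ := by
  have : inner ℂ (freeProp hL t x) (freeProp hL t x) = inner ℂ x x := by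
    rw [inner_freeProp_left, freeProp_add, neg_add_cancel, freeProp_zero]
  rw [inner_self_eq_norm_sq_to_K, inner_self_eq_norm_sq_to_K] at this
  have h2 : ‖freeProp hL t x‖ ^ 2 = ‖x‖ ^ 2 := by exact_mod_cast this
  exact (pow_left_inj₀ (norm_nonneg _) (norm_nonneg _) two_ne_zero).1 h2

/-- The matrix element is a series in the ring basis whose phases have modulus one, so the summable
products of coefficients dominate it uniformly in time. -/
theorem continuous_inner_freeProp (x y : OneSpace L) :
    Continuous fun t => inner ℂ x (freeProp hL t y) := by
  have e : (fun t => inner ℂ x (freeProp hL t y)) = fun t : ℝ => ∑' m, (inner ℂ x (ringVec L m) *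
      inner ℂ (ringVec L m) y * Complex.exp (-Complex.I * t * (ringMomentum L m ^ 2 : ℝ))) :=
    funext fun t => (hasSum_inner_freeProp hL t x y).tsum_eq.symm
  rw [e]
  refine continuous_tsum (u := fun m => ‖inner ℂ x (ringVec L m) * inner ℂ (ringVec L m) y‖)
    (fun m => by fun_prop) ?_ fun m t => ?_
  · simpa using ((ringBasis hL).summable_inner_mul_inner x y).norm
  · rw [norm_mul, norm_phase, mul_one]

/-- Strong continuity from weak continuity: the propagator is isometric, so the squared distance is
2‖x‖² minus twice the real part of an inner product that is continuous in t. -/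
theorem continuous_freeProp_apply (x : OneSpace L) : Continuous fun t => freeProp hL t x := by
  rw [continuous_iff_continuousAt]
  intro s
  rw [ContinuousAt, tendsto_iff_norm_sub_tendsto_zero]
  have e : ∀ t, ‖freeProp hL t x - freeProp hL s x‖ =
      Real.sqrt (2 * ‖x‖ ^ 2 - 2 * Complex.re (inner ℂ (freeProp hL s x) (freeProp hL t x))) := by
    intro t
    rw [← Real.sqrt_sq (norm_nonneg (freeProp hL t x - freeProp hL s x)), norm_sub_rev,
      @norm_sub_sq ℂ, norm_freeProp, norm_freeProp]
    congr 1
    simp only [RCLike.re_to_complex]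
    ring
  simp_rw [e]
  have hc : Continuous fun t => Real.sqrt (2 * ‖x‖ ^ 2 -
      2 * Complex.re (inner ℂ (freeProp hL s x) (freeProp hL t x))) := by
    have := continuous_inner_freeProp hL (freeProp hL s x) x
    fun_prop
  have h0 := hc.tendsto s
  have h1 : 2 * ‖x‖ ^ 2 - 2 * Complex.re (inner ℂ (freeProp hL s x) (freeProp hL s x)) = 0 := by
    have := inner_self_eq_norm_sq (𝕜 := ℂ) (freeProp hL s x)
    rw [RCLike.re_to_complex] at this
    rw [this, norm_freeProp, sub_self]
  rwa [h1, Real.sqrt_zero] at h0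

theorem continuous_freeProp {u : ℝ → OneSpace L} (hu : Continuous u) {r : ℝ → ℝ}
    (hr : Continuous r) : Continuous fun t => freeProp hL (r t) (u t) := by
  rw [continuous_iff_continuousAt]
  intro s
  rw [ContinuousAt, tendsto_iff_norm_sub_tendsto_zero]
  have h1 : Continuous fun t => ‖u t - u s‖ +
      ‖freeProp hL (r t) (u s) - freeProp hL (r s) (u s)‖ :=
    (hu.sub continuous_const).norm.add
      (((continuous_freeProp_apply hL (u s)).comp hr).sub continuous_const).norm
  have h2 := h1.tendsto s
  simp only [sub_self, norm_zero, add_zero] at h2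
  refine squeeze_zero (fun _ => norm_nonneg _) (fun t => ?_) h2
  rw [← norm_freeProp hL (r t) (u t - u s), map_sub]
  exact norm_sub_le_norm_sub_add_norm_sub _ _ _

end FreeProp

/-! ### The potential of one particle -/

/-- The restriction of a function to box `b`. -/
def boxRestrict (L : ℝ) {n : ℕ} (b : Fin n) (f : OneSpace L) : OneSpace L :=
  ((Lp.memLp f).indicator (measurableSet_boxSet L b)).toLp _

theorem boxRestrict_coeFn (L : ℝ) {n : ℕ} (b : Fin n) (f : OneSpace L) :
    boxRestrict L b f =ᵐ[lineMeasure L] (boxSet L b).indicator f :=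
  MemLp.coeFn_toLp _

theorem norm_boxRestrict_le (L : ℝ) {n : ℕ} (b : Fin n) (f : OneSpace L) :
    ‖boxRestrict L b f‖ ≤ ‖f‖ := by
  refine Lp.norm_le_norm_of_ae_le ?_
  filter_upwards [boxRestrict_coeFn L b f] with x hx
  rw [hx]
  exact norm_indicator_le_norm_self _ _

theorem boxRestrict_add (L : ℝ) {n : ℕ} (b : Fin n) (f g : OneSpace L) :
    boxRestrict L b (f + g) = boxRestrict L b f + boxRestrict L b g := by
  refine Lp.ext ?_
  filter_upwards [boxRestrict_coeFn L b (f + g), boxRestrict_coeFn L b f, boxRestrict_coeFn L b g,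
    Lp.coeFn_add f g, Lp.coeFn_add (boxRestrict L b f) (boxRestrict L b g)] with x h1 h2 h3 h4 h5
  rw [h1, h5, Pi.add_apply, h2, h3]
  by_cases h : x ∈ boxSet L b
  · rw [Set.indicator_of_mem h, Set.indicator_of_mem h, Set.indicator_of_mem h, h4, Pi.add_apply]
  · rw [Set.indicator_of_notMem h, Set.indicator_of_notMem h, Set.indicator_of_notMem h, add_zero]

theorem boxRestrict_smul (L : ℝ) {n : ℕ} (b : Fin n) (c : ℂ) (f : OneSpace L) :
    boxRestrict L b (c • f) = c • boxRestrict L b f := by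
  refine Lp.ext ?_
  filter_upwards [boxRestrict_coeFn L b (c • f), boxRestrict_coeFn L b f,
    Lp.coeFn_smul c f, Lp.coeFn_smul c (boxRestrict L b f)] with x h1 h2 h4 h5
  rw [h1, h5, Pi.smul_apply, h2]
  by_cases h : x ∈ boxSet L b
  · rw [Set.indicator_of_mem h, Set.indicator_of_mem h, h4, Pi.smul_apply]
  · rw [Set.indicator_of_notMem h, Set.indicator_of_notMem h, smul_zero]

/-- Multiplication by the indicator function of box `b`. -/
def boxProj (L : ℝ) {n : ℕ} (b : Fin n) : OneSpace L →L[ℂ] OneSpace L :=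
  LinearMap.mkContinuous
    { toFun := boxRestrict L b
      map_add' := boxRestrict_add L b
      map_smul' := boxRestrict_smul L b } 1
    fun f => by rw [one_mul]; exact norm_boxRestrict_le L b f

theorem boxProj_coeFn (L : ℝ) {n : ℕ} (b : Fin n) (f : OneSpace L) :
    boxProj L b f =ᵐ[lineMeasure L] (boxSet L b).indicator f :=
  boxRestrict_coeFn L b f

theorem norm_boxProj_le (L : ℝ) {n : ℕ} (b : Fin n) (f : OneSpace L) :
    ‖boxProj L b f‖ ≤ ‖f‖ :=
  norm_boxRestrict_le L b f

theorem inner_boxProj_left (L : ℝ) {n : ℕ} (b : Fin n) (f g : OneSpace L) :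
    inner ℂ (boxProj L b f) g = inner ℂ f (boxProj L b g) := by
  rw [inner_Lp_eq _ _ (boxProj_coeFn L b f) (ae_eq_refl _),
    inner_Lp_eq _ _ (ae_eq_refl _) (boxProj_coeFn L b g)]
  congr 1
  funext x
  by_cases h : x ∈ boxSet L b <;> simp [h]

theorem boxProj_boxVec {L : ℝ} (hL : 0 < L) {n : ℕ} (b : Fin n) (a : Wavelet n) :
    boxProj L b (boxVec L a) = if a.box = b then boxVec L a else 0 := by
  refine Lp.ext ?_
  split_ifs with h
  · subst h
    filter_upwards [boxProj_coeFn L a.box (boxVec L a), boxVec_coeFn L a] with x h1 h2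
    rw [h1]
    by_cases hx : x ∈ boxSet L a.box
    · simp [hx]
    · simp [hx, h2, boxFun]
  · filter_upwards [boxProj_coeFn L b (boxVec L a), boxVec_coeFn L a,
      Lp.coeFn_zero ℂ 2 (lineMeasure L)] with x h1 h2 h3
    rw [h1, h3]
    by_cases hx : x ∈ boxSet L b
    · have : x ∉ boxSet L a.box := fun h' => h (boxSet_unique hL h' hx)
      simp [hx, h2, boxFun, this]
    · simp [hx]

/-- The potential of one particle at time `s`. -/
def potOp (L : ℝ) {n : ℕ} (v : Fin n → ℝ → ℝ) (s : ℝ) : OneSpace L →L[ℂ] OneSpace L :=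
  ∑ b, ((v b s : ℝ) : ℂ) • boxProj L b

theorem potOp_apply (L : ℝ) {n : ℕ} (v : Fin n → ℝ → ℝ) (s : ℝ) (f : OneSpace L) :
    potOp L v s f = ∑ b, ((v b s : ℝ) : ℂ) • boxProj L b f := by
  rw [potOp, _root_.sum_apply]
  rfl

theorem inner_potOp_left (L : ℝ) {n : ℕ} (v : Fin n → ℝ → ℝ) (s : ℝ) (f g : OneSpace L) :
    inner ℂ (potOp L v s f) g = inner ℂ f (potOp L v s g) := by
  rw [potOp_apply, potOp_apply, sum_inner, inner_sum]
  refine Finset.sum_congr rfl fun b _ => ?_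
  rw [inner_smul_left, inner_smul_right, inner_boxProj_left, Complex.conj_ofReal]

theorem potOp_boxVec {L : ℝ} (hL : 0 < L) {n : ℕ} (v : Fin n → ℝ → ℝ) (s : ℝ) (a : Wavelet n) :
    potOp L v s (boxVec L a) = ((v a.box s : ℝ) : ℂ) • boxVec L a := by
  rw [potOp_apply, Finset.sum_eq_single a.box]
  · rw [boxProj_boxVec hL, if_pos rfl]
  · intro b _ hb
    rw [boxProj_boxVec hL, if_neg hb.symm, smul_zero]
  · simp

theorem norm_potOp_le (L : ℝ) {n : ℕ} (v : Fin n → ℝ → ℝ) (s : ℝ) (f : OneSpace L) :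
    ‖potOp L v s f‖ ≤ (∑ b, |v b s|) * ‖f‖ := by
  rw [potOp_apply, Finset.sum_mul]
  refine (norm_sum_le _ _).trans (Finset.sum_le_sum fun b _ => ?_)
  rw [norm_smul, Complex.norm_real, Real.norm_eq_abs]
  gcongr
  exact norm_boxProj_le L b f

/-! ### The interaction picture of one particle -/

section Interaction

variable {L : ℝ} (hL : 0 < L) {n : ℕ} (v : Fin n → ℝ → ℝ)

/-- The potential of one particle in the interaction picture. -/
def intOp (s : ℝ) : OneSpace L →L[ℂ] OneSpace L :=
  freeProp hL (-s) ∘L potOp L v s ∘L freeProp hL s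

theorem intOp_apply (s : ℝ) (x : OneSpace L) :
    intOp hL v s x = freeProp hL (-s) (potOp L v s (freeProp hL s x)) := rfl

theorem inner_intOp_left (s : ℝ) (x y : OneSpace L) :
    inner ℂ (intOp hL v s x) y = inner ℂ x (intOp hL v s y) := by
  rw [intOp_apply, intOp_apply, inner_freeProp_left, inner_potOp_left, neg_neg,
    ← inner_freeProp_left]

theorem norm_intOp_le (s : ℝ) (x : OneSpace L) :
    ‖intOp hL v s x‖ ≤ (∑ b, |v b s|) * ‖x‖ := by
  rw [intOp_apply, norm_freeProp, ← norm_freeProp hL s x]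
  exact norm_potOp_le _ _ _ _

variable {v}

theorem locallyIntegrable_abs (hv : ∀ b, LocallyIntegrable (v b)) :
    LocallyIntegrable fun s => ∑ b, |v b s| := by
  refine locallyIntegrable_finsetSum _ fun b _ => ?_
  exact (hv b).mono (hv b).aestronglyMeasurable.norm (by simp)

/-- In the expansion over boxes each term is a scalar `v b s` times a continuous vector. This avoids
any measurability question for the operator-valued map itself. -/
theorem locallyIntegrable_intOp (hv : ∀ b, LocallyIntegrable (v b)) {u : ℝ → OneSpace L}
    (hu : Continuous u) : LocallyIntegrable fun s => intOp hL v s (u s) := by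
  have e : (fun s => intOp hL v s (u s)) = fun s => ∑ b, v b s •
      freeProp hL (-s) (boxProj L b (freeProp hL s (u s))) := by
    funext s
    rw [intOp_apply, potOp_apply, map_sum]
    refine Finset.sum_congr rfl fun b _ => ?_
    rw [map_smul, Complex.coe_smul]
    rfl
  rw [e]
  refine locallyIntegrable_finsetSum _ fun b _ => ?_
  refine locallyIntegrable_bilin_continuous (ContinuousLinearMap.lsmul ℝ ℝ) (hv b) ?_
  exact continuous_freeProp hL ((boxProj L b).continuous.comp
    (continuous_freeProp hL hu continuous_id)) continuous_neg

/-- `u` solves the one-particle equation in the interaction picture. -/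
def IsOrbit (v : Fin n → ℝ → ℝ) (u : ℝ → OneSpace L) : Prop :=
  IsPrimitive u fun s => -Complex.I • intOp hL v s (u s)

theorem exists_isOrbit (hv : ∀ b, LocallyIntegrable (v b)) (u₀ : OneSpace L) :
    ∃ u, u 0 = u₀ ∧ IsOrbit hL v u := by
  refine volterra_exists (B := fun s => -Complex.I • intOp hL v s) (locallyIntegrable_abs hv)
    (fun s => Finset.sum_nonneg fun b _ => abs_nonneg _) (fun s x => ?_) (fun u hu => ?_) u₀
  · simpa [norm_smul] using norm_intOp_le hL v s x
  · exact (locallyIntegrable_intOp hL hv hu).smul (-Complex.I)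

theorem IsOrbit.unique (hv : ∀ b, LocallyIntegrable (v b)) {u u' : ℝ → OneSpace L}
    (hu : IsOrbit hL v u) (hu' : IsOrbit hL v u') (h : u 0 = u' 0) : u = u' := by
  refine volterra_unique (B := fun s => -Complex.I • intOp hL v s) (locallyIntegrable_abs hv)
    (fun s => Finset.sum_nonneg fun b _ => abs_nonneg _) (fun s x => ?_) hu hu' h
  simpa [norm_smul] using norm_intOp_le hL v s x

/-- The interaction-picture generator is -i times a symmetric operator, so the two terms of the
product rule cancel. This keeps the orbitals orthonormal. -/
theorem IsOrbit.inner_eq {u u' : ℝ → OneSpace L} (hu : IsOrbit hL v u)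
    (hu' : IsOrbit hL v u') (t : ℝ) : inner ℂ (u t) (u' t) = inner ℂ (u 0) (u' 0) := by
  have h := (IsPrimitive.inner hu hu').eq_add_integral t
  have e : ∀ s, inner ℂ (u s) (-Complex.I • intOp hL v s (u' s)) +
      inner ℂ (-Complex.I • intOp hL v s (u s)) (u' s) = 0 := by
    intro s
    rw [inner_smul_left, inner_smul_right, inner_intOp_left]
    simp
  rwa [funext e, intervalIntegral.integral_zero, add_zero] at h

theorem isPrimitive_inner_orbit {u : ℝ → OneSpace L} (hu : IsOrbit hL v u) (x : OneSpace L) :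
    IsPrimitive (fun t => inner ℂ x (u t)) fun s => -Complex.I * inner ℂ x (intOp hL v s (u s)) := by
  have := IsPrimitive.clm ((innerSL ℂ x).restrictScalars ℝ) hu
  simpa [inner_smul_right] using this

/-- The orbit that starts at the wavelet `c`. -/
def orbit (hv : ∀ b, LocallyIntegrable (v b)) (c : Wavelet n) : ℝ → OneSpace L :=
  (exists_isOrbit hL hv (boxVec L c)).choose

theorem orbit_zero (hv : ∀ b, LocallyIntegrable (v b)) (c : Wavelet n) :
    orbit hL hv c 0 = boxVec L c :=
  (exists_isOrbit hL hv (boxVec L c)).choose_spec.1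

theorem isOrbit_orbit (hv : ∀ b, LocallyIntegrable (v b)) (c : Wavelet n) :
    IsOrbit hL v (orbit hL hv c) :=
  (exists_isOrbit hL hv (boxVec L c)).choose_spec.2

theorem green_eq (t : ℝ) (a c : Wavelet n) :
    green L t a c = inner ℂ (boxVec L a) (freeProp hL t (boxVec L c)) := by
  rw [← (hasSum_inner_freeProp hL t _ _).tsum_eq, green]
  refine tsum_congr fun m => ?_
  rw [← inner_ringVec_boxVec hL, ← inner_ringVec_boxVec hL, inner_conj_symm]
  push_cast
  rfl

/-- The sum over γ in the definition of U_t is Parseval in the wavelet basis, in which the potential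
is diagonal. -/
theorem interaction_eq (hn : 0 < n) (t : ℝ) (a c : Wavelet n) :
    interaction L v t a c = inner ℂ (boxVec L a) (intOp hL v t (boxVec L c)) := by
  rw [intOp_apply, ← neg_neg t, neg_neg (-t), ← inner_freeProp_left, neg_neg,
    ← (boxBasis hL hn).tsum_inner_mul_inner, interaction]
  refine tsum_congr fun g => ?_
  rw [green_eq hL, green_eq hL, boxBasis_apply, ← inner_freeProp_left,
    ← inner_potOp_left, potOp_boxVec hL, inner_smul_left, Complex.conj_ofReal, mul_assoc]

theorem hasSum_interaction_mul (hn : 0 < n) (t : ℝ) (a : Wavelet n) (x : OneSpace L) :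
    HasSum (fun g => interaction L v t a g * inner ℂ (boxVec L g) x)
      (inner ℂ (boxVec L a) (intOp hL v t x)) := by
  have := (boxBasis hL hn).hasSum_inner_mul_inner (intOp hL v t (boxVec L a)) x
  rw [inner_intOp_left] at this
  simpa [interaction_eq hL hn, inner_intOp_left] using this

theorem tsum_green_mul (hn : 0 < n) (t : ℝ) (a : Wavelet n) (x : OneSpace L) :
    ∑' g, green L t a g * inner ℂ (boxVec L g) x = inner ℂ (boxVec L a) (freeProp hL t x) := by
  have := (boxBasis hL hn).tsum_inner_mul_inner (freeProp hL (-t) (boxVec L a)) x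
  rw [inner_freeProp_left, neg_neg] at this
  rw [← this]
  refine tsum_congr fun g => ?_
  rw [green_eq hL, boxBasis_apply, inner_freeProp_left, neg_neg]

theorem isPsiTilde_orbit (hn : 0 < n) (hv : ∀ b, LocallyIntegrable (v b)) :
    IsPsiTilde L v fun t a c => inner ℂ (boxVec L a) (orbit hL hv c t) := by
  have hp := fun a c : Wavelet n => isPrimitive_inner_orbit hL (isOrbit_orbit hL hv c) (boxVec L a)
  refine ⟨fun c => ⟨fun t => (boxBasis hL hn).repr (orbit hL hv c t), ?_, fun t a => ?_⟩,
    fun a c t => ?_, fun a c t => ?_⟩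
  · exact (boxBasis hL hn).repr.continuous.comp (isOrbit_orbit hL hv c).continuous
  · rw [HilbertBasis.repr_apply_apply, boxBasis_apply]
  · simp only [(hasSum_interaction_mul hL hn _ _ _).tsum_eq]
    have := ((hp a c).1.intervalIntegrable' 0 t).const_mul Complex.I
    simpa [← mul_assoc] using this
  · simp only [(hasSum_interaction_mul hL hn _ _ _).tsum_eq]
    rw [(hp a c).eq_add_integral t, orbit_zero,
      orthonormal_iff_ite.1 (orthonormal_boxVec hL n) a c, intervalIntegral.integral_const_mul]
    ring

/-- The continuous ℓ² column is the coordinate list of a continuous one-particle vector. The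
coordinate equations assemble into the orbit equation of that vector, and orbits are unique. -/
theorem IsPsiTilde.eq_orbit (hn : 0 < n) (hv : ∀ b, LocallyIntegrable (v b))
    {ψt : ℝ → Wavelet n → Wavelet n → ℂ} (h : IsPsiTilde L v ψt) (t : ℝ) (a c : Wavelet n) :
    ψt t a c = inner ℂ (boxVec L a) (orbit hL hv c t) := by
  obtain ⟨u, huc, hu⟩ := h.column c
  set x : ℝ → OneSpace L := fun t => (boxBasis hL hn).repr.symm (u t) with hx
  have hxc : Continuous x := (boxBasis hL hn).repr.symm.continuous.comp huc
  have hxa : ∀ t a, inner ℂ (boxVec L a) (x t) = ψt t a c := by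
    intro t a
    rw [← boxBasis_apply hL hn, ← HilbertBasis.repr_apply_apply, hx]
    simp [hu]
  -- Bochner integrability of the whole vector is needed before the coordinate functionals can be
  -- exchanged with the integral.
  have hloc : LocallyIntegrable fun s => -Complex.I • intOp hL v s (x s) :=
    (locallyIntegrable_intOp hL hv hxc).smul (-Complex.I)
  have heq : ∀ t, x t = boxVec L c + ∫ s in (0 : ℝ)..t, -Complex.I • intOp hL v s (x s) := by
    intro t
    refine (boxBasis hL hn).ext_inner fun a => ?_
    have e := ((innerSL ℂ (boxVec L a)).restrictScalars ℝ).intervalIntegral_comp_comm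
      (hloc.intervalIntegrable' 0 t)
    simp only [ContinuousLinearMap.coe_restrictScalars', innerSL_apply_apply] at e
    rw [boxBasis_apply, hxa, h.equation, inner_add_right, ← e,
      orthonormal_iff_ite.1 (orthonormal_boxVec hL n) a c]
    simp only [← hxa, (hasSum_interaction_mul hL hn _ _ _).tsum_eq, inner_smul_right]
    rw [intervalIntegral.integral_const_mul]
    ring
  have h0 : x 0 = boxVec L c := by rw [heq 0]; simp
  have hxo : IsOrbit hL v x := ⟨hloc, fun t => by rw [h0]; exact heq t⟩
  rw [← hxa, hxo.unique hL hv (isOrbit_orbit hL hv c) (by rw [h0, orbit_zero])]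

theorem IsPsiTilde.psi_eq (hn : 0 < n) (hv : ∀ b, LocallyIntegrable (v b))
    {ψt : ℝ → Wavelet n → Wavelet n → ℂ} (h : IsPsiTilde L v ψt) (t : ℝ) (a c : Wavelet n) :
    psi L ψt t a c = inner ℂ (boxVec L a) (freeProp hL t (orbit hL hv c t)) := by
  rw [psi, ← tsum_green_mul hL hn]
  exact tsum_congr fun g => by rw [h.eq_orbit hL hn hv]

end Interaction

theorem existsUnique_psiTilde {L : ℝ} (hL : 0 < L) {n : ℕ} {v : Fin n → ℝ → ℝ} (hn : 0 < n) (hv : ∀ b, LocallyIntegrable (v b)) :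
    ∃! ψt : ℝ → Wavelet n → Wavelet n → ℂ, IsPsiTilde L v ψt :=
  ⟨_, isPsiTilde_orbit hL hn hv, fun ψt h => by
    funext t a c
    exact h.eq_orbit hL hn hv t a c⟩

/-! ### The sign of an arrangement of points -/

/-- `∏_{i < j} sgn (x_i - x_j)`. -/
def pairSign {N : ℕ} (x : Fin N → ℝ) : ℂ :=
  ∏ i, ∏ j, if i < j then ((Real.sign (x i - x j) : ℝ) : ℂ) else 1

theorem real_sign_mul (a b : ℝ) : Real.sign (a * b) = Real.sign a * Real.sign b := by
  rcases lt_trichotomy a 0 with ha | rfl | ha <;> rcases lt_trichotomy b 0 with hb | rfl | hb <;>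
    simp [*, Real.sign_of_neg, Real.sign_of_pos, mul_pos_of_neg_of_neg, mul_neg_of_pos_of_neg,
      mul_neg_of_neg_of_pos]

/-- The sign of a real number, as a monoid homomorphism. -/
def realSignHom : ℝ →* ℝ where
  toFun := Real.sign
  map_one' := Real.sign_one
  map_mul' := real_sign_mul

/-- The Vandermonde determinant of -x is the product of x_i - x_j over i < j. Antisymmetry of
`pairSign` is thereby inherited from determinants. -/
theorem pairSign_eq_sign_det {N : ℕ} (x : Fin N → ℝ) :
    pairSign x = ((Real.sign (Matrix.vandermonde (-x)).det : ℝ) : ℂ) := by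
  rw [Matrix.det_vandermonde]
  change _ = ((realSignHom _ : ℝ) : ℂ)
  rw [map_prod, Complex.ofReal_prod, pairSign]
  refine Finset.prod_congr rfl fun i _ => ?_
  rw [map_prod, Complex.ofReal_prod, ← Finset.prod_filter]
  refine Finset.prod_congr (by ext; simp) fun j _ => ?_
  simp only [Pi.neg_apply, realSignHom, MonoidHom.coe_mk, OneHom.coe_mk]
  congr 2
  ring

theorem pairSign_comp {N : ℕ} (x : Fin N → ℝ) (σ : Equiv.Perm (Fin N)) :
    pairSign (x ∘ σ) = ((Equiv.Perm.sign σ : ℤ) : ℂ) * pairSign x := by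
  have h : Matrix.vandermonde (-(x ∘ σ)) = (Matrix.vandermonde (-x)).submatrix σ id := by
    ext i j
    simp [Matrix.vandermonde_apply]
  rw [pairSign_eq_sign_det, pairSign_eq_sign_det, h, Matrix.det_permute, real_sign_mul]
  push_cast
  congr 1
  rcases Int.units_eq_one_or (Equiv.Perm.sign σ) with h | h
  · simp [h]
  · simp [h, Real.sign_of_neg]

theorem pairSign_mul_self {N : ℕ} {x : Fin N → ℝ} (hx : Function.Injective x) :
    pairSign x * pairSign x = 1 := by
  have : (Matrix.vandermonde (-x)).det ≠ 0 :=
    Matrix.det_vandermonde_ne_zero_iff.2 (neg_injective.comp hx)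
  rw [pairSign_eq_sign_det]
  rcases this.lt_or_gt with h | h
  · simp [Real.sign_of_neg h]
  · simp [Real.sign_of_pos h]

theorem conj_pairSign {N : ℕ} (x : Fin N → ℝ) : conj (pairSign x) = pairSign x := by
  rw [pairSign_eq_sign_det, Complex.conj_ofReal]

theorem norm_pairSign_le {N : ℕ} (x : Fin N → ℝ) : ‖pairSign x‖ ≤ 1 := by
  rw [pairSign_eq_sign_det]
  exact norm_sign_le _

theorem measurable_pairSign {N : ℕ} : Measurable (pairSign : (Fin N → ℝ) → ℂ) := by
  unfold pairSign
  refine Finset.measurable_prod _ fun i _ => Finset.measurable_prod _ fun j _ => ?_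
  split_ifs
  · exact measurable_sign_sub i j
  · exact measurable_const

/-! ### Product functions on the cube -/

theorem cubeMeasure_eq_pi (L : ℝ) (N : ℕ) :
    cubeMeasure L N = Measure.pi fun _ : Fin N => lineMeasure L := by
  rw [cubeMeasure, volume_pi, Measure.restrict_pi_pi]

instance isFiniteMeasure_cubeMeasure (L : ℝ) (N : ℕ) : IsFiniteMeasure (cubeMeasure L N) := by
  rw [cubeMeasure_eq_pi]
  infer_instance

theorem ae_eval {L : ℝ} {N : ℕ} {p : Fin N → ℝ → Prop} (h : ∀ j, ∀ᵐ x ∂(lineMeasure L), p j x) :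
    ∀ᵐ x ∂(cubeMeasure L N), ∀ j, p j (x j) := by
  rw [ae_all_iff, cubeMeasure_eq_pi]
  intro j
  exact (Measure.quasiMeasurePreserving_eval (fun _ : Fin N => lineMeasure L) j).ae (h j)

/-- For i ≠ j the coincidence set x_i = x_j is a proper linear subspace, hence null. Off these sets
`pairSign` squares to one. -/
theorem ae_injective (L : ℝ) (N : ℕ) : ∀ᵐ x ∂(cubeMeasure L N), Function.Injective x := by
  have h : ∀ i j : Fin N, ∀ᵐ x ∂(cubeMeasure L N), x i = x j → i = j := by
    intro i j
    by_cases hij : i = j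
    · exact Filter.Eventually.of_forall fun _ _ => hij
    refine ae_restrict_of_ae ?_
    have hs := Measure.addHaar_submodule (volume : Measure (Fin N → ℝ))
      (LinearMap.ker ((LinearMap.proj i : (Fin N → ℝ) →ₗ[ℝ] ℝ) - LinearMap.proj j))
      (by
        intro htop
        have : Pi.single i (1 : ℝ) ∈ LinearMap.ker
            ((LinearMap.proj i : (Fin N → ℝ) →ₗ[ℝ] ℝ) - LinearMap.proj j) := by
          rw [htop]; trivial
        simp [Ne.symm hij] at this)
    filter_upwards [measure_eq_zero_iff_ae_notMem.1 hs] with x hx hxe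
    exact absurd (by simp [hxe]) hx
  filter_upwards [ae_all_iff.2 fun i => ae_all_iff.2 (h i)] with x hx i j hij
  exact hx i j hij

theorem coe_piCongrLeft_symm {N : ℕ} (σ : Equiv.Perm (Fin N)) :
    ⇑(MeasurableEquiv.piCongrLeft (fun _ : Fin N => ℝ) σ.symm) = fun x => x ∘ σ := by
  funext x j
  obtain ⟨i, rfl⟩ := σ.symm.surjective j
  rw [MeasurableEquiv.coe_piCongrLeft, Equiv.piCongrLeft_apply_apply]
  simp

theorem measurePreserving_comp_perm (L : ℝ) {N : ℕ} (σ : Equiv.Perm (Fin N)) :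
    MeasurePreserving (fun x : Fin N → ℝ => x ∘ σ) (cubeMeasure L N) (cubeMeasure L N) := by
  rw [cubeMeasure_eq_pi]
  have := measurePreserving_piCongrLeft (α := fun _ : Fin N => ℝ) (fun _ => lineMeasure L) σ.symm
  rwa [coe_piCongrLeft_symm] at this

theorem integral_comp_perm (L : ℝ) {N : ℕ} (σ : Equiv.Perm (Fin N)) (f : (Fin N → ℝ) → ℂ) :
    ∫ x, f (x ∘ σ) ∂(cubeMeasure L N) = ∫ x, f x ∂(cubeMeasure L N) := by
  refine (measurePreserving_comp_perm L σ).integral_comp ?_ f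
  rw [← coe_piCongrLeft_symm]
  exact MeasurableEquiv.measurableEmbedding _

theorem memLp_tensor {L : ℝ} {N : ℕ} (g : Fin N → OneSpace L) :
    MemLp (fun x : Fin N → ℝ => ∏ j, g j (x j)) 2 (cubeMeasure L N) := by
  have hm : StronglyMeasurable fun x : Fin N → ℝ => ∏ j, g j (x j) := by
    refine Finset.stronglyMeasurable_fun_prod _ fun j _ => ?_
    exact (Lp.stronglyMeasurable (g j)).comp_measurable (measurable_pi_apply j)
  rw [memLp_two_iff_integrable_sq_norm hm.aestronglyMeasurable, cubeMeasure_eq_pi]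
  simp only [norm_prod, ← Finset.prod_pow]
  exact Integrable.fintype_prod (f := fun j x => ‖g j x‖ ^ 2) fun j =>
    (memLp_two_iff_integrable_sq_norm (Lp.aestronglyMeasurable (g j))).1 (Lp.memLp (g j))

theorem integral_tensor_mul {L : ℝ} {N : ℕ} (f g : Fin N → OneSpace L) :
    ∫ x, conj (∏ j, f j (x j)) * ∏ j, g j (x j) ∂(cubeMeasure L N) =
      ∏ j, inner ℂ (f j) (g j) := by
  simp only [map_prod, ← Finset.prod_mul_distrib]
  rw [cubeMeasure_eq_pi, integral_fintype_prod_eq_prod (fun j x => conj (f j x) * g j x)]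
  exact Finset.prod_congr rfl fun j _ => (inner_Lp_eq _ _ (ae_eq_refl _) (ae_eq_refl _)).symm

/-! ### Hardcore states from Slater determinants -/

/-- The Slater determinant of the functions `g`, times the sign that makes it symmetric. -/
def slaterFun {N : ℕ} (g : Fin N → ℝ → ℂ) (x : Fin N → ℝ) : ℂ :=
  ((Real.sqrt (N ! : ℝ) : ℝ) : ℂ)⁻¹ * (pairSign x * (Matrix.of fun i j => g i (x j)).det)

theorem slaterFun_eq_sum {N : ℕ} (g : Fin N → ℝ → ℂ) (x : Fin N → ℝ) :
    slaterFun g x = ((Real.sqrt (N ! : ℝ) : ℝ) : ℂ)⁻¹ * (pairSign x *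
      ∑ σ : Equiv.Perm (Fin N), ((Equiv.Perm.sign σ : ℤ) : ℂ) * ∏ j, g (σ j) (x j)) := by
  rw [slaterFun, Matrix.det_apply']
  rfl

theorem memLp_pairSign_mul {L : ℝ} {N : ℕ} {f : (Fin N → ℝ) → ℂ}
    (hf : MemLp f 2 (cubeMeasure L N)) :
    MemLp (fun x => pairSign x * f x) 2 (cubeMeasure L N) := by
  refine hf.of_le (measurable_pairSign.aestronglyMeasurable.mul hf.1)
    (Filter.Eventually.of_forall fun x => ?_)
  rw [norm_mul]
  exact mul_le_of_le_one_left (norm_nonneg _) (norm_pairSign_le x)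

theorem memLp_slaterFun {L : ℝ} {N : ℕ} (g : Fin N → OneSpace L) :
    MemLp (slaterFun fun i => g i) 2 (cubeMeasure L N) := by
  rw [funext (slaterFun_eq_sum fun i => g i)]
  refine (memLp_pairSign_mul (memLp_finsetSum _ fun σ _ => ?_)).const_mul _
  exact (memLp_tensor (g ∘ σ)).const_mul _

/-- The hardcore boson state of the orbitals `g`. -/
def slater {L : ℝ} {N : ℕ} (g : Fin N → OneSpace L) : NSpace L N := (memLp_slaterFun g).toLp _

theorem slater_coeFn {L : ℝ} {N : ℕ} (g : Fin N → OneSpace L) :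
    slater g =ᵐ[cubeMeasure L N] slaterFun fun i => g i :=
  MemLp.coeFn_toLp _

theorem slaterFun_comp {N : ℕ} (g : Fin N → ℝ → ℂ) (x : Fin N → ℝ) (σ : Equiv.Perm (Fin N)) :
    slaterFun g (x ∘ σ) = slaterFun g x := by
  have h : (Matrix.of fun i j => g i ((x ∘ σ) j)) =
      (Matrix.of fun i j => g i (x j)).submatrix id σ := rfl
  rw [slaterFun, slaterFun, h, Matrix.det_permute', pairSign_comp]
  have h1 : ((Equiv.Perm.sign σ : ℤ) : ℂ) * ((Equiv.Perm.sign σ : ℤ) : ℂ) = 1 := by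
    rcases Int.units_eq_one_or (Equiv.Perm.sign σ) with h | h <;> simp [h]
  linear_combination ((Real.sqrt (N ! : ℝ) : ℝ) : ℂ)⁻¹ * pairSign x *
    (Matrix.of fun i j => g i (x j)).det * h1

theorem slaterFun_congr {L : ℝ} {N : ℕ} {g g' : Fin N → ℝ → ℂ}
    (h : ∀ i, g i =ᵐ[lineMeasure L] g' i) :
    slaterFun g =ᵐ[cubeMeasure L N] slaterFun g' := by
  have : ∀ᵐ x ∂(lineMeasure L), ∀ i, g i x = g' i x := ae_all_iff.2 h
  filter_upwards [ae_eval (N := N) fun _ => this] with x hx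
  rw [slaterFun, slaterFun]
  congr 3
  ext i j
  exact hx j i

theorem isBosonic_of_ae_eq {L : ℝ} {N : ℕ} {f : NSpace L N} {f' : (Fin N → ℝ) → ℂ}
    (h : f =ᵐ[cubeMeasure L N] f') (hf : ∀ (σ : Equiv.Perm (Fin N)) x, f' (x ∘ σ) = f' x) :
    IsBosonic f := by
  intro σ
  filter_upwards [h, (measurePreserving_comp_perm L σ).quasiMeasurePreserving.ae h] with x h1 h2
  rw [h1, h2, hf]

theorem isBosonic_slater {L : ℝ} {N : ℕ} (g : Fin N → OneSpace L) : IsBosonic (slater g) :=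
  isBosonic_of_ae_eq (slater_coeFn g) fun σ x => slaterFun_comp _ x σ

theorem sqrt_factorial_ne_zero (N : ℕ) : ((Real.sqrt (N ! : ℝ) : ℝ) : ℂ) ≠ 0 := by
  have : (0 : ℝ) < N ! := by positivity
  simpa using (Real.sqrt_pos.2 this).ne'

/-- Against a symmetric function all N! terms of the determinant contribute equally after a
relabelling of the particles, so the prefactor becomes N!/√N! = √N!. -/
theorem inner_slater_of_isBosonic {L : ℝ} {N : ℕ} (g : Fin N → OneSpace L) {F : NSpace L N}
    (hF : IsBosonic F) : inner ℂ (slater g) F = ((Real.sqrt (N ! : ℝ) : ℝ) : ℂ) *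
      ∫ x, conj (∏ j, g j (x j)) * (pairSign x * F x) ∂(cubeMeasure L N) := by
  have hSF := memLp_pairSign_mul (Lp.memLp F)
  rw [inner_Lp_eq _ _ (slater_coeFn g) (ae_eq_refl _)]
  have e : ∀ x, conj (slaterFun (fun i => g i) x) * F x =
      ∑ σ : Equiv.Perm (Fin N), (((Real.sqrt (N ! : ℝ) : ℝ) : ℂ)⁻¹ *
        ((Equiv.Perm.sign σ : ℤ) : ℂ)) *
          (conj (∏ j, g (σ j) (x j)) * (pairSign x * F x)) := by
    intro x
    rw [slaterFun_eq_sum, map_mul, map_mul, conj_pairSign, map_inv₀, Complex.conj_ofReal, map_sum,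
      Finset.mul_sum, Finset.mul_sum, Finset.sum_mul]
    refine Finset.sum_congr rfl fun σ _ => ?_
    rw [map_mul, map_intCast]
    ring
  simp_rw [e]
  rw [integral_finsetSum]
  · have hσ : ∀ σ : Equiv.Perm (Fin N),
        ∫ x, (((Real.sqrt (N ! : ℝ) : ℝ) : ℂ)⁻¹ * ((Equiv.Perm.sign σ : ℤ) : ℂ)) *
          (conj (∏ j, g (σ j) (x j)) * (pairSign x * F x)) ∂(cubeMeasure L N) =
        ((Real.sqrt (N ! : ℝ) : ℝ) : ℂ)⁻¹ *
          ∫ x, conj (∏ j, g j (x j)) * (pairSign x * F x) ∂(cubeMeasure L N) := by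
      intro σ
      rw [← integral_comp_perm L σ.symm
        (fun x => conj (∏ j, g j (x j)) * (pairSign x * F x)), integral_const_mul, mul_assoc,
        ← integral_const_mul ((Equiv.Perm.sign σ : ℤ) : ℂ)]
      congr 1
      refine integral_congr_ae ?_
      filter_upwards [hF σ.symm] with x hx
      rw [hx, pairSign_comp, Equiv.Perm.sign_symm]
      have : ∏ j, g j ((x ∘ σ.symm) j) = ∏ j, g (σ j) (x j) := by
        rw [← Equiv.prod_comp σ]
        simp
      rw [this]
      ring
    rw [Finset.sum_congr rfl fun σ _ => hσ σ, Finset.sum_const, Finset.card_univ,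
      Fintype.card_perm, Fintype.card_fin, nsmul_eq_mul, ← mul_assoc]
    congr 1
    have h1 : ((N ! : ℕ) : ℂ) = ((Real.sqrt (N ! : ℝ) : ℝ) : ℂ) * ((Real.sqrt (N ! : ℝ) : ℝ) : ℂ) :=
      by rw [sqrt_mul_sqrt_complex (by positivity)]; simp
    rw [h1, mul_assoc, mul_inv_cancel₀ (sqrt_factorial_ne_zero N), mul_one]
  · intro σ _
    refine Integrable.const_mul ?_ _
    exact ((memLp_tensor (g ∘ σ)).star).integrable_mul hSF

/-- The two pair signs cancel almost everywhere, so hardcore states have the Gram determinants of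
free fermions. -/
theorem inner_slater_slater {L : ℝ} {N : ℕ} (f g : Fin N → OneSpace L) :
    inner ℂ (slater f) (slater g) = (Matrix.of fun i j => inner ℂ (f i) (g j)).det := by
  rw [inner_slater_of_isBosonic f (isBosonic_slater g)]
  have e : ∫ x, conj (∏ j, f j (x j)) * (pairSign x * slater g x) ∂(cubeMeasure L N) =
      ∫ x, ∑ σ : Equiv.Perm (Fin N), (((Real.sqrt (N ! : ℝ) : ℝ) : ℂ)⁻¹ *
        ((Equiv.Perm.sign σ : ℤ) : ℂ)) * (conj (∏ j, f j (x j)) * ∏ j, g (σ j) (x j))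
        ∂(cubeMeasure L N) := by
    refine integral_congr_ae ?_
    filter_upwards [slater_coeFn g, ae_injective L N] with x hx hi
    rw [hx, slaterFun_eq_sum, mul_left_comm (pairSign x), ← mul_assoc (pairSign x),
      pairSign_mul_self hi, one_mul, Finset.mul_sum, Finset.mul_sum]
    refine Finset.sum_congr rfl fun σ _ => ?_
    ring
  rw [e, integral_finsetSum]
  · simp only [integral_const_mul]
    have : ∀ σ : Equiv.Perm (Fin N), ∫ x, conj (∏ j, f j (x j)) * ∏ j, g (σ j) (x j)
        ∂(cubeMeasure L N) = ∏ j, inner ℂ (f j) (g (σ j)) :=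
      fun σ => integral_tensor_mul f (g ∘ σ)
    simp only [this]
    rw [← Matrix.det_transpose, Matrix.det_apply', Finset.mul_sum]
    refine Finset.sum_congr rfl fun σ _ => ?_
    rw [mul_assoc, ← mul_assoc, mul_inv_cancel₀ (sqrt_factorial_ne_zero N), one_mul]
    rfl
  · intro σ _
    refine Integrable.const_mul ?_ _
    exact ((memLp_tensor f).star).integrable_mul (memLp_tensor (g ∘ σ))

/-- The squared norm of a difference of Slater states is a combination of Gram determinants, which
are continuous in the orbitals. -/
theorem continuous_slater {L : ℝ} {N : ℕ} {u : Fin N → ℝ → OneSpace L}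
    (hu : ∀ i, Continuous (u i)) : Continuous fun t => slater fun i => u i t := by
  rw [continuous_iff_continuousAt]
  intro s
  rw [ContinuousAt, tendsto_iff_norm_sub_tendsto_zero]
  have e : ∀ t, ‖(slater fun i => u i t) - slater fun i => u i s‖ = Real.sqrt (Complex.re
      ((Matrix.of fun i j => inner ℂ (u i t) (u j t)).det -
        2 * (Matrix.of fun i j => inner ℂ (u i t) (u j s)).det +
        (Matrix.of fun i j => inner ℂ (u i s) (u j s)).det)) := by
    intro t
    rw [← Real.sqrt_sq (norm_nonneg _), @norm_sub_sq ℂ, ← inner_slater_slater,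
      ← inner_slater_slater, ← inner_slater_slater, ← @inner_self_eq_norm_sq ℂ,
      ← @inner_self_eq_norm_sq ℂ]
    congr 1
    simp
  simp_rw [e]
  have hc : Continuous fun t => Real.sqrt (Complex.re
      ((Matrix.of fun i j => inner ℂ (u i t) (u j t)).det -
        2 * (Matrix.of fun i j => inner ℂ (u i t) (u j s)).det +
        (Matrix.of fun i j => inner ℂ (u i s) (u j s)).det)) := by
    refine Real.continuous_sqrt.comp (Complex.continuous_re.comp ?_)
    refine Continuous.add (Continuous.sub ?_ (continuous_const.mul ?_)) continuous_const
    · exact Continuous.matrix_det (continuous_matrix fun i j => (hu i).inner (hu j))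
    · exact Continuous.matrix_det (continuous_matrix fun i j => (hu i).inner continuous_const)
  have h0 := hc.tendsto s
  have h1 : ∀ z : ℂ, z - 2 * z + z = 0 := fun z => by ring
  simpa only [h1, Complex.zero_re, Real.sqrt_zero] using h0

/-! ### Eigenstates and wavelet states as Slater determinants -/

theorem exp_sum_eq_prod {N : ℕ} (x p : Fin N → ℝ) :
    Complex.exp (Complex.I * ∑ j, (x j : ℂ) * (p j : ℂ)) =
      ∏ j, Complex.exp (Complex.I * ((x j : ℂ) * (p j : ℂ))) := by
  rw [Finset.mul_sum, Complex.exp_sum]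

theorem sign_mul_sign {N : ℕ} (σ : Equiv.Perm (Fin N)) :
    ((Equiv.Perm.sign σ : ℤ) : ℂ) * ((Equiv.Perm.sign σ : ℤ) : ℂ) = 1 := by
  rcases Int.units_eq_one_or (Equiv.Perm.sign σ) with h | h <;> simp [h]

theorem eigenChi_eq {L : ℝ} (hL : 0 < L) {N : ℕ} (k : Fin N → ℤ) (x : Fin N → ℝ) :
    eigenChi L k x = ((Real.sqrt (N ! : ℝ) : ℝ) : ℂ)⁻¹ *
      slaterFun (fun i => ringFun L (k i)) x := by
  have hs : ((Real.sqrt L : ℝ) : ℂ) ≠ 0 := by simpa using (Real.sqrt_pos.2 hL).ne'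
  have hf := sqrt_factorial_ne_zero N
  rw [eigenChi, slaterFun_eq_sum]
  have e : ∀ σ : Equiv.Perm (Fin N), ∏ j, ringFun L (k (σ j)) (x j) =
      (((Real.sqrt L : ℝ) : ℂ) ^ N)⁻¹ *
        Complex.exp (Complex.I * ∑ j, (x j : ℂ) * (ringMomentum L (k (σ j)) : ℂ)) := by
    intro σ
    rw [exp_sum_eq_prod x fun j => ringMomentum L (k (σ j))]
    simp only [ringFun, Finset.prod_mul_distrib, Finset.prod_const, Finset.card_univ,
      Fintype.card_fin, inv_pow]
  simp only [e, mul_left_comm _ (((Real.sqrt L : ℝ) : ℂ) ^ N)⁻¹, ← Finset.mul_sum]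
  have h1 : ((N ! : ℕ) : ℂ) = ((Real.sqrt (N ! : ℝ) : ℝ) : ℂ) * ((Real.sqrt (N ! : ℝ) : ℝ) : ℂ) := by
    rw [sqrt_mul_sqrt_complex (by positivity)]; simp
  rw [h1, pairSign]
  simp only [mul_inv]
  ring

theorem bosonize_eigenChi {L : ℝ} (hL : 0 < L) {N : ℕ} (k : Fin N → ℤ) (x : Fin N → ℝ) :
    bosonize (eigenChi L k) x = slaterFun (fun i => ringFun L (k i)) x := by
  have hf := sqrt_factorial_ne_zero N
  have h1 : ((N ! : ℕ) : ℂ) = ((Real.sqrt (N ! : ℝ) : ℝ) : ℂ) * ((Real.sqrt (N ! : ℝ) : ℝ) : ℂ) := by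
    rw [sqrt_mul_sqrt_complex (by positivity)]; simp
  rw [bosonize]
  simp only [eigenChi_eq hL, slaterFun_comp]
  -- The function χ is already symmetric, so symmetrization yields N! equal terms; together with the
  -- two factors 1/√N! the constant is one.
  rw [Finset.sum_const, Finset.card_univ, Fintype.card_perm, Fintype.card_fin, nsmul_eq_mul, h1]
  field_simp

theorem eigenState_eq {L : ℝ} (hL : 0 < L) {N : ℕ} (k : Fin N → ℤ) :
    eigenState L k = slater fun i => ringVec L (k i) := by
  refine (MemLp.toLp_eq_toLp_iff _ _).2 ?_
  rw [funext (bosonize_eigenChi hL k)]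
  exact slaterFun_congr fun i => (ringVec_coeFn L (k i)).symm

/-- The sign `∏_{i < j, b_i ≠ b_j} sgn (b_i - b_j)` of a list of boxes. -/
def boxSign {n N : ℕ} (b : Fin N → Fin n) : ℂ :=
  ∏ i, ∏ j, if i < j ∧ b i ≠ b j then ((Real.sign ((b i : ℕ) - (b j : ℕ) : ℝ) : ℝ) : ℂ) else 1

theorem ofReal_sign_mul_self {r : ℝ} (hr : r ≠ 0) :
    ((Real.sign r : ℝ) : ℂ) * ((Real.sign r : ℝ) : ℂ) = 1 := by
  rcases hr.lt_or_gt with h | h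
  · simp [Real.sign_of_neg h]
  · simp [Real.sign_of_pos h]

theorem boxSign_mul_self {n N : ℕ} (b : Fin N → Fin n) : boxSign b * boxSign b = 1 := by
  rw [boxSign, ← Finset.prod_mul_distrib]
  refine Finset.prod_eq_one fun i _ => ?_
  rw [← Finset.prod_mul_distrib]
  refine Finset.prod_eq_one fun j _ => ?_
  split_ifs with h
  · refine ofReal_sign_mul_self (sub_ne_zero.2 fun e => h.2 (Fin.ext (by exact_mod_cast e)))
  · simp

theorem conj_boxSign {n N : ℕ} (b : Fin N → Fin n) : conj (boxSign b) = boxSign b := by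
  simp only [boxSign, map_prod, apply_ite (starRingEnd ℂ), Complex.conj_ofReal, map_one]

theorem boxSign_const {n N : ℕ} (c : Fin n) : boxSign (fun _ : Fin N => c) = 1 := by
  simp [boxSign]

theorem sign_sub_of_mem_box {L : ℝ} (hL : 0 < L) {n : ℕ} {b c : Fin n} (hbc : b ≠ c) {x y : ℝ}
    (hx : x ∈ boxSet L b) (hy : y ∈ boxSet L c) :
    Real.sign (x - y) = Real.sign ((b : ℕ) - (c : ℕ) : ℝ) := by
  rcases lt_or_gt_of_ne hbc with h | h
  · have h' : ((b : ℕ) : ℝ) < (c : ℕ) := by exact_mod_cast h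
    rw [Real.sign_of_neg (sub_neg.2 (boxSet_lt hL h hx hy)), Real.sign_of_neg (sub_neg.2 h')]
  · have h' : ((c : ℕ) : ℝ) < (b : ℕ) := by exact_mod_cast h
    rw [Real.sign_of_pos (sub_pos.2 (boxSet_lt hL h hy hx)), Real.sign_of_pos (sub_pos.2 h')]

open Classical in
/-- Points that lie in the boxes `b`: the signs of pairs in the same box. -/
theorem prod_sign_same_box {L : ℝ} (hL : 0 < L) {n N : ℕ} (b : Fin N → Fin n) (x : Fin N → ℝ)
    (hx : ∀ j, x j ∈ boxSet L (b j)) :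
    (∏ i, ∏ j, if i < j ∧ b i = b j then ((Real.sign (x i - x j) : ℝ) : ℂ) else 1) =
      boxSign b * pairSign x := by
  have h : pairSign x = (∏ i, ∏ j, if i < j ∧ b i = b j then ((Real.sign (x i - x j) : ℝ) : ℂ)
      else 1) * boxSign b := by
    rw [pairSign, boxSign, ← Finset.prod_mul_distrib]
    refine Finset.prod_congr rfl fun i _ => ?_
    rw [← Finset.prod_mul_distrib]
    refine Finset.prod_congr rfl fun j _ => ?_
    by_cases hij : i < j
    · by_cases hb : b i = b j
      · simp [hij, hb]
      · simp only [hij, hb, ne_eq, not_false_eq_true, and_self, and_false, if_true, if_false,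
          one_mul]
        rw [sign_sub_of_mem_box hL hb (hx i) (hx j)]
    · simp [hij]
  rw [h, mul_comm (boxSign b), mul_assoc, boxSign_mul_self, mul_one]

open Classical in
theorem card_box_perm {n N : ℕ} (a : Fin N → Wavelet n) :
    (Finset.univ.filter fun σ : Equiv.Perm (Fin N) => ∀ j, (a (σ j)).box = (a j).box).card =
      ∏ b : Fin n, (Finset.univ.filter fun j => (a j).box = b).card ! := by
  have := DomMulAct.stabilizer_card fun j => (a j).box
  simp only [Fintype.card_subtype] at this
  rw [← this]
  congr 1
  ext σ
  simp [funext_iff]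

open Classical in
-- When each point x_j lies in the box of label j, the same-box signs are `boxSign` times
-- `pairSign`. Otherwise both sides vanish: a box-preserving permutation leaves at the offending
-- point a plane wave of the same box.
theorem waveletChi_eq {L : ℝ} (hL : 0 < L) {n N : ℕ} (a : Fin N → Wavelet n) (x : Fin N → ℝ) :
    waveletChi L a x = boxSign (fun j => (a j).box) *
      (∏ b : Fin n, ((Finset.univ.filter fun j => (a j).box = b).card ! : ℂ))⁻¹ *
      (pairSign x * ∑ σ ∈ Finset.univ.filter
        (fun σ : Equiv.Perm (Fin N) => ∀ j, (a (σ j)).box = (a j).box),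
          ((Equiv.Perm.sign σ : ℤ) : ℂ) * ∏ j, boxFun L (a (σ j)) (x j)) := by
  rw [waveletChi]
  by_cases hx : ∀ j, x j ∈ boxSet L (a j).box
  · rw [prod_sign_same_box hL (fun j => (a j).box) x hx]
    have hind : ∏ j, (boxSet L (a j).box).indicator (fun _ => (1 : ℂ)) (x j) = 1 :=
      Finset.prod_eq_one fun j _ => by simp [hx j]
    have e : ∀ σ ∈ Finset.univ.filter
        (fun σ : Equiv.Perm (Fin N) => ∀ j, (a (σ j)).box = (a j).box),
        ((Equiv.Perm.sign σ : ℤ) : ℂ) * ∏ j, boxFun L (a (σ j)) (x j) =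
        ((Real.sqrt ((n : ℝ) / L) : ℝ) : ℂ) ^ N * (((Equiv.Perm.sign σ : ℤ) : ℂ) *
        Complex.exp (Complex.I * ∑ j, (x j : ℂ) * ((a (σ j)).momentum L : ℂ))) := by
      intro σ hσ
      have hσ' := (Finset.mem_filter.1 hσ).2
      rw [exp_sum_eq_prod x fun j => (a (σ j)).momentum L]
      have : ∀ j, boxFun L (a (σ j)) (x j) = ((Real.sqrt ((n : ℝ) / L) : ℝ) : ℂ) *
          Complex.exp (Complex.I * ((x j : ℂ) * ((a (σ j)).momentum L : ℂ))) := by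
        intro j
        rw [boxFun, Set.indicator_of_mem]
        rw [hσ' j]
        exact hx j
      simp only [this, Finset.prod_mul_distrib, Finset.prod_const, Finset.card_univ,
        Fintype.card_fin]
      ring
    rw [Finset.sum_congr rfl e, ← Finset.mul_sum, hind]
    ring
  · push Not at hx
    obtain ⟨i, hi⟩ := hx
    have hind : ∏ j, (boxSet L (a j).box).indicator (fun _ => (1 : ℂ)) (x j) = 0 :=
      Finset.prod_eq_zero (Finset.mem_univ i) (by simp [hi])
    rw [hind, mul_zero, Finset.sum_eq_zero, mul_zero, mul_zero]
    intro σ hσ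
    have hσ' := (Finset.mem_filter.1 hσ).2
    rw [Finset.prod_eq_zero (Finset.mem_univ i), mul_zero]
    rw [boxFun, Set.indicator_of_notMem]
    rw [hσ' i]
    exact hi

open Classical in
-- For a fixed box-preserving σ, the sum over all particle permutations is the full Slater
-- determinant, independently of σ. There are ∏ N_b! such σ, which the normalization divides out.
theorem bosonize_waveletChi {L : ℝ} (hL : 0 < L) {n N : ℕ} (a : Fin N → Wavelet n)
    (x : Fin N → ℝ) : bosonize (waveletChi L a) x =
      boxSign (fun j => (a j).box) * slaterFun (fun i => boxFun L (a i)) x := by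
  set D : ℂ := (Matrix.of fun i j => boxFun L (a i) (x j)).det with hD
  have hdet : ∀ σ : Equiv.Perm (Fin N), ∑ τ : Equiv.Perm (Fin N), ((Equiv.Perm.sign τ : ℤ) : ℂ) *
      (((Equiv.Perm.sign σ : ℤ) : ℂ) * ∏ j, boxFun L (a (σ j)) (x (τ j))) = D := by
    intro σ
    have h1 : ((Matrix.of fun i j => boxFun L (a i) (x j)).submatrix σ id).transpose.det =
        ((Equiv.Perm.sign σ : ℤ) : ℂ) * D := by
      rw [Matrix.det_transpose, Matrix.det_permute]
    rw [Matrix.det_apply'] at h1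
    have h2 := congrArg (fun z => ((Equiv.Perm.sign σ : ℤ) : ℂ) * z) h1
    simp only [Finset.mul_sum] at h2
    rw [← mul_assoc, sign_mul_sign, one_mul] at h2
    rw [← h2]
    refine Finset.sum_congr rfl fun τ _ => ?_
    rw [mul_left_comm]
    rfl
  rw [bosonize]
  simp only [waveletChi_eq hL]
  set G := Finset.univ.filter
    (fun σ : Equiv.Perm (Fin N) => ∀ j, (a (σ j)).box = (a j).box) with hG
  set P : ℂ := ∏ b : Fin n, ((Finset.univ.filter fun j => (a j).box = b).card ! : ℂ) with hP
  have hcard : (G.card : ℂ) = P := by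
    rw [hG, card_box_perm, hP]
    push_cast
    rfl
  have hP0 : P ≠ 0 := by
    rw [hP]
    refine Finset.prod_ne_zero_iff.2 fun b _ => ?_
    exact_mod_cast Nat.factorial_ne_zero _
  have hsum : ∑ τ : Equiv.Perm (Fin N), (pairSign (x ∘ τ) * ∑ σ ∈ G,
      ((Equiv.Perm.sign σ : ℤ) : ℂ) * ∏ j, boxFun L (a (σ j)) ((x ∘ τ) j)) =
      P * (pairSign x * D) := by
    have e : ∀ τ : Equiv.Perm (Fin N), (pairSign (x ∘ τ) * ∑ σ ∈ G,
        ((Equiv.Perm.sign σ : ℤ) : ℂ) * ∏ j, boxFun L (a (σ j)) ((x ∘ τ) j)) =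
        ∑ σ ∈ G, pairSign x * (((Equiv.Perm.sign τ : ℤ) : ℂ) *
          (((Equiv.Perm.sign σ : ℤ) : ℂ) * ∏ j, boxFun L (a (σ j)) (x (τ j)))) := by
      intro τ
      rw [pairSign_comp, Finset.mul_sum]
      refine Finset.sum_congr rfl fun σ _ => ?_
      simp only [Function.comp_apply]
      ring
    simp only [e]
    rw [Finset.sum_comm]
    simp only [← Finset.mul_sum, hdet]
    rw [Finset.sum_const, nsmul_eq_mul, hcard]
    ring
  rw [← Finset.mul_sum, hsum, slaterFun, ← hD]
  field_simp

theorem waveletState_eq {L : ℝ} (hL : 0 < L) {n N : ℕ} (a : Fin N → Wavelet n) :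
    waveletState L a = boxSign (fun j => (a j).box) • slater fun i => boxVec L (a i) := by
  refine Lp.ext ?_
  have h1 : waveletState L a =ᵐ[cubeMeasure L N] bosonize (waveletChi L a) := MemLp.coeFn_toLp _
  have h2 : (fun x => slaterFun (fun i => boxFun L (a i)) x) =ᵐ[cubeMeasure L N]
      slaterFun fun i => boxVec L (a i) :=
    slaterFun_congr fun i => (boxVec_coeFn L (a i)).symm
  filter_upwards [h1, h2, slater_coeFn (fun i => boxVec L (a i)), Lp.coeFn_smul
    (boxSign fun j => (a j).box) (slater fun i => boxVec L (a i))] with x h1 h2 h3 h4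
  rw [h1, h4, Pi.smul_apply, h3, bosonize_waveletChi hL, smul_eq_mul, h2]

/-! ### Completeness of products of plane waves -/

section Tensor

variable {L : ℝ} {N : ℕ}

/-- The function `x ↦ ∏_j g_j(x_j)` as a vector. -/
def tensorVec (g : Fin N → OneSpace L) : NSpace L N := (memLp_tensor g).toLp _

theorem tensorVec_coeFn (g : Fin N → OneSpace L) :
    tensorVec g =ᵐ[cubeMeasure L N] fun x => ∏ j, g j (x j) :=
  MemLp.coeFn_toLp _

theorem norm_tensorVec (g : Fin N → OneSpace L) : ‖tensorVec g‖ = ∏ j, ‖g j‖ := by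
  have h : inner ℂ (tensorVec g) (tensorVec g) = ∏ j, inner ℂ (g j) (g j) := by
    rw [inner_Lp_eq _ _ (tensorVec_coeFn g) (tensorVec_coeFn g), integral_tensor_mul]
  simp only [inner_self_eq_norm_sq_to_K] at h
  rw [Finset.prod_pow] at h
  have h2 : ‖tensorVec g‖ ^ 2 = (∏ j, ‖g j‖) ^ 2 := by exact_mod_cast h
  exact (pow_left_inj₀ (norm_nonneg _) (Finset.prod_nonneg fun _ _ => norm_nonneg _)
    two_ne_zero).1 h2

theorem prod_update_apply (g : Fin N → OneSpace L) (i : Fin N) (y : OneSpace L) (x : Fin N → ℝ) :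
    ∏ j, (Function.update g i y j) (x j) = y (x i) * ∏ j ∈ Finset.univ.erase i, g j (x j) := by
  rw [← Finset.mul_prod_erase _ _ (Finset.mem_univ i), Function.update_self]
  congr 1
  refine Finset.prod_congr rfl fun j hj => ?_
  rw [Function.update_of_ne (Finset.ne_of_mem_erase hj)]

/-- Products of functions depend linearly and continuously on each factor. -/
def tensorUpdate (g : Fin N → OneSpace L) (i : Fin N) : OneSpace L →L[ℂ] NSpace L N :=
  LinearMap.mkContinuous
    { toFun := fun y => tensorVec (Function.update g i y)
      map_add' := fun y z => by
        refine Lp.ext ?_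
        filter_upwards [tensorVec_coeFn (Function.update g i (y + z)),
          tensorVec_coeFn (Function.update g i y), tensorVec_coeFn (Function.update g i z),
          Lp.coeFn_add (tensorVec (Function.update g i y)) (tensorVec (Function.update g i z)),
          ae_eval (N := N) fun _ => Lp.coeFn_add y z] with x h1 h2 h3 h4 h5
        rw [h1, h4, Pi.add_apply, h2, h3, prod_update_apply, prod_update_apply, prod_update_apply,
          h5 i, Pi.add_apply, add_mul]
      map_smul' := fun c y => by
        refine Lp.ext ?_
        filter_upwards [tensorVec_coeFn (Function.update g i (c • y)),
          tensorVec_coeFn (Function.update g i y),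
          Lp.coeFn_smul c (tensorVec (Function.update g i y)),
          ae_eval (N := N) fun _ => Lp.coeFn_smul c y] with x h1 h2 h4 h5
        rw [RingHom.id_apply, h1, h4, Pi.smul_apply, h2, prod_update_apply, prod_update_apply,
          h5 i, Pi.smul_apply, smul_eq_mul, smul_eq_mul, mul_assoc] }
    (∏ j ∈ Finset.univ.erase i, ‖g j‖) fun y => by
      change ‖tensorVec (Function.update g i y)‖ ≤ _
      rw [norm_tensorVec, ← Finset.mul_prod_erase _ _ (Finset.mem_univ i), Function.update_self,
        mul_comm]
      apply le_of_eq
      congr 1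
      refine Finset.prod_congr rfl fun j hj => ?_
      rw [Function.update_of_ne (Finset.ne_of_mem_erase hj)]

/-- Density is used one factor at a time: the induction enlarges the set of factors that may be
arbitrary, since a bounded functional that vanishes on the ring basis vanishes everywhere. -/
theorem inner_tensorVec_eq_zero (hL : 0 < L) {F : NSpace L N}
    (h : ∀ k : Fin N → ℤ, inner ℂ F (tensorVec fun j => ringVec L (k j)) = 0)
    (g : Fin N → OneSpace L) : inner ℂ F (tensorVec g) = 0 := by
  have key : ∀ s : Finset (Fin N), ∀ g : Fin N → OneSpace L,
      (∀ j ∉ s, ∃ m, g j = ringVec L m) → inner ℂ F (tensorVec g) = 0 := by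
    intro s
    induction s using Finset.induction_on with
    | empty =>
      intro g hg
      choose k hk using fun j => hg j (by simp)
      rw [funext hk]
      exact h k
    | insert i s hi ih =>
      intro g hg
      let A : OneSpace L →L[ℂ] ℂ := (innerSL ℂ F) ∘L tensorUpdate g i
      have hA : ∀ y, A y = inner ℂ F (tensorVec (Function.update g i y)) := fun y => rfl
      have hle : (Submodule.span ℂ (Set.range (ringBasis hL))).topologicalClosure ≤
          LinearMap.ker (A : OneSpace L →ₗ[ℂ] ℂ) := by
        refine Submodule.topologicalClosure_minimal _ (Submodule.span_le.2 ?_) A.isClosed_ker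
        rintro _ ⟨m, rfl⟩
        rw [SetLike.mem_coe, LinearMap.mem_ker]
        change A _ = 0
        rw [hA]
        refine ih _ fun j hj => ?_
        by_cases hji : j = i
        · subst hji
          exact ⟨m, by simp⟩
        · rw [Function.update_of_ne hji]
          exact hg j (by simp [hji, hj])
      rw [HilbertBasis.dense_span, top_le_iff] at hle
      have : A (g i) = 0 := by
        have : g i ∈ LinearMap.ker (A : OneSpace L →ₗ[ℂ] ℂ) := by rw [hle]; trivial
        exact this
      rwa [hA, Function.update_eq_self] at this
  exact key Finset.univ g fun j hj => absurd (Finset.mem_univ j) hj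

/-- Products of indicators make the integral of `F` vanish on all measurable rectangles. These form
a generating π-system, so it vanishes on all measurable sets. -/
theorem eq_zero_of_inner_tensorVec {F : NSpace L N}
    (h : ∀ g : Fin N → OneSpace L, inner ℂ F (tensorVec g) = 0) : F = 0 := by
  have hint : Integrable F (cubeMeasure L N) := (Lp.memLp F).integrable (by norm_num)
  have hrect : ∀ A : Fin N → Set ℝ, (∀ j, MeasurableSet (A j)) →
      ∫ x in Set.univ.pi A, F x ∂(cubeMeasure L N) = 0 := by
    intro A hA
    have h0 := h fun j => indicatorConstLp 2 (hA j) (measure_ne_top _ _) (1 : ℂ)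
    rw [← inner_conj_symm, map_eq_zero, inner_Lp_eq _ _ (tensorVec_coeFn _) (ae_eq_refl _)] at h0
    rw [← h0, ← integral_indicator (MeasurableSet.univ_pi hA)]
    refine integral_congr_ae ?_
    filter_upwards [ae_eval (N := N) fun j => indicatorConstLp_coeFn (p := 2)
      (hs := hA j) (hμs := measure_ne_top (lineMeasure L) _) (c := (1 : ℂ))] with x hx
    simp only [hx]
    by_cases hxA : x ∈ Set.univ.pi A
    · rw [Set.indicator_of_mem hxA, Finset.prod_eq_one, map_one, one_mul]
      intro j _
      rw [Set.indicator_of_mem (hxA j trivial)]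
    · rw [Set.indicator_of_notMem hxA]
      simp only [Set.mem_pi, Set.mem_univ, true_imp_iff, not_forall] at hxA
      obtain ⟨j, hj⟩ := hxA
      rw [Finset.prod_eq_zero (Finset.mem_univ j), map_zero, zero_mul]
      rw [Set.indicator_of_notMem hj]
  have hall : ∀ s, MeasurableSet s → ∫ x in s, F x ∂(cubeMeasure L N) = 0 := by
    refine MeasurableSpace.induction_on_inter generateFrom_pi.symm isPiSystem_pi ?_ ?_ ?_ ?_
    · simp
    · rintro _ ⟨A, hA, rfl⟩
      exact hrect A fun j => hA j trivial
    · intro s hs h0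
      have h1 := integral_add_compl hs hint
      have h2 := hrect (fun _ => Set.univ) fun _ => MeasurableSet.univ
      rw [Set.pi_univ, setIntegral_univ] at h2
      rwa [h0, h2, zero_add] at h1
    · intro f hd hm h0
      rw [integral_iUnion hm hd hint.integrableOn]
      simp [h0]
  rw [Lp.eq_zero_iff_ae_eq_zero]
  exact hint.ae_eq_zero_of_forall_setIntegral_eq_zero fun s hs _ => hall s hs

end Tensor

/-! ### The eigenstates as a basis of the bosonic states -/

section Bosonic

variable {L : ℝ} {N : ℕ}

theorem slater_comp_perm (g : Fin N → OneSpace L) (σ : Equiv.Perm (Fin N)) :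
    slater (g ∘ σ) = ((Equiv.Perm.sign σ : ℤ) : ℂ) • slater g := by
  refine Lp.ext ?_
  filter_upwards [slater_coeFn (g ∘ σ), slater_coeFn g,
    Lp.coeFn_smul ((Equiv.Perm.sign σ : ℤ) : ℂ) (slater g)] with x h1 h2 h3
  have h : (Matrix.of fun i j => (g ∘ σ) i (x j)) =
      (Matrix.of fun i j => g i (x j)).submatrix σ id := rfl
  rw [h1, h3, Pi.smul_apply, h2, slaterFun, slaterFun, h, Matrix.det_permute, smul_eq_mul]
  ring

theorem slater_eq_zero {g : Fin N → OneSpace L} {i j : Fin N} (hij : i ≠ j) (h : g i = g j) :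
    slater g = 0 := by
  refine Lp.ext ?_
  filter_upwards [slater_coeFn g, Lp.coeFn_zero ℂ 2 (cubeMeasure L N)] with x h1 h2
  rw [h1, h2, slaterFun, Matrix.det_zero_of_row_eq hij, mul_zero, mul_zero, Pi.zero_apply]
  funext l
  simp [h]

/-- Increasing momenta suffice, because sorting changes a Slater state only by a sign and a repeated
momentum makes it zero. Then `pairSign` times `F` is orthogonal to all products of plane waves, and
`pairSign` is invertible almost everywhere. -/
theorem eq_zero_of_inner_eigenState (hL : 0 < L) {F : NSpace L N} (hF : IsBosonic F)
    (h : ∀ k : Fin N → ℤ, StrictMono k → inner ℂ (eigenState L k) F = 0) : F = 0 := by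
  have hall : ∀ k : Fin N → ℤ, inner ℂ (slater fun i => ringVec L (k i)) F = 0 := by
    intro k
    by_cases hk : Function.Injective k
    · set σ := Tuple.sort k
      have hm : StrictMono (k ∘ σ) :=
        (Tuple.monotone_sort k).strictMono_of_injective (hk.comp σ.injective)
      have h1 := h _ hm
      rw [eigenState_eq hL] at h1
      have h2 := slater_comp_perm (fun i => ringVec L (k i)) σ
      change slater (fun i => ringVec L ((k ∘ σ) i)) = _ at h2
      rw [h2, inner_smul_left] at h1
      refine (mul_eq_zero.1 h1).resolve_left ?_
      rw [map_intCast]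
      exact fun h0 => by have := sign_mul_sign σ; simp [h0] at this
    · simp only [Function.Injective, not_forall] at hk
      obtain ⟨i, j, hij, hne⟩ := hk
      rw [slater_eq_zero hne (by rw [hij]), inner_zero_left]
  have hSF : (memLp_pairSign_mul (Lp.memLp F)).toLp _ = 0 := by
    refine eq_zero_of_inner_tensorVec (inner_tensorVec_eq_zero hL fun k => ?_)
    have h1 := hall k
    rw [inner_slater_of_isBosonic _ hF] at h1
    have h2 := (mul_eq_zero.1 h1).resolve_left (sqrt_factorial_ne_zero N)
    rw [← inner_conj_symm, map_eq_zero,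
      inner_Lp_eq _ _ (tensorVec_coeFn _) (MemLp.coeFn_toLp _)]
    exact h2
  rw [Lp.eq_zero_iff_ae_eq_zero] at hSF ⊢
  filter_upwards [hSF, MemLp.coeFn_toLp (memLp_pairSign_mul (Lp.memLp F)),
    ae_injective L N] with x h1 h2 h3
  rw [h1] at h2
  have := congrArg (fun z => pairSign x * z) h2.symm
  simpa [← mul_assoc, pairSign_mul_self h3] using this

theorem isBosonic_iff (F : NSpace L N) : IsBosonic F ↔ ∀ σ : Equiv.Perm (Fin N),
    Lp.compMeasurePreserving (fun x : Fin N → ℝ => x ∘ σ) (measurePreserving_comp_perm L σ) F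
      = F := by
  refine forall_congr' fun σ => ?_
  have h := Lp.coeFn_compMeasurePreserving F (measurePreserving_comp_perm L σ)
  constructor
  · intro hF
    refine Lp.ext ?_
    filter_upwards [h, hF] with x h1 h2
    rw [h1, Function.comp_apply, h2]
  · intro hF
    rw [hF] at h
    filter_upwards [h] with x h1
    exact h1.symm

/-- The subspace of symmetric wave functions. -/
def bosonicSubmodule (L : ℝ) (N : ℕ) : Submodule ℂ (NSpace L N) where
  carrier := {F | IsBosonic F}
  add_mem' {F G} hF hG := by
    simp only [Set.mem_ofPred_eq, isBosonic_iff] at hF hG ⊢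
    intro σ
    rw [map_add, hF, hG]
  zero_mem' := by
    simp only [Set.mem_ofPred_eq, isBosonic_iff]
    intro σ
    rw [map_zero]
  smul_mem' c F hF := by
    simp only [Set.mem_ofPred_eq, isBosonic_iff] at hF ⊢
    intro σ
    have := (Lp.compMeasurePreservingₗ ℂ (fun x : Fin N → ℝ => x ∘ σ)
      (measurePreserving_comp_perm L σ) (E := ℂ) (p := 2)).map_smul c F
    refine this.trans ?_
    congr 1
    exact hF σ

theorem isClosed_bosonicSubmodule (L : ℝ) (N : ℕ) :
    IsClosed (bosonicSubmodule L N : Set (NSpace L N)) := by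
  have : (bosonicSubmodule L N : Set (NSpace L N)) = ⋂ σ : Equiv.Perm (Fin N),
      {F | Lp.compMeasurePreserving (fun x : Fin N → ℝ => x ∘ σ)
        (measurePreserving_comp_perm L σ) F = F} := by
    ext F
    rw [Set.mem_iInter]
    exact isBosonic_iff F
  rw [this]
  refine isClosed_iInter fun σ => isClosed_eq ?_ continuous_id
  exact (Lp.isometry_compMeasurePreserving (measurePreserving_comp_perm L σ)).continuous

instance completeSpace_bosonicSubmodule (L : ℝ) (N : ℕ) : CompleteSpace (bosonicSubmodule L N) :=
  (isClosed_bosonicSubmodule L N).completeSpace_coe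

theorem det_orthonormal_eq_zero {ι H : Type*} [NormedAddCommGroup H] [InnerProductSpace ℂ H]
    {e : ι → H} (he : Orthonormal ℂ e) {a c : Fin N → ι} {i : Fin N} (hi : ∀ j, a i ≠ c j) :
    (Matrix.of fun i j => inner ℂ (e (a i)) (e (c j))).det = 0 := by
  refine Matrix.det_eq_zero_of_row_eq_zero i fun j => ?_
  rw [Matrix.of_apply]
  exact he.2 (hi j)

theorem det_orthonormal_self {ι H : Type*} [NormedAddCommGroup H] [InnerProductSpace ℂ H]
    {e : ι → H} (he : Orthonormal ℂ e) {a : Fin N → ι} (ha : Function.Injective a) :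
    (Matrix.of fun i j => inner ℂ (e (a i)) (e (a j))).det = 1 := by
  classical
  have : (Matrix.of fun i j => inner ℂ (e (a i)) (e (a j))) = (1 : Matrix (Fin N) (Fin N) ℂ) := by
    ext i j
    rw [Matrix.of_apply, orthonormal_iff_ite.1 he, Matrix.one_apply]
    simp [ha.eq_iff]
  rw [this, Matrix.det_one]

theorem exists_notMem_range_of_strictMono {ι : Type*} [LinearOrder ι] {a c : Fin N → ι}
    (ha : StrictMono a) (hc : StrictMono c) (h : a ≠ c) : ∃ i, ∀ j, a i ≠ c j := by
  by_contra! hcon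
  apply h
  have hr : Set.range a = Set.range c := by
    have hsub : Finset.univ.image a ⊆ Finset.univ.image c := by
      intro y hy
      obtain ⟨i, -, rfl⟩ := Finset.mem_image.1 hy
      obtain ⟨j, hj⟩ := hcon i
      exact Finset.mem_image.2 ⟨j, Finset.mem_univ _, hj.symm⟩
    have := Finset.eq_of_subset_of_card_le hsub (by
      rw [Finset.card_image_of_injective _ ha.injective,
        Finset.card_image_of_injective _ hc.injective])
    simpa using congrArg (fun s : Finset ι => (s : Set ι)) this
  exact (StrictMono.range_inj ha hc).1 hr

theorem orthonormal_eigenState (hL : 0 < L) :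
    Orthonormal ℂ fun k : {k : Fin N → ℤ // StrictMono k} => eigenState L k.1 := by
  classical
  rw [orthonormal_iff_ite]
  intro k k'
  rw [eigenState_eq hL, eigenState_eq hL, inner_slater_slater]
  split_ifs with h
  · subst h
    exact det_orthonormal_self (orthonormal_ringVec hL) k.2.injective
  · obtain ⟨i, hi⟩ := exists_notMem_range_of_strictMono k.2 k'.2 fun e => h (Subtype.ext e)
    exact det_orthonormal_eq_zero (orthonormal_ringVec hL) hi

/-- The eigenstates form a Hilbert basis of the closed symmetric subspace, so the norm is controlled
by finite Parseval sums. Finite sums suit an evolution equation known only coefficient by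
coefficient. -/
theorem norm_le_of_sum_inner_eigenState (hL : 0 < L) {F : NSpace L N} (hF : IsBosonic F) {R : ℝ}
    (hR : 0 ≤ R) (h : ∀ s : Finset {k : Fin N → ℤ // StrictMono k},
      ∑ k ∈ s, ‖inner ℂ (eigenState L k.1) F‖ ^ 2 ≤ R ^ 2) : ‖F‖ ≤ R := by
  have hmem : ∀ k : {k : Fin N → ℤ // StrictMono k}, eigenState L k.1 ∈ bosonicSubmodule L N := by
    intro k
    rw [eigenState_eq hL]
    exact isBosonic_slater _
  let e : {k : Fin N → ℤ // StrictMono k} → bosonicSubmodule L N := fun k => ⟨_, hmem k⟩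
  have he : Orthonormal ℂ e := by
    have := orthonormal_eigenState (N := N) hL
    rw [orthonormal_iff_ite] at this ⊢
    exact this
  let b : HilbertBasis {k : Fin N → ℤ // StrictMono k} ℂ (bosonicSubmodule L N) :=
    HilbertBasis.mkOfOrthogonalEqBot he (by
      rw [Submodule.eq_bot_iff]
      intro f hf
      refine Subtype.ext (eq_zero_of_inner_eigenState hL f.2 fun k hk => ?_)
      exact (Submodule.mem_orthogonal _ _).1 hf _ (Submodule.subset_span ⟨⟨k, hk⟩, rfl⟩))
  have hb : ∀ k, b k = e k := fun k => by simp [b]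
  let f : bosonicSubmodule L N := ⟨F, hF⟩
  have hs := b.hasSum_inner_mul_inner f f
  rw [inner_self_eq_norm_sq_to_K] at hs
  have hs' : HasSum (fun k : {k : Fin N → ℤ // StrictMono k} =>
      ‖inner ℂ (eigenState L k.1) F‖ ^ 2) (‖F‖ ^ 2) := by
    have h1 := Complex.hasSum_re hs
    convert! h1 using 1
    · funext k
      rw [← inner_conj_symm f, hb, ← Complex.normSq_eq_conj_mul_self, Complex.ofReal_re,
        Complex.normSq_eq_norm_sq]
      rfl
    · have : ‖f‖ = ‖F‖ := rfl
      rw [this]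
      norm_cast
  have h2 : ‖F‖ ^ 2 ≤ R ^ 2 := hasSum_le_of_sum_le hs' h
  exact (pow_le_pow_iff_left₀ (norm_nonneg _) hR two_ne_zero).1 h2

end Bosonic

/-! ### The potential of `N` particles -/

section Potential

variable {L : ℝ} {n N : ℕ} (v : Fin n → ℝ → ℝ) (s : ℝ)

open Classical in
/-- The potential of one particle as a function. -/
def potFun (L : ℝ) (x : ℝ) : ℝ := ∑ b : Fin n, if x ∈ boxSet L b then v b s else 0

theorem potential_eq_sum (x : Fin N → ℝ) : potential L v s x = ∑ j, potFun v s L (x j) := rfl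

theorem measurable_potFun (L : ℝ) : Measurable (potFun v s L) := by
  unfold potFun
  refine Finset.measurable_sum _ fun b _ => ?_
  exact Measurable.ite (measurableSet_boxSet L b) measurable_const measurable_const

theorem abs_potFun_le (L x : ℝ) : |potFun v s L x| ≤ ∑ b, |v b s| := by
  unfold potFun
  refine (Finset.abs_sum_le_sum_abs _ _).trans (Finset.sum_le_sum fun b _ => ?_)
  split_ifs
  · exact le_rfl
  · simp

theorem abs_potential_le (x : Fin N → ℝ) : |potential L v s x| ≤ N * ∑ b, |v b s| := by
  rw [potential_eq_sum]
  refine (Finset.abs_sum_le_sum_abs _ _).trans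
    ((Finset.sum_le_sum fun j _ => abs_potFun_le v s L (x j)).trans ?_)
  simp

theorem measurable_potential : Measurable (potential L v s : (Fin N → ℝ) → ℝ) := by
  have : (potential L v s : (Fin N → ℝ) → ℝ) = fun x => ∑ j, potFun v s L (x j) := rfl
  rw [this]
  exact Finset.measurable_sum _ fun j _ => (measurable_potFun v s L).comp (measurable_pi_apply j)

theorem norm_potential_mul_le (f : NSpace L N) (x : Fin N → ℝ) :
    ‖(potential L v s x : ℂ) * f x‖ ≤ (N * ∑ b, |v b s|) * ‖f x‖ := by
  rw [norm_mul, Complex.norm_real]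
  exact mul_le_mul_of_nonneg_right (abs_potential_le v s x) (norm_nonneg _)

theorem memLp_potential_mul (f : NSpace L N) :
    MemLp (fun x => (potential L v s x : ℂ) * f x) 2 (cubeMeasure L N) :=
  (Lp.memLp f).of_le_mul
    ((Complex.measurable_ofReal.comp (measurable_potential v s)).aestronglyMeasurable.mul
      (Lp.aestronglyMeasurable f))
    (Filter.Eventually.of_forall (norm_potential_mul_le v s f))

/-- The potential applied to a state of `N` particles. -/
def potVec (f : NSpace L N) : NSpace L N := (memLp_potential_mul v s f).toLp _

theorem potVec_coeFn (f : NSpace L N) :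
    potVec v s f =ᵐ[cubeMeasure L N] fun x => (potential L v s x : ℂ) * f x :=
  MemLp.coeFn_toLp _

theorem norm_potVec_le (f : NSpace L N) : ‖potVec v s f‖ ≤ (N * ∑ b, |v b s|) * ‖f‖ := by
  refine Lp.norm_le_mul_norm_of_ae_le_mul ?_
  filter_upwards [potVec_coeFn v s f] with x hx
  rw [hx]
  exact norm_potential_mul_le v s f x

theorem potVec_sub (f g : NSpace L N) : potVec v s (f - g) = potVec v s f - potVec v s g := by
  refine Lp.ext ?_
  filter_upwards [potVec_coeFn v s (f - g), potVec_coeFn v s f, potVec_coeFn v s g,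
    Lp.coeFn_sub f g, Lp.coeFn_sub (potVec v s f) (potVec v s g)] with x h1 h2 h3 h4 h5
  rw [h1, h5, Pi.sub_apply, h2, h3, h4, Pi.sub_apply, mul_sub]

theorem potVec_smul (c : ℂ) (f : NSpace L N) : potVec v s (c • f) = c • potVec v s f := by
  refine Lp.ext ?_
  filter_upwards [potVec_coeFn v s (c • f), potVec_coeFn v s f,
    Lp.coeFn_smul c f, Lp.coeFn_smul c (potVec v s f)] with x h1 h2 h4 h5
  rw [h1, h5, Pi.smul_apply, h2, h4, Pi.smul_apply, smul_eq_mul, smul_eq_mul, mul_left_comm]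

theorem potentialElement_eq (k : Fin N → ℤ) (f : NSpace L N) :
    potentialElement L v s k f = inner ℂ (eigenState L k) (potVec v s f) := by
  have h : eigenState L k =ᵐ[cubeMeasure L N] bosonize (eigenChi L k) := MemLp.coeFn_toLp _
  rw [inner_Lp_eq _ _ h (potVec_coeFn v s f), potentialElement]
  simp only [mul_assoc]

theorem potOp_coeFn (f : OneSpace L) :
    potOp L v s f =ᵐ[lineMeasure L] fun x => (potFun v s L x : ℂ) * f x := by
  have h1 : ∀ t : Finset (Fin n), (∑ b ∈ t, ((v b s : ℝ) : ℂ) • boxProj L b f : OneSpace L)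
      =ᵐ[lineMeasure L] fun x => ∑ b ∈ t, ((v b s : ℝ) : ℂ) * (boxSet L b).indicator f x := by
    intro t
    induction t using Finset.induction_on with
    | empty =>
      simp only [Finset.sum_empty]
      exact Lp.coeFn_zero ℂ 2 (lineMeasure L)
    | insert b t hb ih =>
      rw [Finset.sum_insert hb]
      filter_upwards [ih, Lp.coeFn_add (((v b s : ℝ) : ℂ) • boxProj L b f)
        (∑ b ∈ t, ((v b s : ℝ) : ℂ) • boxProj L b f),
        Lp.coeFn_smul ((v b s : ℝ) : ℂ) (boxProj L b f), boxProj_coeFn L b f] with x h1 h2 h3 h4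
      rw [h2, Pi.add_apply, h1, h3, Pi.smul_apply, h4, Finset.sum_insert hb, smul_eq_mul]
  rw [potOp_apply]
  refine (h1 Finset.univ).trans (Filter.Eventually.of_forall fun x => ?_)
  simp only [potFun, Complex.ofReal_sum, Finset.sum_mul]
  refine Finset.sum_congr rfl fun b _ => ?_
  by_cases hx : x ∈ boxSet L b <;> simp [hx]

/-- A one-body multiplication operator acts on a determinant as a derivation. In the term of σ, the
factor V(x_j) attaches to orbital q = σ j. -/
theorem sum_mul_slaterFun (V : ℝ → ℂ) (g : Fin N → ℝ → ℂ) (x : Fin N → ℝ) :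
    (∑ j, V (x j)) * slaterFun g x =
      ∑ q, slaterFun (Function.update g q fun y => V y * g q y) x := by
  have h : ∀ (σ : Equiv.Perm (Fin N)) (q : Fin N),
      ∏ j, (Function.update g q fun y => V y * g q y) (σ j) (x j) =
        V (x (σ.symm q)) * ∏ j, g (σ j) (x j) := by
    intro σ q
    rw [← Finset.mul_prod_erase _ _ (Finset.mem_univ (σ.symm q)),
      ← Finset.mul_prod_erase _ (fun j => g (σ j) (x j)) (Finset.mem_univ (σ.symm q)),
      Equiv.apply_symm_apply, Function.update_self, mul_assoc]
    congr 2
    refine Finset.prod_congr rfl fun j hj => ?_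
    rw [Function.update_of_ne]
    intro e
    exact Finset.ne_of_mem_erase hj (by rw [← e, Equiv.symm_apply_apply])
  simp only [slaterFun_eq_sum, h, ← Finset.mul_sum]
  rw [mul_left_comm, mul_left_comm _ (pairSign x), Finset.sum_comm, Finset.mul_sum]
  congr 2
  refine Finset.sum_congr rfl fun σ _ => ?_
  rw [← Equiv.sum_comp σ.symm, ← Finset.mul_sum, ← Finset.sum_mul]
  ring

theorem potVec_slater (g : Fin N → OneSpace L) :
    potVec v s (slater g) = ∑ q, slater (Function.update g q (potOp L v s (g q))) := by
  refine Lp.ext ?_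
  have h1 : ∀ t : Finset (Fin N), (∑ q ∈ t, slater (Function.update g q (potOp L v s (g q))) :
      NSpace L N) =ᵐ[cubeMeasure L N] fun x => ∑ q ∈ t, slaterFun
        (Function.update (fun i => ⇑(g i)) q fun y => (potFun v s L y : ℂ) * g q y) x := by
    intro t
    induction t using Finset.induction_on with
    | empty =>
      simp only [Finset.sum_empty]
      exact Lp.coeFn_zero ℂ 2 (cubeMeasure L N)
    | insert q t hq ih =>
      rw [Finset.sum_insert hq]
      have hc : slaterFun (fun i => ⇑(Function.update g q (potOp L v s (g q)) i))
          =ᵐ[cubeMeasure L N] slaterFun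
            (Function.update (fun i => ⇑(g i)) q fun y => (potFun v s L y : ℂ) * g q y) := by
        refine slaterFun_congr fun i => ?_
        by_cases hi : i = q
        · subst hi
          rw [Function.update_self, Function.update_self]
          exact potOp_coeFn v s (g i)
        · rw [Function.update_of_ne hi, Function.update_of_ne hi]
      filter_upwards [ih, Lp.coeFn_add (slater (Function.update g q (potOp L v s (g q))))
        (∑ q ∈ t, slater (Function.update g q (potOp L v s (g q)))), hc,
        slater_coeFn (Function.update g q (potOp L v s (g q)))] with x h1 h2 h3 h4
      rw [h2, Pi.add_apply, h1, h4, h3, Finset.sum_insert hq]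
  filter_upwards [h1 Finset.univ, potVec_coeFn v s (slater g), slater_coeFn g] with x h1 h2 h3
  rw [h1, h2, h3, potential_eq_sum, ← sum_mul_slaterFun]
  push_cast
  rfl

end Potential

/-! ### Uniqueness of the evolution -/

section Evolution

variable {L : ℝ} {n N : ℕ} {v : Fin n → ℝ → ℝ}

theorem norm_exp_neg_I_mul (t s E : ℝ) :
    ‖Complex.exp (-Complex.I * ((t : ℂ) - s) * E)‖ = 1 := by
  rw [← Complex.ofReal_sub]
  exact norm_phase _ _

/-- The energies are unbounded, so the estimate works with finitely many eigencoefficients of the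
difference, where the free phases have modulus one and the initial data cancel. -/
theorem IsEvolution.norm_sub_le (hL : 0 < L) (hv : ∀ b, LocallyIntegrable (v b))
    {α : Fin N → Wavelet n}
    {Ψ Φ : ℝ → NSpace L N} (hΨ : IsEvolution L v α Ψ) (hΦ : IsEvolution L v α Φ) (t : ℝ) :
    ‖Ψ t - Φ t‖ ≤ |∫ s in (0 : ℝ)..t, (N * ∑ b, |v b s|) * ‖Ψ s - Φ s‖| := by
  set R := |∫ s in (0 : ℝ)..t, (N * ∑ b, |v b s|) * ‖Ψ s - Φ s‖| with hRdef
  have hwl : LocallyIntegrable fun s => (N : ℝ) * ∑ b, |v b s| :=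
    (locallyIntegrable_abs hv).smul (N : ℝ)
  have hRi : IntervalIntegrable (fun s => (N * ∑ b, |v b s|) * ‖Ψ s - Φ s‖) volume 0 t :=
    (locallyIntegrable_bilin_continuous (ContinuousLinearMap.mul ℝ ℝ) hwl
      (hΨ.continuous.sub hΦ.continuous).norm).intervalIntegrable' _ _
  have hbos : IsBosonic (Ψ t - Φ t) :=
    (bosonicSubmodule L N).sub_mem (hΨ.bosonic t) (hΦ.bosonic t)
  refine norm_le_of_sum_inner_eigenState hL hbos (abs_nonneg _) fun F => ?_
  set p : {k : Fin N → ℤ // StrictMono k} → ℂ :=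
    fun k => inner ℂ (eigenState L k.1) (Ψ t - Φ t) with hp
  set ph : {k : Fin N → ℤ // StrictMono k} → ℝ → ℂ :=
    fun k s => Complex.exp (-Complex.I * (t - s) * energy L k.1) with hph
  set q : {k : Fin N → ℤ // StrictMono k} → ℝ → ℂ :=
    fun k s => inner ℂ (eigenState L k.1) (potVec v s (Ψ s - Φ s)) with hq
  have hqe : ∀ k s, q k s = potentialElement L v s k.1 (Ψ s) -
      potentialElement L v s k.1 (Φ s) := by
    intro k s
    rw [hq, potentialElement_eq, potentialElement_eq, ← inner_sub_right, ← potVec_sub]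
  have hcont : ∀ k, Continuous (ph k) := fun k => by rw [hph]; fun_prop
  have hint : ∀ k, IntervalIntegrable (fun s => ph k s * q k s) volume 0 t := by
    intro k
    simp only [hqe]
    exact ((hΨ.integrable k.1 k.2 t).sub (hΦ.integrable k.1 k.2 t)).continuousOn_mul
      (hcont k).continuousOn
  have hpi : ∀ k, p k = -Complex.I * ∫ s in (0 : ℝ)..t, ph k s * q k s := by
    intro k
    have i1 := (hΨ.integrable k.1 k.2 t).continuousOn_mul (hcont k).continuousOn
    have i2 := (hΦ.integrable k.1 k.2 t).continuousOn_mul (hcont k).continuousOn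
    simp only [hp, hqe, mul_sub]
    rw [intervalIntegral.integral_sub i1 i2, inner_sub_right, hΨ.duhamel k.1 k.2 t,
      hΦ.duhamel k.1 k.2 t, hΨ.initial, hΦ.initial]
    ring
  set P := Real.sqrt (∑ k ∈ F, ‖p k‖ ^ 2) with hP
  have hP2 : P ^ 2 = ∑ k ∈ F, ‖p k‖ ^ 2 := Real.sq_sqrt (Finset.sum_nonneg fun _ _ => by positivity)
  have hsum : ((P ^ 2 : ℝ) : ℂ) =
      -Complex.I * ∫ s in (0 : ℝ)..t, ∑ k ∈ F, conj (p k) * (ph k s * q k s) := by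
    rw [intervalIntegral.integral_finsetSum fun k _ => (hint k).const_mul _, Finset.mul_sum, hP2,
      Complex.ofReal_sum]
    refine Finset.sum_congr rfl fun k _ => ?_
    rw [intervalIntegral.integral_const_mul, mul_left_comm, ← hpi,
      ← Complex.normSq_eq_conj_mul_self, Complex.normSq_eq_norm_sq]
  -- The squared length P² is written as an integral pairing the coefficients at time t with those
  -- of the potential term at time s. Cauchy–Schwarz and Bessel bound this pairing by P times the
  -- norm of the potential term; dividing by P, when positive, gives P ≤ R.
  have hbound : P ^ 2 ≤ P * R := by
    have h1 : ‖∫ s in (0 : ℝ)..t, ∑ k ∈ F, conj (p k) * (ph k s * q k s)‖ ≤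
        |∫ s in (0 : ℝ)..t, P * ((N * ∑ b, |v b s|) * ‖Ψ s - Φ s‖)| := by
      refine intervalIntegral.norm_integral_le_abs_of_norm_le
        (Filter.Eventually.of_forall fun s => ?_) (hRi.const_mul _)
      calc ‖∑ k ∈ F, conj (p k) * (ph k s * q k s)‖
          ≤ ∑ k ∈ F, ‖p k‖ * ‖q k s‖ := by
            refine (norm_sum_le _ _).trans (Finset.sum_le_sum fun k _ => ?_)
            rw [norm_mul, norm_mul, RCLike.norm_conj, hph]
            simp only
            rw [norm_exp_neg_I_mul, one_mul]
        _ ≤ P * Real.sqrt (∑ k ∈ F, ‖q k s‖ ^ 2) := Real.sum_mul_le_sqrt_mul_sqrt _ _ _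
        _ ≤ P * ‖potVec v s (Ψ s - Φ s)‖ := by
            gcongr
            rw [← Real.sqrt_sq (norm_nonneg (potVec v s (Ψ s - Φ s)))]
            exact Real.sqrt_le_sqrt ((orthonormal_eigenState hL).sum_inner_products_le _)
        _ ≤ P * ((N * ∑ b, |v b s|) * ‖Ψ s - Φ s‖) := by
            gcongr
            exact norm_potVec_le v s _
    rw [intervalIntegral.integral_const_mul, abs_mul, abs_of_nonneg (Real.sqrt_nonneg _)] at h1
    have h2 := congrArg norm hsum
    rw [norm_mul, norm_neg, Complex.norm_I, one_mul, Complex.norm_real, Real.norm_eq_abs,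
      abs_of_nonneg (sq_nonneg P)] at h2
    rw [h2]
    exact h1
  rw [← hP2]
  have hP0 : 0 ≤ P := Real.sqrt_nonneg _
  have hR0 : 0 ≤ R := abs_nonneg _
  rcases hP0.eq_or_lt with h | h
  · rw [← h, zero_pow two_ne_zero]; positivity
  · have : P ≤ R := le_of_mul_le_mul_left (by rw [← sq]; exact hbound) h
    gcongr

theorem IsEvolution.unique (hL : 0 < L) (hv : ∀ b, LocallyIntegrable (v b))
    {α : Fin N → Wavelet n}
    {Ψ Φ : ℝ → NSpace L N} (hΨ : IsEvolution L v α Ψ) (hΦ : IsEvolution L v α Φ) : Ψ = Φ := by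
  have h : ∀ t, ‖Ψ t - Φ t‖ = 0 := by
    refine eq_zero_of_le_integral (w := fun s => N * ∑ b, |v b s|)
      ((locallyIntegrable_abs hv).smul (N : ℝ)) (fun s => mul_nonneg (Nat.cast_nonneg N)
        (Finset.sum_nonneg fun _ _ => abs_nonneg _))
      (hΨ.continuous.sub hΦ.continuous).norm (fun t => norm_nonneg _) fun t => ?_
    exact IsEvolution.norm_sub_le hL hv hΨ hΦ t
  funext t
  exact sub_eq_zero.1 (norm_eq_zero.1 (h t))

/-! ### Existence of the evolution -/

/-- The evolved orbitals of the state `α`. -/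
def orbitals (hL : 0 < L) (hv : ∀ b, LocallyIntegrable (v b)) (α : Fin N → Wavelet n) (t : ℝ)
    (q : Fin N) : OneSpace L :=
  freeProp hL t (orbit hL hv (α q) t)

/-- The evolved state. -/
def evolved (hL : 0 < L) (hv : ∀ b, LocallyIntegrable (v b)) (α : Fin N → Wavelet n) (t : ℝ) :
    NSpace L N :=
  boxSign (fun j => (α j).box) • slater (orbitals hL hv α t)

theorem exp_energy (k : Fin N → ℤ) (t : ℝ) : Complex.exp (-Complex.I * t * energy L k) =
    ∏ i, Complex.exp (-Complex.I * t * (ringMomentum L (k i) ^ 2 : ℝ)) := by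
  rw [← Complex.exp_sum, energy, ← Finset.mul_sum]
  push_cast
  rfl

theorem isPrimitive_det {c c' : Fin N → Fin N → ℝ → ℂ}
    (h : ∀ i j, IsPrimitive (c i j) (c' i j)) :
    IsPrimitive (fun t => (Matrix.of fun i j => c i j t).det)
      fun t => ∑ q, (Matrix.of fun i j => if j = q then c' i j t else c i j t).det := by
  classical
  have h1 := IsPrimitive.sum Finset.univ fun (σ : Equiv.Perm (Fin N)) _ =>
    (IsPrimitive.prod Finset.univ fun j _ => h (σ j) j).const_mul ((Equiv.Perm.sign σ : ℤ) : ℂ)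
  convert! h1 using 1
  · funext t
    rw [Matrix.det_apply']
    rfl
  · funext t
    simp only [Matrix.det_apply']
    rw [Finset.sum_comm]
    refine Finset.sum_congr rfl fun σ _ => ?_
    rw [Finset.mul_sum]
    refine Finset.sum_congr rfl fun q _ => ?_
    congr 1
    refine Finset.prod_congr rfl fun j _ => ?_
    simp

/-- Each row of the Gram determinant carries one free phase, and the product of the phases is that
of the total energy; the remaining determinant contains only interaction-picture orbits. -/
theorem inner_eigenState_evolved (hL : 0 < L) (hv : ∀ b, LocallyIntegrable (v b))
    (α : Fin N → Wavelet n)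
    (k : Fin N → ℤ) (t : ℝ) : inner ℂ (eigenState L k) (evolved hL hv α t) =
      Complex.exp (-Complex.I * t * energy L k) * (boxSign (fun j => (α j).box) *
        (Matrix.of fun i j => inner ℂ (ringVec L (k i)) (orbit hL hv (α j) t)).det) := by
  rw [eigenState_eq hL, evolved, inner_smul_right, inner_slater_slater, exp_energy]
  simp only [orbitals, inner_ringVec_freeProp]
  have h := Matrix.det_mul_column
    (fun i => Complex.exp (-Complex.I * t * (ringMomentum L (k i) ^ 2 : ℝ)))
    (Matrix.of fun i j => inner ℂ (ringVec L (k i)) (orbit hL hv (α j) t))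
  simp only [Matrix.of_apply] at h
  rw [h]
  ring

theorem potentialElement_evolved (hL : 0 < L) (hv : ∀ b, LocallyIntegrable (v b))
    (α : Fin N → Wavelet n)
    (k : Fin N → ℤ) (s : ℝ) : potentialElement L v s k (evolved hL hv α s) =
      Complex.exp (-Complex.I * s * energy L k) * (boxSign (fun j => (α j).box) *
        ∑ q, (Matrix.of fun i j => if j = q
          then inner ℂ (ringVec L (k i)) (intOp hL v s (orbit hL hv (α j) s))
          else inner ℂ (ringVec L (k i)) (orbit hL hv (α j) s)).det) := by
  rw [potentialElement_eq, eigenState_eq hL, evolved, potVec_smul, inner_smul_right,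
    potVec_slater, inner_sum, exp_energy, mul_left_comm]
  congr 1
  rw [Finset.mul_sum]
  refine Finset.sum_congr rfl fun q _ => ?_
  rw [inner_slater_slater, ← Matrix.det_mul_column]
  congr 1
  ext i j
  simp only [Matrix.of_apply]
  by_cases hj : j = q
  · subst hj
    -- The potential applied to a freely propagated orbit is the free propagator applied to the
    -- interaction-picture generator, so the modified column carries the same row phases as the
    -- others.
    rw [Function.update_self, if_pos rfl, intOp_apply, ← inner_ringVec_freeProp hL, freeProp_add,
      add_neg_cancel, freeProp_zero]
    rfl
  · rw [Function.update_of_ne hj, if_neg hj, ← inner_ringVec_freeProp hL]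
    rfl

/-- After the free phases are removed, Duhamel's formula says that the determinant of orbit
coefficients is the integral of its column-wise derivative. -/
theorem isEvolution_evolved (hL : 0 < L) (hv : ∀ b, LocallyIntegrable (v b))
    (α : Fin N → Wavelet n) :
    IsEvolution L v α (evolved hL hv α) := by
  have hprim : ∀ k : Fin N → ℤ, IsPrimitive
      (fun t => (Matrix.of fun i j => inner ℂ (ringVec L (k i)) (orbit hL hv (α j) t)).det)
      fun s => -Complex.I * ∑ q, (Matrix.of fun i j => if j = q
          then inner ℂ (ringVec L (k i)) (intOp hL v s (orbit hL hv (α j) s))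
          else inner ℂ (ringVec L (k i)) (orbit hL hv (α j) s)).det := by
    intro k
    have h := isPrimitive_det fun i j =>
      isPrimitive_inner_orbit hL (isOrbit_orbit hL hv (α j)) (ringVec L (k i))
    convert! h using 1
    funext s
    rw [Finset.mul_sum]
    refine Finset.sum_congr rfl fun q _ => ?_
    have h := Matrix.det_mul_row (fun j => if j = q then -Complex.I else 1)
      (Matrix.of fun i j => if j = q
        then inner ℂ (ringVec L (k i)) (intOp hL v s (orbit hL hv (α j) s))
        else inner ℂ (ringVec L (k i)) (orbit hL hv (α j) s))
    rw [Finset.prod_ite_eq' Finset.univ q, if_pos (Finset.mem_univ q)] at h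
    rw [← h]
    congr 1
    ext i j
    simp only [Matrix.of_apply]
    split_ifs <;> simp
  refine ⟨?_, fun t => ?_, ?_, fun k _ t => ?_, fun k _ t => ?_⟩
  · refine (continuous_slater fun q => ?_).const_smul (boxSign fun j => (α j).box)
    exact continuous_freeProp hL (isOrbit_orbit hL hv (α q)).continuous continuous_id
  · exact (bosonicSubmodule L N).smul_mem _ (isBosonic_slater _)
  · rw [evolved, waveletState_eq hL]
    congr 2
    funext q
    rw [orbitals, freeProp_zero, orbit_zero]
  · simp only [potentialElement_evolved]
    have h := ((hprim k).1.intervalIntegrable' 0 t).const_mul Complex.I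
    simp only [← mul_assoc, mul_neg, Complex.I_mul_I, neg_neg, one_mul] at h
    refine IntervalIntegrable.continuousOn_mul (h.const_mul _) ?_
    exact Continuous.continuousOn (by fun_prop)
  · simp only [potentialElement_evolved, inner_eigenState_evolved]
    have h := (hprim k).eq_add_integral t
    rw [h, intervalIntegral.integral_const_mul]
    -- The phases over [0, s] and [s, t] combine to the phase over [0, t], which leaves the
    -- integral.
    have e : ∀ s : ℝ, ∀ z : ℂ, Complex.exp (-Complex.I * (t - s) * energy L k) *
        (Complex.exp (-Complex.I * s * energy L k) * z) =
        Complex.exp (-Complex.I * t * energy L k) * z := by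
      intro s z
      rw [← mul_assoc, ← Complex.exp_add]
      congr 2
      ring
    simp only [e, intervalIntegral.integral_const_mul]
    simp only [Complex.ofReal_zero, mul_zero, zero_mul, Complex.exp_zero, one_mul]
    ring

theorem existsUnique_evolution (hL : 0 < L) (hv : ∀ b, LocallyIntegrable (v b))
    (α : Fin N → Wavelet n) :
    ∃! Ψ : ℝ → NSpace L N, IsEvolution L v α Ψ :=
  ⟨_, isEvolution_evolved hL hv α, fun _ h => IsEvolution.unique hL hv h (isEvolution_evolved hL hv α)⟩

end Evolution

/-! ### Summing a product of two determinants over common rows -/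

section CommonRows

theorem hasSum_pi_prod {ι : Type*} {K : ℕ} {f : Fin K → ι → ℂ} {s : Fin K → ℂ}
    (h : ∀ k, HasSum (f k) (s k)) :
    HasSum (fun r : Fin K → ι => ∏ k, f k (r k)) (∏ k, s k) := by
  induction K with
  | zero => simp
  | succ K ih =>
    have h0 := h 0
    have h1 := ih fun k => h k.succ
    have hs := summable_mul_of_summable_norm h0.summable.norm h1.summable.norm
    have h2 := h0.mul h1 hs
    rw [Fin.prod_univ_succ, ← (Fin.consEquiv fun _ => ι).hasSum_iff]
    refine h2.congr_fun fun p => ?_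
    simp [Fin.prod_univ_succ, Fin.consEquiv]

variable {ι : Type*} {M K : ℕ}

/-- The `M`-body minors summed over the orbitals. -/
theorem sum_det_eq_det {κ : Type*} [Fintype κ] (B C : Fin M → κ → ℂ) :
    ∑ q : Fin M → κ, (Matrix.of fun i j => B i (q i) * C i (q j)).det =
      (Matrix.of fun i j => ∑ q, B i q * C j q).det := by
  classical
  have h (q : Fin M → κ) : (Matrix.of fun i j => B i (q i) * C i (q j)).det =
      ∑ σ : Equiv.Perm (Fin M), ((Equiv.Perm.sign σ : ℤ) : ℂ) *
        ∏ i, B i (q i) * C (σ i) (q i) := by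
    rw [Matrix.det_apply']
    refine Finset.sum_congr rfl fun σ _ => ?_
    simp only [Matrix.of_apply, Finset.prod_mul_distrib]
    -- Reindexing makes the `B` factor independent of σ, so the sum over `q` splits into independent
    -- sums over its entries.
    rw [Equiv.prod_comp σ (fun i => B i (q i))]
  simp_rw [h]
  rw [Finset.sum_comm, ← Matrix.det_transpose, Matrix.det_apply']
  refine Finset.sum_congr rfl fun σ _ => ?_
  rw [← Finset.mul_sum]
  congr 1
  simp only [Matrix.transpose_apply, Matrix.of_apply]
  rw [Finset.prod_univ_sum]
  simp

/-- An injective prescription on the first block extends to some permutation, and the extensions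
differ from it exactly by permutations of the second block. -/
theorem card_perm_comp_inl (q : Fin M → Fin M ⊕ Fin K) (hq : Function.Injective q) :
    (Finset.univ.filter fun σ : Equiv.Perm (Fin M ⊕ Fin K) => σ ∘ Sum.inl = q).card = K ! := by
  classical
  obtain ⟨σ₀, h₀⟩ : ∃ σ₀ : Equiv.Perm (Fin M ⊕ Fin K), σ₀ ∘ Sum.inl = q := by
    let e : {z : Fin M ⊕ Fin K // z ∈ Set.range Sum.inl} ≃
        {z : Fin M ⊕ Fin K // z ∈ Set.range q} :=
      (Equiv.ofInjective _ Sum.inl_injective).symm.trans (Equiv.ofInjective q hq)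
    refine ⟨e.extendSubtype, funext fun i => ?_⟩
    have hi : (Sum.inl i : Fin M ⊕ Fin K) ∈ Set.range Sum.inl := ⟨i, rfl⟩
    rw [Function.comp_apply, Equiv.extendSubtype_apply_of_mem e _ hi]
    simp [e]
  have : (Finset.univ.filter fun σ : Equiv.Perm (Fin M ⊕ Fin K) => σ ∘ Sum.inl = q) =
      Finset.univ.image fun ρ : Equiv.Perm (Fin K) => σ₀ * Equiv.Perm.sumCongr 1 ρ := by
    ext σ
    simp only [Finset.mem_filter, Finset.mem_univ, true_and, Finset.mem_image]
    constructor
    · intro h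
      have hf (i : Fin M) : (σ₀⁻¹ * σ) (Sum.inl i) = Sum.inl i := by
        have h1 : σ (Sum.inl i) = σ₀ (Sum.inl i) := by
          rw [← Function.comp_apply (f := σ), h, ← h₀, Function.comp_apply]
        simp [h1]
      obtain ⟨⟨ρ₁, ρ₂⟩, hρ⟩ := Equiv.Perm.mem_sumCongrHom_range_of_perm_mapsTo_inl
        (σ := σ₀⁻¹ * σ) (by rintro _ ⟨i, rfl⟩; exact ⟨i, (hf i).symm⟩)
      refine ⟨ρ₂, ?_⟩
      have h1 : ρ₁ = 1 := by
        ext i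
        have := hf i
        rw [← hρ] at this
        simpa using congrArg (Sum.elim Fin.val (fun _ => 0)) this
      rw [h1] at hρ
      have : Equiv.Perm.sumCongr 1 ρ₂ = σ₀⁻¹ * σ := hρ
      rw [this, mul_inv_cancel_left]
    · rintro ⟨ρ, rfl⟩
      rw [← h₀]
      ext i : 1
      simp
  rw [this, Finset.card_image_of_injective, Finset.card_univ, Fintype.card_perm, Fintype.card_fin]
  intro ρ ρ' h
  have h := mul_left_cancel h
  ext k
  have := congrArg (fun σ : Equiv.Perm (Fin M ⊕ Fin K) => σ (Sum.inr k)) h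
  simpa using congrArg (Sum.elim (fun _ => 0) Fin.val) this

theorem sum_perm_comp_inl (F : (Fin M → Fin M ⊕ Fin K) → ℂ)
    (hF : ∀ q, ¬ Function.Injective q → F q = 0) :
    ∑ σ : Equiv.Perm (Fin M ⊕ Fin K), F (σ ∘ Sum.inl) = K ! * ∑ q, F q := by
  classical
  rw [← Finset.sum_fiberwise' Finset.univ
    (fun σ : Equiv.Perm (Fin M ⊕ Fin K) => (σ ∘ Sum.inl : Fin M → Fin M ⊕ Fin K)) F,
    Finset.mul_sum]
  refine Finset.sum_congr rfl fun q _ => ?_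
  rw [Finset.sum_const, nsmul_eq_mul]
  by_cases hq : Function.Injective q
  · rw [card_perm_comp_inl q hq]
  · simp [hF q hq]

/-- The left side is the determinant of a matrix whose last rows are the unit vectors at σ(inr k).
Permuting its columns by σ makes it block triangular with an identity block. -/
theorem sum_perm_delta (C : Fin M → Fin M ⊕ Fin K → ℂ) (σ : Equiv.Perm (Fin M ⊕ Fin K)) :
    ∑ τ : Equiv.Perm (Fin M ⊕ Fin K), ((Equiv.Perm.sign τ : ℤ) : ℂ) *
      ((∏ i, C i (τ (Sum.inl i))) *
        ∏ k, if σ (Sum.inr k) = τ (Sum.inr k) then (1 : ℂ) else 0) =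
      ((Equiv.Perm.sign σ : ℤ) : ℂ) * (Matrix.of fun i j => C i (σ (Sum.inl j))).det := by
  classical
  let W : Matrix (Fin M ⊕ Fin K) (Fin M ⊕ Fin K) ℂ := Matrix.of fun p q =>
    Sum.elim (fun i => C i q) (fun k => if σ (Sum.inr k) = q then (1 : ℂ) else 0) p
  have h1 : (W.submatrix id σ) = Matrix.fromBlocks (Matrix.of fun i j => C i (σ (Sum.inl j)))
      (Matrix.of fun i k => C i (σ (Sum.inr k))) 0 1 := by
    ext (i | k) (j | l) <;> simp [W, Matrix.one_apply]
  have h2 := Matrix.det_permute' σ W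
  rw [h1, Matrix.det_fromBlocks_zero₂₁, Matrix.det_one, mul_one] at h2
  rw [h2, ← mul_assoc, ← Int.cast_mul, ← Units.val_mul, Int.units_mul_self]
  rw [← Matrix.det_transpose W, Matrix.det_apply']
  simp [W]

/-- Orthonormal orbitals, integrated over the rows `r`. -/
theorem hasSum_det_mul_det {A : ι → Fin M ⊕ Fin K → ℂ}
    (hA : ∀ p q, HasSum (fun a => A a p * conj (A a q)) (if p = q then 1 else 0))
    (x y : Fin M → ι) :
    HasSum (fun r : Fin K → ι => (Matrix.of fun i j => A (Sum.elim x r i) j).det *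
        conj (Matrix.of fun i j => A (Sum.elim y r i) j).det)
      (K ! * (Matrix.of fun i j => ∑ q, A (x i) q * conj (A (y j) q)).det) := by
  classical
  have hterm (r : Fin K → ι) : (Matrix.of fun i j => A (Sum.elim x r i) j).det *
        conj (Matrix.of fun i j => A (Sum.elim y r i) j).det =
      ∑ σ : Equiv.Perm (Fin M ⊕ Fin K), ∑ τ : Equiv.Perm (Fin M ⊕ Fin K),
        ((Equiv.Perm.sign σ : ℤ) : ℂ) * (∏ i, A (x i) (σ (Sum.inl i))) *
        (((Equiv.Perm.sign τ : ℤ) : ℂ) * (∏ i, conj (A (y i) (τ (Sum.inl i))))) *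
        ∏ k, A (r k) (σ (Sum.inr k)) * conj (A (r k) (τ (Sum.inr k))) := by
    rw [← Matrix.det_transpose, Matrix.det_apply', ← Matrix.det_transpose (Matrix.of fun i j =>
      A (Sum.elim y r i) j), Matrix.det_apply', map_sum, Finset.sum_mul_sum]
    refine Finset.sum_congr rfl fun σ _ => Finset.sum_congr rfl fun τ _ => ?_
    simp only [Matrix.transpose_apply, Matrix.of_apply, Fintype.prod_sum_type, Sum.elim_inl,
      Sum.elim_inr, map_mul, map_intCast, map_prod, Finset.prod_mul_distrib]
    ring
  simp_rw [hterm]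
  -- The common rows have become Kronecker deltas. They reduce the sum over τ to an M-by-M
  -- determinant, and the sum over σ then counts each choice of the first M orbitals K! times.
  have hval : (K ! * (Matrix.of fun i j => ∑ q, A (x i) q * conj (A (y j) q)).det : ℂ) =
      ∑ σ : Equiv.Perm (Fin M ⊕ Fin K), ∑ τ : Equiv.Perm (Fin M ⊕ Fin K),
        ((Equiv.Perm.sign σ : ℤ) : ℂ) * (∏ i, A (x i) (σ (Sum.inl i))) *
        (((Equiv.Perm.sign τ : ℤ) : ℂ) * (∏ i, conj (A (y i) (τ (Sum.inl i))))) *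
        ∏ k, if σ (Sum.inr k) = τ (Sum.inr k) then (1 : ℂ) else 0 := by
    rw [← sum_det_eq_det (fun i q => A (x i) q) (fun i q => conj (A (y i) q)),
      ← sum_perm_comp_inl (K := K) (fun q => (Matrix.of fun i j =>
        A (x i) (q i) * conj (A (y i) (q j))).det)]
    · refine Finset.sum_congr rfl fun σ _ => ?_
      have h := sum_perm_delta (fun i q => conj (A (y i) q)) σ
      simp only [mul_assoc] at h ⊢
      rw [← Finset.mul_sum, ← Finset.mul_sum, h]
      have h3 := Matrix.det_mul_column (fun i => A (x i) (σ (Sum.inl i)))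
        (Matrix.of fun i j => conj (A (y i) (σ (Sum.inl j))))
      simp only [Function.comp_apply, Matrix.of_apply] at h3 ⊢
      rw [h3, mul_left_comm, ← mul_assoc (((Equiv.Perm.sign σ : ℤ) : ℂ)), ← Int.cast_mul,
        ← Units.val_mul, Int.units_mul_self]
      simp
    · intro q hq
      obtain ⟨i, j, hij, hne⟩ := Function.not_injective_iff.1 hq
      have h3 := Matrix.det_mul_column (fun i => A (x i) (q i))
        (Matrix.of fun i j => conj (A (y i) (q j)))
      simp only [Matrix.of_apply] at h3
      rw [h3, Matrix.det_zero_of_column_eq hne (by intro k; simp [hij]), mul_zero]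
  rw [hval]
  refine hasSum_sum fun σ _ => hasSum_sum fun τ _ => ?_
  exact (hasSum_pi_prod fun k => hA _ _).mul_left _

end CommonRows

/-! ### From tuples of labels to finite sets of labels -/

section TupleFinset

variable {ι : Type*} {M K : ℕ}

theorem det_append (A : ι → Fin (M + K) → ℂ) (x : Fin M → ι) (r : Fin K → ι) :
    (Matrix.of fun i j => A (Fin.append x r i) j).det =
      (Matrix.of fun i j => A (Sum.elim x r i) (finSumFinEquiv j)).det := by
  rw [← Matrix.det_submatrix_equiv_self (finSumFinEquiv (m := M) (n := K))]
  congr 1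
  ext (i | i) j <;> simp

variable [LinearOrder ι]

/-- An injective tuple is a K-element set together with an ordering; symmetry makes all K! orderings
contribute equally. -/
theorem hasSum_finset_of_hasSum_tuple {g : (Fin K → ι) → ℂ} {S : ℂ} (h : HasSum g S)
    (hsymm : ∀ r (σ : Equiv.Perm (Fin K)), g (r ∘ σ) = g r)
    (hzero : ∀ r, ¬ Function.Injective r → g r = 0) :
    HasSum (fun R : Finset ι => if h : R.card = K then g (R.orderEmbOfFin h) else 0)
      ((K ! : ℂ)⁻¹ * S) := by
  classical
  let e : {R : Finset ι // R.card = K} × Equiv.Perm (Fin K) → (Fin K → ι) :=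
    fun p => p.1.1.orderEmbOfFin p.1.2 ∘ p.2
  have he : Function.Injective e := by
    rintro ⟨⟨R, hR⟩, σ⟩ ⟨⟨R', hR'⟩, σ'⟩ hp
    have hr : R = R' := by
      have := congrArg Set.range hp
      simpa [e, Set.range_comp] using this
    subst hr
    have hs : σ = σ' := by
      ext i
      have := congrFun hp i
      simp only [e, Function.comp_apply] at this
      exact congrArg Fin.val ((R.orderEmbOfFin hR).injective this)
    rw [hs]
  have hrange : ∀ r ∉ Set.range e, g r = 0 := by
    intro r hr
    by_contra hne
    have hinj : Function.Injective r := by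
      by_contra hi
      exact hne (hzero r hi)
    have hcard : (Finset.univ.image r).card = K := by
      rw [Finset.card_image_of_injective _ hinj, Finset.card_univ, Fintype.card_fin]
    have hmem (i : Fin K) : r i ∈ Finset.univ.image r := by simp
    let s : Fin K → Fin K := fun i => ((Finset.univ.image r).orderIsoOfFin hcard).symm ⟨r i, hmem i⟩
    have hs : Function.Injective s := fun i j hij => hinj (by simpa [s] using hij)
    refine hr ⟨(⟨Finset.univ.image r, hcard⟩,
      Equiv.ofBijective s (Finite.injective_iff_bijective.1 hs)), funext fun i => ?_⟩
    simp only [e, Function.comp_apply, Equiv.ofBijective_apply]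
    rw [← Finset.coe_orderIsoOfFin_apply]
    simp [s]
  have h1 : HasSum (g ∘ e) S := (he.hasSum_iff hrange).2 h
  have h2 : HasSum (fun R : {R : Finset ι // R.card = K} =>
      (K ! : ℂ) * g (R.1.orderEmbOfFin R.2)) S := by
    refine h1.prod_fiberwise fun R => ?_
    have hc : ∀ σ : Equiv.Perm (Fin K), (g ∘ e) (R, σ) = g (R.1.orderEmbOfFin R.2) :=
      fun σ => hsymm _ σ
    simp_rw [hc]
    convert hasSum_fintype (fun _ : Equiv.Perm (Fin K) => g (R.1.orderEmbOfFin R.2)) using 1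
    simp [Fintype.card_perm]
  have h3 := h2.mul_left (K ! : ℂ)⁻¹
  have hK : (K ! : ℂ) ≠ 0 := Nat.cast_ne_zero.2 (Nat.factorial_ne_zero K)
  rw [← (Subtype.val_injective (p := fun R : Finset ι => R.card = K)).hasSum_iff]
  · refine h3.congr_fun fun R => ?_
    simp only [Function.comp_apply, dif_pos R.2, inv_mul_cancel_left₀ hK]
  · intro R hR
    rw [dif_neg]
    simpa using hR

/-- The sum of a product of two Slater determinants over a common set of labels. -/
theorem hasSum_finset_det_mul_det {A : ι → Fin (M + K) → ℂ}
    (hA : ∀ p q, HasSum (fun a => A a p * conj (A a q)) (if p = q then 1 else 0))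
    (x y : Fin M → ι) :
    HasSum (fun R : Finset ι => if h : R.card = K then
        (Matrix.of fun i j => A (Fin.append x (R.orderEmbOfFin h) i) j).det *
          conj (Matrix.of fun i j => A (Fin.append y (R.orderEmbOfFin h) i) j).det else 0)
      (Matrix.of fun i j => ∑ q, A (x i) q * conj (A (y j) q)).det := by
  classical
  have h := hasSum_det_mul_det (A := fun a p => A a (finSumFinEquiv p))
    (fun p q => by simpa using hA (finSumFinEquiv p) (finSumFinEquiv q)) x y
  have hs (z : Fin M → ι) (r : Fin K → ι) (σ : Equiv.Perm (Fin K)) :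
      (Matrix.of fun i j => A (Sum.elim z (r ∘ σ) i) (finSumFinEquiv j)).det =
        ((Equiv.Perm.sign σ : ℤ) : ℂ) *
          (Matrix.of fun i j => A (Sum.elim z r i) (finSumFinEquiv j)).det := by
    have := Matrix.det_permute (Equiv.Perm.sumCongr 1 σ)
      (Matrix.of fun i j => A (Sum.elim z r i) (finSumFinEquiv j))
    rw [Equiv.Perm.sign_sumCongr, Equiv.Perm.sign_one, one_mul] at this
    rw [← this]
    congr 1
    ext (i | i) j <;> simp
  have h2 := hasSum_finset_of_hasSum_tuple h (fun r σ => ?_) (fun r hr => ?_)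
  · have hK : (K ! : ℂ) ≠ 0 := Nat.cast_ne_zero.2 (Nat.factorial_ne_zero K)
    rw [inv_mul_cancel_left₀ hK] at h2
    convert h2 using 1
    · simp_rw [det_append]
    · congr! 4 with i j
      exact (Equiv.sum_comp finSumFinEquiv fun q => A (x i) q * conj (A (y j) q)).symm
  -- Reordering the common rows produces the same sign in both determinants, so their product is
  -- symmetric.
  · rw [hs, hs, map_mul, map_intCast, mul_mul_mul_comm, ← Int.cast_mul, ← Units.val_mul,
      Int.units_mul_self]
    simp
  · obtain ⟨i, j, hij, hne⟩ := Function.not_injective_iff.1 hr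
    rw [Matrix.det_zero_of_row_eq (i := Sum.inr i) (j := Sum.inr j) (by simpa using hne)
      (by ext q; simp [hij]), zero_mul]

end TupleFinset

/-! ### Overlaps of wavelet states with the evolved state -/

section Overlaps

variable {L : ℝ} {n N : ℕ}

theorem inner_ket_single (a : Fin N → Wavelet n) (f : NSpace L N) :
    inner ℂ (ket L a) (lp.single 2 N f) = inner ℂ (waveletState L a) f := by
  rw [ket, lp.inner_single_left, lp.single_apply_self]

theorem inner_ket_single_of_ne {M : ℕ} (h : M ≠ N) (a : Fin M → Wavelet n) (f : NSpace L N) :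
    inner ℂ (ket L a) (lp.single 2 N f) = 0 := by
  rw [ket, lp.inner_single_left, lp.single_apply_ne _ _ _ h, inner_zero_right]

theorem inner_ketFirst {M K : ℕ} {X R : Finset (Wavelet n)} (hX : X.card = M) (hR : R.card = K)
    (f : NSpace L (M + K)) :
    inner ℂ (ketFirst L X R) (lp.single 2 (M + K) f) =
      inner ℂ (waveletState L (Fin.append (X.orderEmbOfFin hX) (R.orderEmbOfFin hR))) f := by
  subst hX hR
  exact inner_ket_single _ _

theorem inner_ketFirst_of_ne {X R : Finset (Wavelet n)} (h : X.card + R.card ≠ N)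
    (f : NSpace L N) : inner ℂ (ketFirst L X R) (lp.single 2 N f) = 0 :=
  inner_ket_single_of_ne h _ _

theorem inner_waveletState_smul_slater (hL : 0 < L) (a : Fin N → Wavelet n) (c : ℂ)
    (g : Fin N → OneSpace L) :
    inner ℂ (waveletState L a) (c • slater g) = boxSign (fun j => (a j).box) * c *
      (Matrix.of fun i j => inner ℂ (boxVec L (a i)) (g j)).det := by
  rw [waveletState_eq hL, inner_smul_left, inner_smul_right, inner_slater_slater, conj_boxSign,
    mul_assoc]

variable {v : Fin n → ℝ → ℝ}

theorem inner_orbitals (hL : 0 < L) (hv : ∀ b, LocallyIntegrable (v b)) {α : Fin N → Wavelet n}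
    (hα : Function.Injective α) (t : ℝ) (p q : Fin N) :
    inner ℂ (orbitals hL hv α t p) (orbitals hL hv α t q) = if p = q then (1 : ℂ) else 0 := by
  rw [orbitals, orbitals, inner_freeProp_left, freeProp_add, neg_add_cancel, freeProp_zero,
    (isOrbit_orbit hL hv _).inner_eq hL (isOrbit_orbit hL hv _), orbit_zero, orbit_zero,
    orthonormal_iff_ite.1 (orthonormal_boxVec hL n)]
  simp only [hα.eq_iff]

theorem hasSum_inner_orbitals (hL : 0 < L) (hn : 0 < n) (hv : ∀ b, LocallyIntegrable (v b))
    {α : Fin N → Wavelet n} (hα : Function.Injective α) (t : ℝ) (p q : Fin N) :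
    HasSum (fun a : Wavelet n => inner ℂ (boxVec L a) (orbitals hL hv α t p) *
      conj (inner ℂ (boxVec L a) (orbitals hL hv α t q))) (if p = q then 1 else 0) := by
  have h := (boxBasis hL hn).hasSum_inner_mul_inner (orbitals hL hv α t q) (orbitals hL hv α t p)
  rw [inner_orbitals hL hv hα] at h
  simp_rw [eq_comm (a := q)] at h
  refine h.congr_fun fun a => ?_
  rw [boxBasis_apply, inner_conj_symm, mul_comm]

/-- The overlaps of the wavelet states with a Slater determinant, as a function of the set of
labels outside of the box. -/
theorem cumulTerm_slater {M K : ℕ} (hL : 0 < L) {b : Fin n} {X Y : Finset (Wavelet n)}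
    (hXb : ∀ a ∈ X, a.box = b) (hYb : ∀ a ∈ Y, a.box = b) (hX : X.card = M) (hY : Y.card = M)
    {c : ℂ} (hc : c * conj c = 1) (g : Fin (M + K) → OneSpace L) (p : Completion X Y) :
    cumulTerm (lp.single 2 (M + K) (c • slater g)) X Y p =
      if h : (p.1.1 \ X).card = K then
        (Matrix.of fun i j => inner ℂ (boxVec L (Fin.append (X.orderEmbOfFin hX)
          ((p.1.1 \ X).orderEmbOfFin h) i)) (g j)).det *
        conj (Matrix.of fun i j => inner ℂ (boxVec L (Fin.append (Y.orderEmbOfFin hY)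
          ((p.1.1 \ X).orderEmbOfFin h) i)) (g j)).det
      else 0 := by
  rw [cumulTerm, ← p.2.2.2]
  split_ifs with h
  · rw [← inner_conj_symm (lp.single 2 (M + K) _), inner_ketFirst hX h, inner_ketFirst hY h,
      inner_waveletState_smul_slater hL, inner_waveletState_smul_slater hL]
    -- The box sequences of the two label lists agree, because X and Y have equal size and lie in
    -- one box and the rest is common. Hence the two box signs multiply to one.
    have hs : (fun j => (Fin.append (X.orderEmbOfFin hX) ((p.1.1 \ X).orderEmbOfFin h) j).box) =
        fun j => (Fin.append (Y.orderEmbOfFin hY) ((p.1.1 \ X).orderEmbOfFin h) j).box := by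
      funext j
      refine Fin.addCases (fun i => ?_) (fun i => ?_) j
      · rw [Fin.append_left, Fin.append_left, hXb _ (Finset.orderEmbOfFin_mem _ _ _),
          hYb _ (Finset.orderEmbOfFin_mem _ _ _)]
      · rw [Fin.append_right, Fin.append_right]
    rw [hs, map_mul, map_mul, conj_boxSign, mul_mul_mul_comm, mul_mul_mul_comm _ c, boxSign_mul_self,
      hc, one_mul, one_mul]
  · rw [inner_ketFirst_of_ne (by omega), zero_mul]

theorem cumulTerm_eq_zero {X Y : Finset (Wavelet n)} (h : X.card ≠ Y.card ∨ N < X.card)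
    (f : NSpace L N) (p : Completion X Y) : cumulTerm (lp.single 2 N f) X Y p = 0 := by
  rw [cumulTerm, ← p.2.2.2]
  by_cases h1 : X.card + (p.1.1 \ X).card = N
  · rw [inner_eq_zero_symm.1 (inner_ketFirst_of_ne (X := Y) (by omega) f), mul_zero]
  · rw [inner_ketFirst_of_ne h1, zero_mul]

/-- A completion is determined by its common rest R, which is disjoint from X and Y. The sum extends
to all finite sets R at no cost, since an overlap repeats a row in one of the determinants. -/
theorem hasSum_cumulTerm {M K : ℕ} (hL : 0 < L) {b : Fin n} {X Y : Finset (Wavelet n)}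
    (hXb : ∀ a ∈ X, a.box = b) (hYb : ∀ a ∈ Y, a.box = b) (hX : X.card = M) (hY : Y.card = M)
    {c : ℂ} (hc : c * conj c = 1) (g : Fin (M + K) → OneSpace L)
    (hg : ∀ p q, HasSum (fun a : Wavelet n => inner ℂ (boxVec L a) (g p) *
      conj (inner ℂ (boxVec L a) (g q))) (if p = q then 1 else 0)) :
    HasSum (cumulTerm (lp.single 2 (M + K) (c • slater g)) X Y)
      (Matrix.of fun i j => ∑ q, inner ℂ (boxVec L (X.orderEmbOfFin hX i)) (g q) *
        conj (inner ℂ (boxVec L (Y.orderEmbOfFin hY j)) (g q))).det := by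
  have h := hasSum_finset_det_mul_det (A := fun a q => inner ℂ (boxVec L a) (g q)) hg
    (X.orderEmbOfFin hX) (Y.orderEmbOfFin hY)
  let e : Completion X Y → Finset (Wavelet n) := fun p => p.1.1 \ X
  have he : Function.Injective e := by
    intro p p' hp
    have h1 : p.1.1 \ X = p'.1.1 \ X := hp
    refine Subtype.ext (Prod.ext ?_ ?_)
    · rw [← Finset.sdiff_union_of_subset p.2.1, h1, Finset.sdiff_union_of_subset p'.2.1]
    · rw [← Finset.sdiff_union_of_subset p.2.2.1, ← p.2.2.2, h1, p'.2.2.2,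
        Finset.sdiff_union_of_subset p'.2.2.1]
  have hdet (Z R : Finset (Wavelet n)) (hZ : Z.card = M) (hR : R.card = K) (h : ¬ Disjoint R Z) :
      (Matrix.of fun i j => inner ℂ (boxVec L (Fin.append (Z.orderEmbOfFin hZ)
          (R.orderEmbOfFin hR) i)) (g j)).det = 0 := by
    obtain ⟨a, haR, haZ⟩ := Finset.not_disjoint_iff.1 h
    rw [← Finset.mem_coe, ← Finset.range_orderEmbOfFin R hR] at haR
    rw [← Finset.mem_coe, ← Finset.range_orderEmbOfFin Z hZ] at haZ
    obtain ⟨k, hk⟩ := haR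
    obtain ⟨i, hi⟩ := haZ
    refine Matrix.det_zero_of_row_eq (i := Fin.castAdd K i) (j := Fin.natAdd M k) ?_ ?_
    · intro h
      have := congrArg Fin.val h
      simp at this
      omega
    · funext j
      simp only [Matrix.of_apply, Fin.append_left, Fin.append_right, hi, hk]
  rw [← he.hasSum_iff] at h
  · exact h.congr_fun fun p => cumulTerm_slater hL hXb hYb hX hY hc g p
  · intro R hR
    split_ifs with hK
    · by_cases h1 : Disjoint R X
      · have h2 : ¬ Disjoint R Y := by
          intro h2
          refine hR ⟨⟨(R ∪ X, R ∪ Y), Finset.subset_union_right, Finset.subset_union_right, ?_⟩, ?_⟩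
          · change (R ∪ X) \ X = (R ∪ Y) \ Y
            rw [Finset.union_sdiff_cancel_right h1, Finset.union_sdiff_cancel_right h2]
          · exact Finset.union_sdiff_cancel_right h1
        rw [hdet Y R hY hK h2, map_zero, mul_zero]
      · rw [hdet X R hX hK h1, zero_mul]
    · rfl

end Overlaps

/-! ### The cumulative reduced density matrix -/

section Density

variable {L : ℝ} {n N : ℕ}

theorem inner_ket_ket (hL : 0 < L) {M : ℕ} {b : Fin n} {x y : Fin M → Wavelet n}
    (hx : ∀ i, (x i).box = b) (hy : ∀ i, (y i).box = b) :
    inner ℂ (ket L x) (ket L y) =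
      (Matrix.of fun i j => if x i = y j then (1 : ℂ) else 0).det := by
  rw [ket.eq_def L y, inner_ket_single, waveletState_eq hL y, inner_waveletState_smul_slater hL]
  simp only [hx, hy, boxSign_const, one_mul]
  congr 1
  ext i j
  exact orthonormal_iff_ite.1 (orthonormal_boxVec hL n) _ _

theorem inner_ket_enum (hL : 0 < L) {M : ℕ} {b : Fin n} {x : Fin M → Wavelet n}
    (hx : ∀ i, (x i).box = b) {X : Finset (Wavelet n)} (hXb : ∀ a ∈ X, a.box = b)
    (hX : X.card = M) : inner ℂ (ket L x) (ket L (enum X)) =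
      (Matrix.of fun i j => if x i = X.orderEmbOfFin hX j then (1 : ℂ) else 0).det := by
  subst hX
  exact inner_ket_ket hL hx fun i => hXb _ (Finset.orderEmbOfFin_mem _ _ _)

theorem inner_ket_enum_eq_zero (hL : 0 < L) {M : ℕ} {b : Fin n} {x : Fin M → Wavelet n}
    (hxi : Function.Injective x) (hx : ∀ i, (x i).box = b) {X : Finset (Wavelet n)}
    (hXb : ∀ a ∈ X, a.box = b) (hne : X ≠ Finset.univ.image x) :
    inner ℂ (ket L x) (ket L (enum X)) = 0 := by
  by_cases hX : X.card = M
  · rw [inner_ket_enum hL hx hXb hX]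
    obtain ⟨i, hi⟩ : ∃ i, x i ∉ X := by
      by_contra! h
      refine hne (Finset.eq_of_subset_of_card_le (Finset.image_subset_iff.2 fun i _ => h i) ?_).symm
      rw [Finset.card_image_of_injective _ hxi, Finset.card_univ, Fintype.card_fin, hX]
    refine Matrix.det_eq_zero_of_row_eq_zero i fun j => if_neg fun h => hi ?_
    rw [h]
    exact Finset.orderEmbOfFin_mem _ _ _
  · exact inner_ket_single_of_ne (Ne.symm hX) _ _

/-- The labels of a family that is localized in a box, as a set. -/
def labelSet {M : ℕ} {b : Fin n} {x : Fin M → Wavelet n} (hx : ∀ i, (x i).box = b) : InBox b :=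
  ⟨Finset.univ.image x, by simpa using hx⟩

/-- Wavelet states in one box with different label sets are orthogonal, so a single pair (X, Y)
survives; its two overlaps only compare the given orders of the labels with the increasing ones. -/
theorem rhoCumul_ket_ket (hL : 0 < L) {M M' : ℕ} {b : Fin n} {x : Fin M → Wavelet n}
    {y : Fin M' → Wavelet n} (hxi : Function.Injective x) (hyi : Function.Injective y)
    (hx : ∀ i, (x i).box = b) (hy : ∀ i, (y i).box = b) (Ψ : Fock L) :
    rhoCumul Ψ b (ket L x) (ket L y) =
      inner ℂ (ket L x) (ket L (enum (labelSet hx).1)) *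
        inner ℂ (ket L (enum (labelSet hy).1)) (ket L y) *
        ∑' p, cumulTerm Ψ (labelSet hx).1 (labelSet hy).1 p := by
  refine tsum_eq_single (labelSet hx, labelSet hy) fun P hP => ?_
  by_cases h1 : P.1.1 = Finset.univ.image x
  · have h2 : P.2.1 ≠ Finset.univ.image y := fun h2 =>
      hP (Prod.ext (Subtype.ext h1) (Subtype.ext h2))
    rw [inner_eq_zero_symm.1 (inner_ket_enum_eq_zero hL hyi hy P.2.2 h2), mul_zero, zero_mul]
  · rw [inner_ket_enum_eq_zero hL hxi hx P.1.2 h1, zero_mul, zero_mul]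

/-- The 0-1 matrix re-expresses the family `x` through the enumeration `ξ`, so its determinant turns
rows listed along `ξ` into rows listed along `x`. This removes the sorting signs in ⟨x|X⟩ and ⟨Y|y⟩.
-/
theorem det_ite_mul_det {ι : Type*} [DecidableEq ι] {M : ℕ} {x ξ : Fin M → ι}
    (hξ : Function.Injective ξ) (hx : ∀ i, x i ∈ Set.range ξ) (F : ι → Fin M → ℂ) :
    (Matrix.of fun i j => if x i = ξ j then (1 : ℂ) else 0).det *
      (Matrix.of fun i j => F (ξ i) j).det = (Matrix.of fun i j => F (x i) j).det := by
  rw [← Matrix.det_mul]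
  congr 1
  ext i j
  obtain ⟨k, hk⟩ := hx i
  simp only [Matrix.mul_apply, Matrix.of_apply, ← hk, hξ.eq_iff]
  simp

theorem rhoCumul_slater {M K : ℕ} (hL : 0 < L) {b : Fin n} {x y : Fin M → Wavelet n}
    (hxi : Function.Injective x) (hyi : Function.Injective y)
    (hx : ∀ i, (x i).box = b) (hy : ∀ i, (y i).box = b)
    {c : ℂ} (hc : c * conj c = 1) (g : Fin (M + K) → OneSpace L)
    (hg : ∀ p q, HasSum (fun a : Wavelet n => inner ℂ (boxVec L a) (g p) *
      conj (inner ℂ (boxVec L a) (g q))) (if p = q then 1 else 0)) :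
    rhoCumul (lp.single 2 (M + K) (c • slater g)) b (ket L x) (ket L y) =
      (Matrix.of fun i j => ∑ q, inner ℂ (boxVec L (x i)) (g q) *
        conj (inner ℂ (boxVec L (y j)) (g q))).det := by
  have hcard {z : Fin M → Wavelet n} (hz : Function.Injective z) :
      (Finset.univ.image z).card = M := by
    rw [Finset.card_image_of_injective _ hz, Finset.card_univ, Fintype.card_fin]
  have hrange {z : Fin M → Wavelet n} (hz : Function.Injective z) (i : Fin M) :
      z i ∈ Set.range ((Finset.univ.image z).orderEmbOfFin (hcard hz)) := by
    simp
  rw [rhoCumul_ket_ket hL hxi hyi hx hy, (hasSum_cumulTerm hL (labelSet hx).2 (labelSet hy).2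
    (hcard hxi) (hcard hyi) hc g hg).tsum_eq, ← inner_conj_symm (ket L (enum (labelSet hy).1)),
    inner_ket_enum hL hx (labelSet hx).2 (hcard hxi),
    inner_ket_enum hL hy (labelSet hy).2 (hcard hyi), mul_right_comm]
  have h1 := det_ite_mul_det ((Finset.univ.image x).orderEmbOfFin (hcard hxi)).injective (hrange hxi) fun a j =>
    ∑ q, inner ℂ (boxVec L a) (g q) * conj (inner ℂ (boxVec L
      ((Finset.univ.image y).orderEmbOfFin (hcard hyi) j)) (g q))
  have h2 := det_ite_mul_det ((Finset.univ.image y).orderEmbOfFin (hcard hyi)).injective (hrange hyi) fun a j =>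
    ∑ q, inner ℂ (boxVec L (x j)) (g q) * conj (inner ℂ (boxVec L a) (g q))
  have h3 : conj (Matrix.of fun i j => if y i = (Finset.univ.image y).orderEmbOfFin (hcard hyi) j
      then (1 : ℂ) else 0).det = (Matrix.of fun i j =>
        if y i = (Finset.univ.image y).orderEmbOfFin (hcard hyi) j then (1 : ℂ) else 0).det := by
    rw [RingHom.map_det]
    congr 1
    ext i j
    simp [apply_ite]
  rw [← Matrix.det_transpose (Matrix.of fun i j => ∑ q, inner ℂ (boxVec L (x i)) (g q) *
        conj (inner ℂ (boxVec L (y j)) (g q)))]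
  refine Eq.trans ?_ h2
  rw [mul_comm]
  refine congrArg₂ _ h3 (h1.trans ?_)
  rw [← Matrix.det_transpose]
  rfl

theorem conj_boxSign_mul_self (b : Fin N → Fin n) : boxSign b * conj (boxSign b) = 1 := by
  rw [conj_boxSign, boxSign_mul_self]

variable {v : Fin n → ℝ → ℝ}

theorem summable_cumulTerm_evolved (hL : 0 < L) (hn : 0 < n) (hv : ∀ b, LocallyIntegrable (v b))
    {α : Fin N → Wavelet n} (hα : Function.Injective α) (t : ℝ) {b : Fin n} (X Y : InBox b) :
    Summable (cumulTerm (lp.single 2 N (evolved hL hv α t)) X.1 Y.1) := by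
  by_cases h : X.1.card ≠ Y.1.card ∨ N < X.1.card
  · exact summable_zero.congr fun p => (cumulTerm_eq_zero h _ p).symm
  · push Not at h
    obtain ⟨K, rfl⟩ := Nat.exists_eq_add_of_le h.2
    exact (hasSum_cumulTerm hL X.2 Y.2 rfl h.1.symm (conj_boxSign_mul_self _) _
      (hasSum_inner_orbitals hL hn hv hα t)).summable

theorem rhoCumul_evolved (hL : 0 < L) (hn : 0 < n) (hv : ∀ b, LocallyIntegrable (v b))
    {α : Fin N → Wavelet n} (hα : Function.Injective α) (t : ℝ) {M : ℕ} {b : Fin n}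
    {x y : Fin M → Wavelet n} (hxi : Function.Injective x) (hyi : Function.Injective y)
    (hx : ∀ i, (x i).box = b) (hy : ∀ i, (y i).box = b) :
    rhoCumul (lp.single 2 N (evolved hL hv α t)) b (ket L x) (ket L y) =
      ∑ q : Fin M → Fin N, (Matrix.of fun i j =>
        inner ℂ (boxVec L (x i)) (orbitals hL hv α t (q i)) *
          conj (inner ℂ (boxVec L (y i)) (orbitals hL hv α t (q j)))).det := by
  by_cases h : M ≤ N
  · obtain ⟨K, rfl⟩ := Nat.exists_eq_add_of_le h
    rw [sum_det_eq_det (fun i q => inner ℂ (boxVec L (x i)) (orbitals hL hv α t q))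
      (fun i q => conj (inner ℂ (boxVec L (y i)) (orbitals hL hv α t q)))]
    exact rhoCumul_slater hL hxi hyi hx hy (conj_boxSign_mul_self _) _
      (hasSum_inner_orbitals hL hn hv hα t)
  · have hcard : N < (labelSet hx).1.card := by
      rw [labelSet, Finset.card_image_of_injective _ hxi, Finset.card_univ, Fintype.card_fin]
      omega
    rw [rhoCumul_ket_ket hL hxi hyi hx hy]
    simp_rw [cumulTerm_eq_zero (Or.inr hcard)]
    rw [tsum_zero, mul_zero]
    refine (Finset.sum_eq_zero fun q _ => ?_).symm
    -- For M > N the density matrix element vanishes by particle number. Every map q repeats a value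
    -- by pigeonhole, so each determinant on the right has two equal columns up to a common row
    -- factor.
    obtain ⟨i, j, hne, hij⟩ := Fintype.exists_ne_map_eq_of_card_lt q (by simpa using h)
    have h3 := Matrix.det_mul_column
      (fun i => inner ℂ (boxVec L (x i)) (orbitals hL hv α t (q i)))
      (Matrix.of fun i j => conj (inner ℂ (boxVec L (y i)) (orbitals hL hv α t (q j))))
    simp only [Matrix.of_apply] at h3
    rw [h3, Matrix.det_zero_of_column_eq hne (by intro k; simp [hij]), mul_zero]

theorem rhoCumul_eq_zero_of_ne (hL : 0 < L) (f : NSpace L N) {M M' : ℕ} (hM : M ≠ M') {b : Fin n}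
    {x : Fin M → Wavelet n} {y : Fin M' → Wavelet n} (hxi : Function.Injective x)
    (hyi : Function.Injective y) (hx : ∀ i, (x i).box = b) (hy : ∀ i, (y i).box = b) :
    rhoCumul (lp.single 2 N f) b (ket L x) (ket L y) = 0 := by
  have hcard : (labelSet hx).1.card ≠ (labelSet hy).1.card := by
    rw [labelSet, labelSet, Finset.card_image_of_injective _ hxi,
      Finset.card_image_of_injective _ hyi]
    simpa using hM
  rw [rhoCumul_ket_ket hL hxi hyi hx hy]
  simp_rw [cumulTerm_eq_zero (Or.inl hcard)]
  rw [tsum_zero, mul_zero]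

end Density

end HardcoreWavelet

end

/-! ### Assembly of the theorem -/

theorem theorem2 (L : ℝ) (hL : 0 < L) (n : ℕ) (hn : 0 < n)
    (v : Fin n → ℝ → ℝ) (hv : ∀ b, MeasureTheory.LocallyIntegrable (v b))
    (N : ℕ) (hN : Even N)
    (α : Fin N → HardcoreWavelet.Wavelet n) (hα : Function.Injective α) :
    (∃! Ψ : ℝ → HardcoreWavelet.NSpace L N, HardcoreWavelet.IsEvolution L v α Ψ) ∧
    (∃! ψt : ℝ → HardcoreWavelet.Wavelet n → HardcoreWavelet.Wavelet n → ℂ,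
      HardcoreWavelet.IsPsiTilde L v ψt) ∧
    ∀ (Ψ : ℝ → HardcoreWavelet.NSpace L N)
      (ψt : ℝ → HardcoreWavelet.Wavelet n → HardcoreWavelet.Wavelet n → ℂ),
      HardcoreWavelet.IsEvolution L v α Ψ → HardcoreWavelet.IsPsiTilde L v ψt →
      ∀ (t : ℝ) (b : Fin n),
        (∀ X Y : HardcoreWavelet.InBox b,
          Summable (HardcoreWavelet.cumulTerm (lp.single 2 N (Ψ t)) X.1 Y.1)) ∧
        (∀ (M : ℕ) (x y : Fin M → HardcoreWavelet.Wavelet n),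
          Function.Injective x → Function.Injective y →
          (∀ i, (x i).box = b) → (∀ i, (y i).box = b) →
          HardcoreWavelet.rhoCumul (lp.single 2 N (Ψ t)) b
              (HardcoreWavelet.ket L x) (HardcoreWavelet.ket L y) =
            ∑ q : Fin M → Fin N, Matrix.det (Matrix.of fun i j : Fin M =>
              HardcoreWavelet.psi L ψt t (x i) (α (q i)) *
                star (HardcoreWavelet.psi L ψt t (y i) (α (q j))))) ∧
        (∀ (M M' : ℕ) (x : Fin M → HardcoreWavelet.Wavelet n)
          (y : Fin M' → HardcoreWavelet.Wavelet n),
          M ≠ M' → Function.Injective x → Function.Injective y →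
          (∀ i, (x i).box = b) → (∀ i, (y i).box = b) →
          HardcoreWavelet.rhoCumul (lp.single 2 N (Ψ t)) b
            (HardcoreWavelet.ket L x) (HardcoreWavelet.ket L y) = 0) := by
  refine ⟨HardcoreWavelet.existsUnique_evolution hL hv α,
    HardcoreWavelet.existsUnique_psiTilde hL hn hv, fun Ψ ψt hΨ hψ t b => ?_⟩
  -- Uniqueness replaces an arbitrary solution by the explicit Slater determinant of evolved
  -- orbitals.
  have h := hΨ.unique hL hv (HardcoreWavelet.isEvolution_evolved hL hv α)
  subst h
  refine ⟨HardcoreWavelet.summable_cumulTerm_evolved hL hn hv hα t, ?_, ?_⟩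
  · intro M x y hxi hyi hx hy
    rw [HardcoreWavelet.rhoCumul_evolved hL hn hv hα t hxi hyi hx hy]
    simp_rw [hψ.psi_eq hL hn hv]
    rfl
  · intro M M' x y hM hxi hyi hx hy
    exact HardcoreWavelet.rhoCumul_eq_zero_of_ne hL _ hM hxi hyi hx hy
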